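/- Let $p_1$ be a probability distribution on $\mathbb Z^2$ and let $X_j=X_0+\xi_1+\dots+\xi_j$, $j\ge 0$, be the random walk with i.i.d. steps $\xi_i$ of law $p_1$; $\mathbb P^x$ denotes its law when $X_0=x$, and $p_1(x,y)=p_1(y-x)$. Let $|\cdot|$ be the Euclidean norm and $\beta>0$. Assume that the walk is symmetric ($p_1(-x)=p_1(x)$), strongly aperiodic (for every $x\in\mathbb Z^2$ the set $\{x+z: p_1(z)>0\}$ generates the group $\mathbb Z^2$), that the covariance matrix of $\xi_1$ is the identity, that $\sum_x |x|^{3+2\beta}p_1(x)<\infty$, and that Condition A holds: either $p_1$ has finite support, or there are $c>0$ and $s_0$ such that for all real $s\ge s_0$ and $R\ge s$, $$\inf_{y\in\mathbb Z^2:\,R\le |y|\le R+s}\ \sum_{z\in D(0,R)}p_1(y,z)\ \ge\ c\,e^{-\beta s^{1/4}} .$$ Here $D(x,r)=\{y\in\mathbb Z^2: |y-x|<r\}$. For $A\subseteq \mathbb Z^2$ and $s\ge 0$ let $\partial A_s=\{y\in A^c:\ \inf_{x\in A}|y-x|\le s\}$; for $B\subseteq\mathbb Z^2$ let $T_B=\inf\{i\ge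 0: X_i\in B\}$ and $H_B(x,y)=\mathbb P^x(T_B<\infty,\ X_{T_B}=y)$. Then there are constants $C<\infty$ and $N\in\mathbb N$, depending only on $p_1$ and $\beta$, such that for all integers $n\ge N$ and all real $r,R$ with $e^n\le r=R/n^3$ the following hold. (1) For all $x,x'\in D(0,r)$ and all $y\in\partial D(0,R)_{n^4}$, $$\bigl|H_{D(0,R)^c}(x,y)-H_{D(0,R)^c}(x',y)\bigr|\le C n^{-3}\,H_{D(0,R)^c}(x',y).$$ (2) For all $x\in\partial D(0,r)_{n^4}$ and all $y\in\partial D(0,R)_{n^4}$, writing $q(x)=\mathbb P^x\bigl(T_{D(0,R)^c}<T_{D(0,r/n^3)}\bigr)$, $$\bigl|\mathbb P^x\bigl(X_{T_{D(0,R)^c}}=y,\ T_{D(0,R)^c}<T_{D(0,r/n^3)}\bigr)-q(x)\,H_{D(0,R)^c}(x,y)\bigr|\le C n^{-3}\,q(x)\,H_{D(0,R)^c}(x,y).$$ That is, uniformly, $H_{D(0,R)^c}(x,y)=(1+O(n^{-3}))H_{D(0,R)^c}(x',y)$ and $\mathbb P^x(X_{T_{D(0,R)^c}}=y,\ T_{D(0,R)^c}<T_{D(0,r/n^3)})=(1+O(n^{-3}))\,\mathbb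 P^x(T_{D(0,R)^c}<T_{D(0,r/n^3)})\,H_{D(0,R)^c}(x,y)$ as $n\to\infty$. -/

import Mathlib

namespace PlanarWalk

open MeasureTheory

noncomputable section

/-- The Euclidean norm `|x|` of a lattice point. -/
def euclid (x : ℤ × ℤ) : ℝ := Real.sqrt ((x.1 : ℝ) ^ 2 + (x.2 : ℝ) ^ 2)

/-- The discrete disc `D(x, r) = {y ∈ ℤ² : |y - x| < r}`. -/
def disc (x : ℤ × ℤ) (r : ℝ) : Set (ℤ × ℤ) := {y | euclid (y - x) < r}

/-- The `s`-band `∂A_s = {y ∈ Aᶜ : inf_{x ∈ A} |y - x| ≤ s}`; the infimum is taken in the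
extended reals, so that it is `+∞` for empty `A`. -/
def band (A : Set (ℤ × ℤ)) (s : ℝ) : Set (ℤ × ℤ) :=
  {y | y ∉ A ∧ (⨅ x ∈ A, ((euclid (y - x) : ℝ) : EReal)) ≤ (s : EReal)}

/-! ### Step distributions -/

/-- The one-step probability `p₁(x) = P⁰(X₁ = x)` as a real number. -/
def step (p : PMF (ℤ × ℤ)) (x : ℤ × ℤ) : ℝ := (p x).toReal

/-- The one-step transition probability `p₁(x, y) = Pˣ(X₁ = y)`. -/
def trans (p : PMF (ℤ × ℤ)) (x y : ℤ × ℤ) : ℝ := step p (y - x)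

/-- The walk is symmetric. -/
def IsSymmetric (p : PMF (ℤ × ℤ)) : Prop := ∀ x, p (-x) = p x

/-- Strong aperiodicity in the sense of Spitzer: for every `x`, the translate by `x` of the
support of the step distribution generates the group `ℤ²`. -/
def IsStronglyAperiodic (p : PMF (ℤ × ℤ)) : Prop :=
  ∀ x : ℤ × ℤ, AddSubgroup.closure ((fun z => x + z) '' p.support) = ⊤

/-- `E |X₁|^q < ∞`. -/
def HasMoment (p : PMF (ℤ × ℤ)) (q : ℝ) : Prop :=
  Summable fun x : ℤ × ℤ => euclid x ^ q * step p x

/-- The matrix of second moments of the step is the identity (for a symmetric walk this is its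
covariance matrix). -/
def HasIdentityCovariance (p : PMF (ℤ × ℤ)) : Prop :=
  HasSum (fun x : ℤ × ℤ => (x.1 : ℝ) ^ 2 * step p x) 1 ∧
  HasSum (fun x : ℤ × ℤ => (x.2 : ℝ) ^ 2 * step p x) 1 ∧
  HasSum (fun x : ℤ × ℤ => (x.1 : ℝ) * (x.2 : ℝ) * step p x) 0

/-- Condition A with parameter `β`: either the walk has finite range, or, for some `c > 0` and all
sufficiently large `s`, for every `R ≥ s` and every lattice point `y` with `R ≤ |y| ≤ R + s`, the
probability to jump from `y` into `D(0, R)` is at least `c exp(-β s^{1/4})`. -/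
def ConditionA (p : PMF (ℤ × ℤ)) (β : ℝ) : Prop :=
  p.support.Finite ∨
  ∃ c : ℝ, 0 < c ∧ ∃ s₀ : ℝ, ∀ s R : ℝ, s₀ ≤ s → s ≤ R →
    ∀ y : ℤ × ℤ, R ≤ euclid y → euclid y ≤ R + s →
      c * Real.exp (-(β * s ^ (1 / 4 : ℝ))) ≤ ∑' z : disc 0 R, trans p y z

/-! ### The random walk and its exit distributions -/

/-- The law of the i.i.d. sequence of steps, on the space of all step sequences. -/
def stepsLaw (p : PMF (ℤ × ℤ)) : Measure (ℕ → ℤ × ℤ) :=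
  Measure.infinitePi fun _ : ℕ => p.toMeasure

/-- The walk started at `x`: `X_j = x + ξ₀ + ⋯ + ξ_{j-1}`. -/
def walk (x : ℤ × ℤ) (j : ℕ) (ξ : ℕ → ℤ × ℤ) : ℤ × ℤ := x + ∑ i ∈ Finset.range j, ξ i

/-- `T_B = inf {i ≥ 0 : X_i ∈ B}` for the walk started at `x` (`⊤` if `B` is never hit). -/
def hitTime (x : ℤ × ℤ) (B : Set (ℤ × ℤ)) (ξ : ℕ → ℤ × ℤ) : WithTop ℕ :=
  hittingAfter (walk x) B 0 ξ

/-- The event `{T_B < ∞, X_{T_B} = y}` for the walk started at `x`. -/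
def hitsAt (x : ℤ × ℤ) (B : Set (ℤ × ℤ)) (y : ℤ × ℤ) : Set (ℕ → ℤ × ℤ) :=
  {ξ | ∃ j : ℕ, hitTime x B ξ = (j : WithTop ℕ) ∧ walk x j ξ = y}

/-- The event `{T_A < T_B}` for the walk started at `x`. -/
def hitsBefore (x : ℤ × ℤ) (A B : Set (ℤ × ℤ)) : Set (ℕ → ℤ × ℤ) :=
  {ξ | hitTime x A ξ < hitTime x B ξ}

/-- The hitting distribution `H_A(x, y) = Pˣ(X_{T_A} = y)`. -/
def hitDist (p : PMF (ℤ × ℤ)) (A : Set (ℤ × ℤ)) (x y : ℤ × ℤ) : ℝ :=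
  (stepsLaw p).real (hitsAt x A y)

end

end PlanarWalk

/-! Fix `y` outside `D(0,R)` and put `f z = hitDist p (disc 0 R)ᶜ z y`. This function takes values
in `[0,1]` and is harmonic for the transition operator `P` inside the disc (first-step analysis,
`reachProb_eq_transOp`). Part (1) is a quantitative Harnack inequality for `f`. The difficulty is
that long jumps make `f` only approximately a local object, while `f` itself may be very small. All
errors must therefore be relative to an average of `f`.

Harnack (`exists_harnack`) works at a scale `ρ = l ^ 32` comparable to `R`. Powers of `P` smooth: `P
^ m` dominates a lazy translation, and a binomial estimate in the operator algebra gives total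
variation `O(d / √N)` after `m N` steps, without a local limit theorem
(`exists_abs_iterate_transOp_sub_le`). Applied to `f` times a cutoff, this makes `f` nearly constant
on the scale `a = l ^ 22` (`exists_abs_sub_le_of_harmonic`). Summation by parts against a difference
of regularised logarithms shows that averages of `f` over bumps of widths `a` and `ρ` nearly agree
(`abs_sum_bump_sub_le`). Hence `f x` is nearly a multiple of its average over a bump of width `ρ`
centred at `x`, and that average is Lipschitz in `x`. The supremum of `f` needed for the error terms
is bounded by its average through a bootstrap (`exists_le_discAvg`). Doubling (`sum_discF_le_half`)
bounds the average over a large disc by the average over a bump.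

What remains is the error from long jumps, about `ρ² log ρ · P(|ξ| ≥ ρ)`, which the moment
assumption bounds by `R ^ (-1 - 2β) log R`. It must be small compared with the average of `f`. A
barrier argument (`sum_step_le_sum_discF`) shows that this average is at least a multiple of `1 / R`
times the probability of jumping from `y` into the disc. Condition A at `s = n ^ 4` bounds that
probability below by `c e ^ (-β n)`, unless it vanishes (possible only for finite range), in which
case `f = 0` in the disc. Since `R ≥ e ^ n`, the ratio is at most `n ^ (-3)`.

For part (2), let `B = D(0, r / n³)`. Conditioning on the first visit to `B`, where `f` is `(1 +
O(n⁻³)) f x` by part (1), gives `|J - q f(x)| ≤ C n⁻³ f(x)`, where `J` is the probability of exiting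
at `y` before visiting `B` (`reachProb_sub_le`). A logarithmic potential shows `q ≥ 1/8`
(`eventually_le_reachProb`), which turns this into an error relative to `q f(x)`. -/

namespace PlanarWalk

open MeasureTheory

/-! ### The Euclidean norm on the lattice -/

lemma euclid_eq_norm (x : ℤ × ℤ) : euclid x = ‖(⟨x.1, x.2⟩ : ℂ)‖ := by
  rw [Complex.norm_def, Complex.normSq_apply, euclid]
  congr 1
  ring

lemma euclid_nonneg (x : ℤ × ℤ) : 0 ≤ euclid x := Real.sqrt_nonneg _

@[simp] lemma euclid_zero : euclid 0 = 0 := by simp [euclid]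

lemma euclid_sq (x : ℤ × ℤ) : euclid x ^ 2 = (x.1 : ℝ) ^ 2 + (x.2 : ℝ) ^ 2 :=
  Real.sq_sqrt (by positivity)

@[simp] lemma euclid_neg (x : ℤ × ℤ) : euclid (-x) = euclid x := by
  simp [euclid]

lemma euclid_add_le (x y : ℤ × ℤ) : euclid (x + y) ≤ euclid x + euclid y := by
  simp only [euclid_eq_norm]
  have h : (⟨(x + y).1, (x + y).2⟩ : ℂ) = ⟨x.1, x.2⟩ + ⟨y.1, y.2⟩ := by
    apply Complex.ext <;> simp
  rw [h]
  exact norm_add_le _ _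

lemma euclid_sub_comm (x y : ℤ × ℤ) : euclid (x - y) = euclid (y - x) := by
  rw [← euclid_neg, neg_sub]

lemma euclid_sub_le (x y z : ℤ × ℤ) : euclid (x - z) ≤ euclid (x - y) + euclid (y - z) := by
  have := euclid_add_le (x - y) (y - z)
  simpa using this

lemma euclid_le_add_sub (x y : ℤ × ℤ) : euclid x ≤ euclid y + euclid (x - y) := by
  have := euclid_add_le y (x - y)
  simpa using this

lemma abs_fst_le_euclid (x : ℤ × ℤ) : |(x.1 : ℝ)| ≤ euclid x := by
  rw [euclid]
  exact Real.abs_le_sqrt (by nlinarith [sq_nonneg (x.2 : ℝ)])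

lemma abs_snd_le_euclid (x : ℤ × ℤ) : |(x.2 : ℝ)| ≤ euclid x := by
  rw [euclid]
  exact Real.abs_le_sqrt (by nlinarith [sq_nonneg (x.1 : ℝ)])

/-- The Euclidean inner product of two lattice points. -/
def dot (x y : ℤ × ℤ) : ℝ := x.1 * y.1 + x.2 * y.2

lemma dot_sq_le (x y : ℤ × ℤ) : dot x y ^ 2 ≤ euclid x ^ 2 * euclid y ^ 2 := by
  rw [euclid_sq, euclid_sq, dot]
  nlinarith [sq_nonneg ((x.1 : ℝ) * y.2 - x.2 * y.1)]

lemma abs_dot_le (x y : ℤ × ℤ) : |dot x y| ≤ euclid x * euclid y := by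
  apply abs_le_of_sq_le_sq _ (mul_nonneg (euclid_nonneg _) (euclid_nonneg _))
  rw [mul_pow]
  exact dot_sq_le x y

lemma euclid_add_sq (x y : ℤ × ℤ) :
    euclid (x + y) ^ 2 = euclid x ^ 2 + 2 * dot x y + euclid y ^ 2 := by
  simp only [euclid_sq, dot, Prod.fst_add, Prod.snd_add, Int.cast_add]
  ring

/-! ### Discs as finite sets -/

lemma mem_disc {x y : ℤ × ℤ} {r : ℝ} : y ∈ disc x r ↔ euclid (y - x) < r := Iff.rfl

lemma mem_disc_zero {y : ℤ × ℤ} {r : ℝ} : y ∈ disc 0 r ↔ euclid y < r := by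
  simp [mem_disc]

lemma disc_finite (x : ℤ × ℤ) (r : ℝ) : (disc x r).Finite := by
  apply ((Set.finite_Icc (x.1 - ⌈r⌉) (x.1 + ⌈r⌉)).prod
    (Set.finite_Icc (x.2 - ⌈r⌉) (x.2 + ⌈r⌉))).subset
  intro y hy
  have hy' : euclid (y - x) < r := hy
  have h1 := abs_le.mp ((abs_fst_le_euclid (y - x)).trans (hy'.le.trans (Int.le_ceil r)))
  have h2 := abs_le.mp ((abs_snd_le_euclid (y - x)).trans (hy'.le.trans (Int.le_ceil r)))
  simp only [Prod.fst_sub, Prod.snd_sub] at h1 h2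
  norm_cast at h1 h2
  simp only [Set.mem_prod, Set.mem_Icc]
  omega

/-- The disc `D(x, r)` as a finite set. -/
noncomputable def discF (x : ℤ × ℤ) (r : ℝ) : Finset (ℤ × ℤ) := (disc_finite x r).toFinset

@[simp] lemma mem_discF {x y : ℤ × ℤ} {r : ℝ} : y ∈ discF x r ↔ euclid (y - x) < r := by
  simp [discF, disc]

lemma card_discF_le (x : ℤ × ℤ) {r : ℝ} (hr : 1 ≤ r) : ((discF x r).card : ℝ) ≤ 25 * r ^ 2 := by
  have hsub : discF x r ⊆ Finset.Icc (x.1 - ⌈r⌉) (x.1 + ⌈r⌉) ×ˢ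
      Finset.Icc (x.2 - ⌈r⌉) (x.2 + ⌈r⌉) := by
    intro y hy
    rw [mem_discF] at hy
    have h1 := abs_le.mp ((abs_fst_le_euclid (y - x)).trans (hy.le.trans (Int.le_ceil r)))
    have h2 := abs_le.mp ((abs_snd_le_euclid (y - x)).trans (hy.le.trans (Int.le_ceil r)))
    simp only [Prod.fst_sub, Prod.snd_sub] at h1 h2
    norm_cast at h1 h2
    simp only [Finset.mem_product, Finset.mem_Icc]
    omega
  have hcard := Finset.card_le_card hsub
  rw [Finset.card_product, Int.card_Icc, Int.card_Icc] at hcard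
  have hc0 : 0 ≤ ⌈r⌉ := Int.ceil_nonneg (by linarith)
  have e1 : (x.1 + ⌈r⌉ + 1 - (x.1 - ⌈r⌉)) = 2 * ⌈r⌉ + 1 := by ring
  have e2 : (x.2 + ⌈r⌉ + 1 - (x.2 - ⌈r⌉)) = 2 * ⌈r⌉ + 1 := by ring
  rw [e1, e2] at hcard
  have h3 : (((2 * ⌈r⌉ + 1).toNat : ℕ) : ℝ) = 2 * (⌈r⌉ : ℝ) + 1 := by
    have : (((2 * ⌈r⌉ + 1).toNat : ℕ) : ℤ) = 2 * ⌈r⌉ + 1 := Int.toNat_of_nonneg (by omega)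
    exact_mod_cast this
  have h4 : ((discF x r).card : ℝ) ≤ (2 * (⌈r⌉ : ℝ) + 1) * (2 * (⌈r⌉ : ℝ) + 1) := by
    rw [← h3]; exact_mod_cast hcard
  have h5 : (⌈r⌉ : ℝ) < r + 1 := Int.ceil_lt_add_one r
  have h6 : (0 : ℝ) ≤ ⌈r⌉ := by exact_mod_cast hc0
  nlinarith

lemma le_card_discF (x : ℤ × ℤ) {r : ℝ} (hr : 0 < r) : r ^ 2 / 4 ≤ ((discF x r).card : ℝ) := by
  -- The inscribed square of half-side `⌊r/2⌋` has circumradius at most `r / √2`, which keeps it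
  -- inside the open disc.
  set k : ℤ := ⌊r / 2⌋ with hk
  have hk0 : 0 ≤ k := Int.floor_nonneg.mpr (by positivity)
  have hsub : Finset.Icc (x.1 - k) (x.1 + k) ×ˢ Finset.Icc (x.2 - k) (x.2 + k) ⊆ discF x r := by
    intro y hy
    simp only [Finset.mem_product, Finset.mem_Icc] at hy
    rw [mem_discF]
    have hkr : (k : ℝ) ≤ r / 2 := Int.floor_le _
    have h1 : |((y - x).1 : ℝ)| ≤ k := by
      rw [abs_le]; constructor <;> (simp only [Prod.fst_sub]; norm_cast; omega)
    have h2 : |((y - x).2 : ℝ)| ≤ k := by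
      rw [abs_le]; constructor <;> (simp only [Prod.snd_sub]; norm_cast; omega)
    have h3 : euclid (y - x) ^ 2 < r ^ 2 := by
      rw [euclid_sq, ← sq_abs, ← sq_abs ((y - x).2 : ℝ)]
      nlinarith [abs_nonneg ((y - x).1 : ℝ), abs_nonneg ((y - x).2 : ℝ)]
    exact lt_of_pow_lt_pow_left₀ 2 hr.le h3
  have hcard := Finset.card_le_card hsub
  rw [Finset.card_product, Int.card_Icc, Int.card_Icc] at hcard
  have e1 : (x.1 + k + 1 - (x.1 - k)) = 2 * k + 1 := by ring
  have e2 : (x.2 + k + 1 - (x.2 - k)) = 2 * k + 1 := by ring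
  rw [e1, e2] at hcard
  have h3 : (((2 * k + 1).toNat : ℕ) : ℝ) = 2 * (k : ℝ) + 1 := by
    have : (((2 * k + 1).toNat : ℕ) : ℤ) = 2 * k + 1 := Int.toNat_of_nonneg (by omega)
    exact_mod_cast this
  have h4 : (2 * (k : ℝ) + 1) * (2 * (k : ℝ) + 1) ≤ ((discF x r).card : ℝ) := by
    rw [← h3]; exact_mod_cast hcard
  have h5 : r / 2 < k + 1 := Int.lt_floor_add_one _
  have h6 : (0 : ℝ) ≤ k := by exact_mod_cast hk0
  nlinarith

/-! ### The transition operator -/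

lemma step_nonneg (p : PMF (ℤ × ℤ)) (z : ℤ × ℤ) : 0 ≤ step p z := ENNReal.toReal_nonneg

lemma hasSum_step (p : PMF (ℤ × ℤ)) : HasSum (step p) 1 := by
  have h := ENNReal.hasSum_toReal (f := fun z => p z) (by rw [p.tsum_coe]; simp)
  rw [← ENNReal.tsum_toReal_eq (fun z => p.apply_ne_top z), p.tsum_coe] at h
  rw [ENNReal.toReal_one] at h
  exact h

lemma summable_step (p : PMF (ℤ × ℤ)) : Summable (step p) := (hasSum_step p).summable

lemma tsum_step (p : PMF (ℤ × ℤ)) : ∑' z, step p z = 1 := (hasSum_step p).tsum_eq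

lemma step_neg {p : PMF (ℤ × ℤ)} (hp : IsSymmetric p) (z : ℤ × ℤ) : step p (-z) = step p z := by
  rw [step, hp, step]

lemma step_sub_comm {p : PMF (ℤ × ℤ)} (hp : IsSymmetric p) (x y : ℤ × ℤ) :
    step p (x - y) = step p (y - x) := by
  rw [← step_neg hp, neg_sub]

/-- The transition operator `P f(x) = E f(x + ξ)` of the walk. -/
noncomputable def transOp (p : PMF (ℤ × ℤ)) (f : ℤ × ℤ → ℝ) (x : ℤ × ℤ) : ℝ :=
  ∑' z, step p z * f (x + z)

variable {p : PMF (ℤ × ℤ)}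

lemma summable_step_mul {g : ℤ × ℤ → ℝ} {B : ℝ} (hg : ∀ z, |g z| ≤ B) :
    Summable fun z => step p z * g z := by
  apply Summable.of_norm_bounded ((summable_step p).mul_right B)
  intro z
  rw [norm_mul, Real.norm_eq_abs, Real.norm_eq_abs, abs_of_nonneg (step_nonneg p z)]
  exact mul_le_mul_of_nonneg_left (hg z) (step_nonneg p z)

/-- Boundedness of a real function. -/
def Bdd (f : ℤ × ℤ → ℝ) : Prop := ∃ B : ℝ, ∀ z, |f z| ≤ B

lemma Bdd.summable {f : ℤ × ℤ → ℝ} (hf : Bdd f) (x : ℤ × ℤ) :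
    Summable fun z => step p z * f (x + z) := by
  obtain ⟨B, hB⟩ := hf
  exact summable_step_mul fun z => hB (x + z)

lemma Bdd.add {f g : ℤ × ℤ → ℝ} (hf : Bdd f) (hg : Bdd g) : Bdd fun z => f z + g z := by
  obtain ⟨B, hB⟩ := hf
  obtain ⟨B', hB'⟩ := hg
  exact ⟨B + B', fun z => (abs_add_le _ _).trans (add_le_add (hB z) (hB' z))⟩

lemma Bdd.sub {f g : ℤ × ℤ → ℝ} (hf : Bdd f) (hg : Bdd g) : Bdd fun z => f z - g z := by
  obtain ⟨B, hB⟩ := hf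
  obtain ⟨B', hB'⟩ := hg
  exact ⟨B + B', fun z => (abs_sub _ _).trans (add_le_add (hB z) (hB' z))⟩

lemma Bdd.mul {f g : ℤ × ℤ → ℝ} (hf : Bdd f) (hg : Bdd g) : Bdd fun z => f z * g z := by
  obtain ⟨B, hB⟩ := hf
  obtain ⟨B', hB'⟩ := hg
  refine ⟨B * B', fun z => ?_⟩
  rw [abs_mul]
  exact mul_le_mul (hB z) (hB' z) (abs_nonneg _) ((abs_nonneg _).trans (hB z))

lemma Bdd.const (c : ℝ) : Bdd fun _ => c := ⟨|c|, fun _ => le_rfl⟩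

lemma Bdd.indicator {f : ℤ × ℤ → ℝ} (hf : Bdd f) (E : Set (ℤ × ℤ)) :
    Bdd fun w => E.indicator f w := by
  obtain ⟨B, hB⟩ := hf
  refine ⟨B, fun z => ?_⟩
  by_cases hz : z ∈ E
  · simpa only [Set.indicator_of_mem hz] using hB z
  · simpa only [Set.indicator_of_notMem hz, abs_zero] using (abs_nonneg _).trans (hB z)

lemma Bdd.of_mem_Icc {f : ℤ × ℤ → ℝ} {a b : ℝ} (h : ∀ z, f z ∈ Set.Icc a b) : Bdd f :=
  ⟨max |a| |b|, fun z => abs_le_max_abs_abs (h z).1 (h z).2⟩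

lemma transOp_add {f g : ℤ × ℤ → ℝ} (hf : Bdd f) (hg : Bdd g) (x : ℤ × ℤ) :
    transOp p (fun z => f z + g z) x = transOp p f x + transOp p g x := by
  simp only [transOp, mul_add]
  exact (hf.summable x).tsum_add (hg.summable x)

lemma transOp_sub {f g : ℤ × ℤ → ℝ} (hf : Bdd f) (hg : Bdd g) (x : ℤ × ℤ) :
    transOp p (fun z => f z - g z) x = transOp p f x - transOp p g x := by
  simp only [transOp, mul_sub]
  exact (hf.summable x).tsum_sub (hg.summable x)

lemma transOp_const_mul (c : ℝ) (f : ℤ × ℤ → ℝ) (x : ℤ × ℤ) :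
    transOp p (fun z => c * f z) x = c * transOp p f x := by
  simp only [transOp, ← tsum_mul_left]
  exact tsum_congr fun z => by ring

@[simp] lemma transOp_const (c : ℝ) (x : ℤ × ℤ) : transOp p (fun _ => c) x = c := by
  rw [transOp, tsum_mul_right, tsum_step, one_mul]

lemma transOp_mono {f g : ℤ × ℤ → ℝ} (hf : Bdd f) (hg : Bdd g) (h : ∀ z, f z ≤ g z)
    (x : ℤ × ℤ) : transOp p f x ≤ transOp p g x :=
  (hf.summable x).tsum_le_tsum (fun z => mul_le_mul_of_nonneg_left (h _) (step_nonneg p z))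
    (hg.summable x)

lemma transOp_nonneg {f : ℤ × ℤ → ℝ} (h : ∀ z, 0 ≤ f z) (x : ℤ × ℤ) : 0 ≤ transOp p f x :=
  tsum_nonneg fun z => mul_nonneg (step_nonneg p z) (h _)

lemma abs_transOp_le {f : ℤ × ℤ → ℝ} {B : ℝ} (h : ∀ z, |f z| ≤ B) (x : ℤ × ℤ) :
    |transOp p f x| ≤ B := by
  have hf : Bdd f := ⟨B, h⟩
  rw [abs_le]
  constructor
  · have := transOp_mono (p := p) (Bdd.const (-B)) hf (fun z => (abs_le.mp (h z)).1) x
    simpa using this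
  · have := transOp_mono (p := p) hf (Bdd.const B) (fun z => (abs_le.mp (h z)).2) x
    simpa using this

lemma step_mul_le_transOp {f : ℤ × ℤ → ℝ} (hf : Bdd f) (h : ∀ z, 0 ≤ f z) (x z : ℤ × ℤ) :
    step p z * f (x + z) ≤ transOp p f x :=
  (hf.summable x).le_tsum z fun w _ => mul_nonneg (step_nonneg p w) (h _)

lemma transOp_eq_tsum_sub (p : PMF (ℤ × ℤ)) (f : ℤ × ℤ → ℝ) (x : ℤ × ℤ) :
    transOp p f x = ∑' w, step p (w - x) * f w := by
  rw [transOp, ← (Equiv.addLeft x).tsum_eq (fun w => step p (w - x) * f w)]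
  simp

/-- The transition operator on finitely supported functions. -/
lemma transOp_eq_sum {f : ℤ × ℤ → ℝ} (E : Finset (ℤ × ℤ)) (h : ∀ z, z ∉ E → f z = 0)
    (x : ℤ × ℤ) : transOp p f x = ∑ w ∈ E, step p (w - x) * f w := by
  rw [transOp_eq_tsum_sub]
  exact tsum_eq_sum fun z hz => by rw [h z hz, mul_zero]

/-- Summation by parts for the symmetric operator `P - 1`. -/
lemma sum_mul_transOp_sub (hp : IsSymmetric p) (E : Finset (ℤ × ℤ)) {f v : ℤ × ℤ → ℝ}
    (hf : Bdd f) (hv : ∀ z, z ∉ E → v z = 0) (hharm : ∀ z ∈ E, v z ≠ 0 → transOp p f z = f z) :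
    ∑ w ∈ E, f w * (transOp p v w - v w)
      = -∑ z ∈ E, v z * transOp p (fun w => (E : Set (ℤ × ℤ))ᶜ.indicator f w) z := by
  classical
  -- Only the restriction of `f` to `E` takes part in the symmetric exchange of sums. The rest of `P
  -- f` is what long jumps out of `E` see, and it forms the right-hand side. Harmonicity is used
  -- only through the product with `v`, so it is needed only where `v` does not vanish.
  have hsplit : ∀ z, transOp p f z = ∑ w ∈ E, step p (w - z) * f w
      + transOp p (fun w => (E : Set (ℤ × ℤ))ᶜ.indicator f w) z := by
    intro z
    have h1 := hf.indicator (E : Set (ℤ × ℤ))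
    have h2 := hf.indicator (E : Set (ℤ × ℤ))ᶜ
    have h3 : f = fun w => (E : Set (ℤ × ℤ)).indicator f w + (E : Set (ℤ × ℤ))ᶜ.indicator f w := by
      funext w; exact (congrFun (Set.indicator_self_add_compl _ f) w).symm
    conv_lhs => rw [h3]
    rw [transOp_add h1 h2]
    congr 1
    rw [transOp_eq_sum E (fun z hz => Set.indicator_of_notMem (by simpa using hz) f)]
    exact Finset.sum_congr rfl fun w hw => by rw [Set.indicator_of_mem (by simpa using hw)]
  have hz : ∀ z ∈ E, v z * f z = v z * (∑ w ∈ E, step p (w - z) * f w)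
      + v z * transOp p (fun w => (E : Set (ℤ × ℤ))ᶜ.indicator f w) z := by
    intro z hzE
    rw [← mul_add, ← hsplit]
    by_cases h0 : v z = 0
    · simp [h0]
    · rw [hharm z hzE h0]
  have hsum := Finset.sum_congr (rfl : E = E) hz
  rw [Finset.sum_add_distrib] at hsum
  have hswap : ∑ z ∈ E, v z * (∑ w ∈ E, step p (w - z) * f w)
      = ∑ w ∈ E, f w * transOp p v w := by
    simp only [Finset.mul_sum]
    rw [Finset.sum_comm]
    refine Finset.sum_congr rfl fun w _ => ?_
    rw [transOp_eq_sum E hv, Finset.mul_sum]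
    exact Finset.sum_congr rfl fun z _ => by rw [step_sub_comm hp]; ring
  rw [hswap] at hsum
  simp only [mul_sub, Finset.sum_sub_distrib]
  have : ∑ w ∈ E, f w * v w = ∑ w ∈ E, v w * f w := Finset.sum_congr rfl fun w _ => mul_comm _ _
  rw [this, hsum]
  ring

/-! ### The maximum principle -/

/-- A bounded-above subharmonic function on a finite set that is nonpositive off the set is
nonpositive, as soon as the walk can move. -/
theorem nonpos_of_subharmonic {D : Set (ℤ × ℤ)} (hD : D.Finite) {s : ℤ × ℤ} (hs0 : s ≠ 0)
    (hs : 0 < step p s) {u : ℤ × ℤ → ℝ} (hu : Bdd u) (hsub : ∀ x ∈ D, u x ≤ transOp p u x)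
    (hout : ∀ x, x ∉ D → u x ≤ 0) (x : ℤ × ℤ) : u x ≤ 0 := by
  by_contra! hx
  have hxD : x ∈ D := by
    by_contra h
    exact absurd (hout x h) (not_le.mpr hx)
  obtain ⟨m, hmD, hm⟩ := hD.exists_maximalFor u D ⟨x, hxD⟩
  have hmax : ∀ z ∈ D, u z ≤ u m := fun z hz => by
    rcases le_total (u z) (u m) with h | h
    · exact h
    · exact hm hz h
  have hmpos : 0 < u m := hx.trans_le (hmax x hxD)
  have hmax' : ∀ z, u z ≤ u m := fun z => by
    by_cases hz : z ∈ D
    · exact hmax z hz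
    · exact (hout z hz).trans hmpos.le
  -- A maximum equal to an average over steps propagates along every possible step. Following `s`
  -- forever gives infinitely many points with the positive value `u m`, and these cannot all lie in
  -- the finite set `D`.
  have hstep : ∀ k : ℕ, u (m + k • s) = u m := by
    intro k
    induction k with
    | zero => simp
    | succ k ih =>
      have hkD : m + k • s ∈ D := by
        by_contra h
        have := hout _ h
        linarith
      have h1 := hsub _ hkD
      have hb : Bdd fun z => u m - u z := (Bdd.const _).sub hu
      have h2 := step_mul_le_transOp (p := p) hb (fun z => sub_nonneg.mpr (hmax' z))
        (m + k • s) s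
      rw [transOp_sub (Bdd.const _) hu, transOp_const] at h2
      have h3 : step p s * (u m - u (m + k • s + s)) ≤ 0 := by linarith
      have h4 : u m - u (m + k • s + s) ≤ 0 := by
        by_contra! h
        exact absurd h3 (not_le.mpr (mul_pos hs h))
      have h5 := hmax' (m + k • s + s)
      rw [succ_nsmul, ← add_assoc]
      linarith
  have hinf : Set.Infinite (Set.range fun k : ℕ => m + k • s) := by
    apply Set.infinite_range_of_injective
    intro i j hij
    have h1 : i • s = j • s := add_left_cancel hij
    have h2 : (i : ℤ) • s = (j : ℤ) • s := by simpa using h1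
    have h3 := smul_left_injective ℤ hs0 h2
    exact_mod_cast h3
  apply hinf
  apply hD.subset
  rintro _ ⟨k, rfl⟩
  by_contra h
  have h1 := hout _ h
  have h2 := hstep k
  simp only at h1
  linarith

end PlanarWalk

namespace PlanarWalk

open MeasureTheory

/-! ### First-step analysis on the path space -/

/-- Prepend a step to a sequence of steps. -/
def consStep (q : (ℤ × ℤ) × (ℕ → ℤ × ℤ)) : ℕ → ℤ × ℤ := fun n => Nat.casesOn n q.1 q.2

@[simp] lemma consStep_zero (q : (ℤ × ℤ) × (ℕ → ℤ × ℤ)) : consStep q 0 = q.1 := rfl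

@[simp] lemma consStep_succ (q : (ℤ × ℤ) × (ℕ → ℤ × ℤ)) (n : ℕ) :
    consStep q (n + 1) = q.2 n := rfl

lemma measurable_consStep : Measurable consStep := by
  rw [measurable_pi_iff]
  intro n
  cases n with
  | zero => exact measurable_fst
  | succ n => exact (measurable_pi_apply n).comp measurable_snd

instance (p : PMF (ℤ × ℤ)) : IsProbabilityMeasure (stepsLaw p) := by
  unfold stepsLaw; infer_instance

/-- This is the Markov property at time one: an independent step followed by an i.i.d. sequence is
again an i.i.d. sequence. A product measure is determined by its values on cylinders, so only these
are compared. -/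
lemma map_consStep (p : PMF (ℤ × ℤ)) :
    (p.toMeasure.prod (stepsLaw p)).map consStep = stepsLaw p := by
  apply Measure.eq_infinitePi
  intro s t ht
  have hmeas : MeasurableSet (Set.pi (s : Set ℕ) t) :=
    MeasurableSet.pi s.countable_toSet fun i _ => ht i
  rw [Measure.map_apply measurable_consStep hmeas]
  classical
  -- Padding with full factors turns the index set of the cylinder into an initial segment, from
  -- which coordinate `0` splits off.
  set t' : ℕ → Set (ℤ × ℤ) := fun i => if i ∈ s then t i else Set.univ with ht'
  obtain ⟨N, hN⟩ : ∃ N, s ⊆ Finset.range (N + 1) := by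
    obtain ⟨N, hN⟩ := s.exists_nat_subset_range
    exact ⟨N, hN.trans (Finset.range_mono (Nat.le_succ N))⟩
  have hpre : consStep ⁻¹' (Set.pi (s : Set ℕ) t)
      = t' 0 ×ˢ Set.pi (Finset.range N : Set ℕ) (fun i => t' (i + 1)) := by
    ext ⟨z, ξ⟩
    simp only [Set.mem_preimage, Set.mem_pi, Finset.mem_coe, Set.mem_prod, Finset.mem_range, ht']
    constructor
    · intro h
      refine ⟨?_, fun i _ => ?_⟩
      · split_ifs with h0
        · exact h 0 h0
        · trivial
      · split_ifs with h0
        · exact h (i + 1) h0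
        · trivial
    · rintro ⟨h0, h1⟩ i hi
      cases i with
      | zero => simpa [hi] using h0
      | succ i =>
        have hiN : i < N := by
          have := Finset.mem_range.mp (hN hi); omega
        simpa [hi] using h1 i hiN
  have ht'm : ∀ i, MeasurableSet (t' i) := fun i => by
    simp only [ht']; split_ifs
    · exact ht i
    · exact MeasurableSet.univ
  rw [hpre, Measure.prod_prod, stepsLaw, Measure.infinitePi_pi _ (fun i _ => ht'm _)]
  have hprod : ∏ i ∈ s, p.toMeasure (t i) = ∏ i ∈ Finset.range (N + 1), p.toMeasure (t' i) := by
    rw [← Finset.prod_subset hN]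
    · exact Finset.prod_congr rfl fun i hi => by simp [ht', hi]
    · intro i _ hi
      simp [ht', hi]
  rw [hprod, Finset.prod_range_succ', mul_comm]

lemma walk_zero (x : ℤ × ℤ) (ξ : ℕ → ℤ × ℤ) : walk x 0 ξ = x := by simp [walk]

lemma walk_succ_consStep (x : ℤ × ℤ) (j : ℕ) (q : (ℤ × ℤ) × (ℕ → ℤ × ℤ)) :
    walk x (j + 1) (consStep q) = walk (x + q.1) j q.2 := by
  simp only [walk, Finset.sum_range_succ', consStep_succ, consStep_zero]
  abel

lemma measurable_walk (x : ℤ × ℤ) (j : ℕ) : Measurable (walk x j) := by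
  unfold walk
  fun_prop

/-- The event that the walk from `x` enters `Y` without having visited `S` before. -/
def reach (x : ℤ × ℤ) (Y S : Set (ℤ × ℤ)) : Set (ℕ → ℤ × ℤ) :=
  {ξ | ∃ j, walk x j ξ ∈ Y ∧ ∀ i < j, walk x i ξ ∉ S}

lemma measurableSet_reach (x : ℤ × ℤ) (Y S : Set (ℤ × ℤ)) : MeasurableSet (reach x Y S) := by
  have : reach x Y S = ⋃ j, (walk x j ⁻¹' Y ∩ ⋂ i, ⋂ (_ : i < j), (walk x i ⁻¹' S)ᶜ) := by
    ext ξ; simp [reach]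
  rw [this]
  refine MeasurableSet.iUnion fun j => (measurable_walk x j (.of_discrete)).inter ?_
  exact MeasurableSet.iInter fun i => MeasurableSet.iInter fun _ =>
    (measurable_walk x i (.of_discrete)).compl

/-- The probability of `reach`. -/
noncomputable def reachProb (p : PMF (ℤ × ℤ)) (Y S : Set (ℤ × ℤ)) (x : ℤ × ℤ) : ℝ :=
  (stepsLaw p).real (reach x Y S)

lemma reachProb_mem_Icc (p : PMF (ℤ × ℤ)) (Y S : Set (ℤ × ℤ)) (x : ℤ × ℤ) :
    reachProb p Y S x ∈ Set.Icc (0 : ℝ) 1 :=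
  ⟨measureReal_nonneg, measureReal_le_one⟩

lemma reachProb_of_mem (p : PMF (ℤ × ℤ)) {Y S : Set (ℤ × ℤ)} {x : ℤ × ℤ} (hx : x ∈ Y) :
    reachProb p Y S x = 1 := by
  have : reach x Y S = Set.univ := by
    ext ξ
    simp only [reach, Set.mem_ofPred_eq, Set.mem_univ, iff_true]
    exact ⟨0, by rwa [walk_zero], by simp⟩
  rw [reachProb, this]
  simp

lemma reachProb_of_notMem (p : PMF (ℤ × ℤ)) {Y S : Set (ℤ × ℤ)} {x : ℤ × ℤ} (hx : x ∈ S)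
    (hxY : x ∉ Y) : reachProb p Y S x = 0 := by
  have : reach x Y S = ∅ := by
    ext ξ
    simp only [reach, Set.mem_ofPred_eq, Set.mem_empty_iff_false, iff_false]
    rintro ⟨j, hj, h⟩
    cases j with
    | zero => rw [walk_zero] at hj; exact hxY hj
    | succ j => exact h 0 (Nat.succ_pos j) (by rwa [walk_zero])
  rw [reachProb, this]
  simp

lemma preimage_reach {x : ℤ × ℤ} {Y S : Set (ℤ × ℤ)} (hx : x ∉ S) (hxY : x ∉ Y) :
    consStep ⁻¹' (reach x Y S) = {q | q.2 ∈ reach (x + q.1) Y S} := by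
  ext q
  simp only [reach, Set.mem_preimage, Set.mem_ofPred_eq]
  constructor
  · rintro ⟨j, hj, h⟩
    cases j with
    | zero => rw [walk_zero] at hj; exact absurd hj hxY
    | succ j =>
      refine ⟨j, by rwa [← walk_succ_consStep], fun i hi => ?_⟩
      rw [← walk_succ_consStep]
      exact h (i + 1) (by omega)
  · rintro ⟨j, hj, h⟩
    refine ⟨j + 1, by rwa [walk_succ_consStep], fun i hi => ?_⟩
    cases i with
    | zero => rwa [walk_zero]
    | succ i => rw [walk_succ_consStep]; exact h i (by omega)

/-- The first-step equation. -/
theorem reachProb_eq_transOp (p : PMF (ℤ × ℤ)) {Y S : Set (ℤ × ℤ)} {x : ℤ × ℤ} (hx : x ∉ S)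
    (hxY : x ∉ Y) : transOp p (reachProb p Y S) x = reachProb p Y S x := by
  have hm := measurableSet_reach x Y S
  have h1 : stepsLaw p (reach x Y S)
      = ∑' z, stepsLaw p (reach (x + z) Y S) * p z := by
    conv_lhs => rw [← map_consStep p]
    rw [Measure.map_apply measurable_consStep hm,
      Measure.prod_apply (measurable_consStep hm), lintegral_countable']
    refine tsum_congr fun z => ?_
    rw [PMF.toMeasure_apply_singleton p z (MeasurableSet.singleton z), preimage_reach hx hxY]
    rfl
  rw [reachProb, Measure.real, h1, ENNReal.tsum_toReal_eq]
  · rw [transOp]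
    refine tsum_congr fun z => ?_
    rw [ENNReal.toReal_mul, mul_comm]
    rfl
  · intro z
    exact ENNReal.mul_ne_top (measure_ne_top _ _) (p.apply_ne_top z)

/-! ### Hitting-time events as instances of `reach` -/

lemma hitTime_eq_coe_iff {x : ℤ × ℤ} {B : Set (ℤ × ℤ)} {ξ : ℕ → ℤ × ℤ} {j : ℕ} :
    hitTime x B ξ = (j : WithTop ℕ) ↔ walk x j ξ ∈ B ∧ ∀ i < j, walk x i ξ ∉ B := by
  constructor
  · intro h
    constructor
    · have h1 : hittingAfter (walk x) B 0 ξ ≠ ⊤ := by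
        change hitTime x B ξ ≠ ⊤
        rw [h]; simp
      have h2 := hittingAfter_mem_set_of_ne_top h1
      -- Membership at the hitting time is expressed through `untopA`, whose arbitrary value at `⊤`
      -- is ruled out by `h1`.
      change walk x (hitTime x B ξ).untopA ξ ∈ B at h2
      rw [h] at h2
      exact h2
    · intro i hi
      apply notMem_of_lt_hittingAfter (n := 0) _ (Nat.zero_le _)
      change (i : WithTop ℕ) < hitTime x B ξ
      rw [h]
      exact_mod_cast hi
  · rintro ⟨h1, h2⟩
    apply le_antisymm
    · exact hittingAfter_le_of_mem (Nat.zero_le _) h1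
    · by_contra! hlt
      have hne : hittingAfter (walk x) B 0 ξ ≠ ⊤ := ne_top_of_lt hlt
      have h3 := hittingAfter_mem_set_of_ne_top hne
      obtain ⟨k, hk⟩ := WithTop.ne_top_iff_exists.mp hne
      change (k : WithTop ℕ) = hitTime x B ξ at hk
      change walk x (hitTime x B ξ).untopA ξ ∈ B at h3
      rw [← hk] at h3 hlt
      exact h2 k (WithTop.coe_lt_coe.mp hlt) h3

lemma coe_lt_hitTime_iff {x : ℤ × ℤ} {B : Set (ℤ × ℤ)} {ξ : ℕ → ℤ × ℤ} {j : ℕ} :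
    (j : WithTop ℕ) < hitTime x B ξ ↔ ∀ i ≤ j, walk x i ξ ∉ B := by
  constructor
  · intro h i hi
    exact notMem_of_lt_hittingAfter (n := 0) (lt_of_le_of_lt (WithTop.coe_le_coe.mpr hi) h)
      (Nat.zero_le _)
  · intro h
    by_contra! hle
    obtain ⟨k, hk⟩ := WithTop.ne_top_iff_exists.mp (ne_top_of_le_ne_top (by simp) hle)
    rw [← hk] at hle
    have h1 := (hitTime_eq_coe_iff.mp hk.symm).1
    exact h k (WithTop.coe_le_coe.mp hle) h1

/-- The target is `{y} ∩ A` and not `{y}`, so that both sides are empty when `y ∉ A`. -/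
lemma hitsAt_eq_reach (x : ℤ × ℤ) (A : Set (ℤ × ℤ)) (y : ℤ × ℤ) :
    hitsAt x A y = reach x ({y} ∩ A) A := by
  ext ξ
  simp only [hitsAt, reach, Set.mem_ofPred_eq, hitTime_eq_coe_iff, Set.mem_inter_iff,
    Set.mem_singleton_iff]
  exact exists_congr fun j => by tauto

lemma hitsBefore_iff {x : ℤ × ℤ} {A B : Set (ℤ × ℤ)} {ξ : ℕ → ℤ × ℤ} :
    ξ ∈ hitsBefore x A B ↔ ∃ j, (walk x j ξ ∈ A ∧ ∀ i < j, walk x i ξ ∉ A) ∧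
      ∀ i ≤ j, walk x i ξ ∉ B := by
  simp only [hitsBefore, Set.mem_ofPred_eq]
  constructor
  · intro h
    obtain ⟨k, hk⟩ := WithTop.ne_top_iff_exists.mp (ne_top_of_lt h)
    refine ⟨k, hitTime_eq_coe_iff.mp hk.symm, ?_⟩
    rw [← hk] at h
    exact coe_lt_hitTime_iff.mp h
  · rintro ⟨j, h1, h2⟩
    rw [hitTime_eq_coe_iff.mpr h1]
    exact coe_lt_hitTime_iff.mpr h2

/-- The comparison of hitting times is strict, so a first entrance into `A` through a point of `B`
does not count. Removing `B` from the target encodes this. -/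
lemma hitsBefore_eq_reach (x : ℤ × ℤ) (A B : Set (ℤ × ℤ)) :
    hitsBefore x A B = reach x (A \ B) (A ∪ B) := by
  ext ξ
  rw [hitsBefore_iff]
  simp only [reach, Set.mem_ofPred_eq, Set.mem_sdiff, Set.mem_union, not_or]
  refine exists_congr fun j => ⟨?_, ?_⟩
  · rintro ⟨⟨h1, h2⟩, h3⟩
    exact ⟨⟨h1, h3 j le_rfl⟩, fun i hi => ⟨h2 i hi, h3 i hi.le⟩⟩
  · rintro ⟨⟨h1, h2⟩, h3⟩
    refine ⟨⟨h1, fun i hi => (h3 i hi).1⟩, fun i hi => ?_⟩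
    rcases hi.lt_or_eq with h | rfl
    · exact (h3 i h).2
    · exact h2

lemma hitsAt_inter_hitsBefore_eq_reach (x : ℤ × ℤ) (A B : Set (ℤ × ℤ)) (y : ℤ × ℤ) :
    hitsAt x A y ∩ hitsBefore x A B = reach x (({y} ∩ A) \ B) (A ∪ B) := by
  ext ξ
  rw [Set.mem_inter_iff, hitsBefore_iff]
  simp only [hitsAt, hitTime_eq_coe_iff, reach, Set.mem_ofPred_eq, Set.mem_sdiff, Set.mem_union,
    not_or, Set.mem_inter_iff, Set.mem_singleton_iff]
  constructor
  · rintro ⟨⟨j, ⟨h1, h2⟩, h3⟩, k, ⟨h4, h5⟩, h6⟩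
    have hjk : j = k := by
      rcases lt_trichotomy j k with h | h | h
      · exact absurd h1 (h5 j h)
      · exact h
      · exact absurd h4 (h2 k h)
    subst hjk
    exact ⟨j, ⟨⟨h3, h1⟩, h6 j le_rfl⟩, fun i hi => ⟨h2 i hi, h6 i hi.le⟩⟩
  · rintro ⟨j, ⟨⟨h1, h2⟩, h3⟩, h4⟩
    refine ⟨⟨j, ⟨h2, fun i hi => (h4 i hi).1⟩, h1⟩, j, ⟨h2, fun i hi => (h4 i hi).1⟩, ?_⟩
    intro i hi
    rcases hi.lt_or_eq with h | rfl
    · exact (h4 i h).2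
    · exact h3

lemma hitDist_eq_reachProb (p : PMF (ℤ × ℤ)) (A : Set (ℤ × ℤ)) (x y : ℤ × ℤ) :
    hitDist p A x y = reachProb p ({y} ∩ A) A x := by
  rw [hitDist, hitsAt_eq_reach, reachProb]

end PlanarWalk

namespace PlanarWalk

/-! ### Moments of the step -/

section Moments

variable {p : PMF (ℤ × ℤ)}

/-- The third absolute moment of the step. -/
noncomputable def thirdMoment (p : PMF (ℤ × ℤ)) : ℝ := ∑' z, step p z * euclid z ^ 3

lemma thirdMoment_nonneg (p : PMF (ℤ × ℤ)) : 0 ≤ thirdMoment p :=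
  tsum_nonneg fun z => mul_nonneg (step_nonneg p z) (pow_nonneg (euclid_nonneg z) 3)

lemma summable_third {q : ℝ} (hq : 3 ≤ q) (h : HasMoment p q) :
    Summable fun z => step p z * euclid z ^ 3 := by
  apply Summable.of_nonneg_of_le _ _ ((summable_step p).add h)
  · exact fun z => mul_nonneg (step_nonneg p z) (pow_nonneg (euclid_nonneg z) 3)
  · intro z
    have h1 : euclid z ^ 3 ≤ 1 + euclid z ^ q := by
      rcases le_total (euclid z) 1 with h1 | h1
      · have := pow_le_one₀ (n := 3) (euclid_nonneg z) h1
        have := Real.rpow_nonneg (euclid_nonneg z) q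
        linarith
      · have : euclid z ^ (3 : ℝ) ≤ euclid z ^ q := Real.rpow_le_rpow_of_exponent_le h1 hq
        rw [show (3 : ℝ) = ((3 : ℕ) : ℝ) by norm_num, Real.rpow_natCast] at this
        linarith
    nlinarith [step_nonneg p z]

lemma hasSum_euclid_sq (hcov : HasIdentityCovariance p) :
    HasSum (fun z => step p z * euclid z ^ 2) 2 := by
  have h := hcov.1.add hcov.2.1
  rw [show (1 : ℝ) + 1 = 2 by norm_num] at h
  convert h using 2 with z
  rw [euclid_sq]; ring

lemma _root_.HasSum.congr_fun' {ι : Type*} {f g : ι → ℝ} {a : ℝ} (h : HasSum f a)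
    (hfg : ∀ i, f i = g i) : HasSum g a := by
  rwa [← funext hfg]

lemma hasSum_dot_sq (hcov : HasIdentityCovariance p) (w : ℤ × ℤ) :
    HasSum (fun z => step p z * dot w z ^ 2) (euclid w ^ 2) := by
  have h := ((hcov.1.mul_left ((w.1 : ℝ) ^ 2)).add (hcov.2.1.mul_left ((w.2 : ℝ) ^ 2))).add
    (hcov.2.2.mul_left (2 * (w.1 : ℝ) * w.2))
  have e : euclid w ^ 2 = (w.1 : ℝ) ^ 2 * 1 + (w.2 : ℝ) ^ 2 * 1 + 2 * (w.1 : ℝ) * w.2 * 0 := by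
    rw [euclid_sq]; ring
  rw [e]
  refine h.congr_fun' fun z => ?_
  rw [dot]
  ring

lemma summable_step_mul_abs_dot (hcov : HasIdentityCovariance p) (w : ℤ × ℤ) :
    Summable fun z => step p z * |dot w z| := by
  apply Summable.of_nonneg_of_le _ _ ((summable_step p).add (hasSum_dot_sq hcov w).summable)
  · exact fun z => mul_nonneg (step_nonneg p z) (abs_nonneg _)
  · intro z
    have : |dot w z| ≤ 1 + dot w z ^ 2 := by
      nlinarith [sq_abs (dot w z), sq_nonneg (|dot w z| - 1), abs_nonneg (dot w z)]
    nlinarith [step_nonneg p z]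

lemma hasSum_dot (hp : IsSymmetric p) (hcov : HasIdentityCovariance p) (w : ℤ × ℤ) :
    HasSum (fun z => step p z * dot w z) 0 := by
  have hs : Summable fun z => step p z * dot w z := by
    apply Summable.of_norm
    convert summable_step_mul_abs_dot hcov w using 2 with z
    rw [norm_mul, Real.norm_eq_abs, Real.norm_eq_abs, abs_of_nonneg (step_nonneg p z)]
  have h0 : ∑' z, step p z * dot w z = 0 := by
    have h1 := (Equiv.neg (ℤ × ℤ)).tsum_eq fun z => step p z * dot w z
    have h2 : ∀ z, step p ((Equiv.neg (ℤ × ℤ)) z) * dot w ((Equiv.neg (ℤ × ℤ)) z)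
        = -(step p z * dot w z) := by
      intro z
      rw [Equiv.neg_apply, step_neg hp, dot, dot]
      simp only [Prod.fst_neg, Prod.snd_neg, Int.cast_neg]
      ring
    simp only [h2, tsum_neg] at h1
    linarith
  rw [← h0]
  exact hs.hasSum

/-- A lower bound for the first absolute moment in every direction. -/
lemma le_tsum_abs_dot (hcov : HasIdentityCovariance p)
    (h3 : Summable fun z => step p z * euclid z ^ 3) (w : ℤ × ℤ) :
    euclid w / (4 * (thirdMoment p + 1)) ≤ ∑' z, step p z * |dot w z| := by
  set M := thirdMoment p
  have hM : 0 ≤ M := thirdMoment_nonneg p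
  -- Truncation level: `|dot w z|²` is at most `B |w| |dot w z|` for `|z| ≤ B` and at most `|w|²
  -- |z|³ / B` otherwise. With this `B` the second part contributes at most half of the second
  -- moment `|w|²`.
  set B := 2 * (M + 1) with hB
  have hB0 : 0 < B := by positivity
  have hw := euclid_nonneg w
  have hpt : ∀ z, step p z * dot w z ^ 2
      ≤ B * euclid w * (step p z * |dot w z|) + euclid w ^ 2 / B * (step p z * euclid z ^ 3) := by
    intro z
    have h1 : dot w z ^ 2 ≤ B * euclid w * |dot w z| + euclid w ^ 2 / B * euclid z ^ 3 := by
      have hz := euclid_nonneg z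
      have h2 := abs_dot_le w z
      have h4 : |dot w z| ^ 2 = dot w z ^ 2 := sq_abs _
      have h0 := abs_nonneg (dot w z)
      rcases le_total (euclid z) B with h | h
      · have h5 : |dot w z| ^ 2 ≤ B * euclid w * |dot w z| := by
          rw [sq]
          apply mul_le_mul_of_nonneg_right _ h0
          nlinarith
        have : 0 ≤ euclid w ^ 2 / B * euclid z ^ 3 := by positivity
        linarith
      · have h5 : dot w z ^ 2 ≤ euclid w ^ 2 / B * euclid z ^ 3 := by
          rw [div_mul_eq_mul_div, le_div_iff₀ hB0]
          calc dot w z ^ 2 * B ≤ (euclid w ^ 2 * euclid z ^ 2) * euclid z :=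
                mul_le_mul (dot_sq_le w z) h hB0.le (by positivity)
            _ = euclid w ^ 2 * euclid z ^ 3 := by ring
        have : 0 ≤ B * euclid w * |dot w z| := by positivity
        linarith
    calc step p z * dot w z ^ 2 ≤ step p z * _ := mul_le_mul_of_nonneg_left h1 (step_nonneg p z)
      _ = _ := by ring
  have hsum := (hasSum_dot_sq hcov w).summable.tsum_le_tsum hpt
    (((summable_step_mul_abs_dot hcov w).mul_left _).add (h3.mul_left _))
  rw [(hasSum_dot_sq hcov w).tsum_eq,
    ((summable_step_mul_abs_dot hcov w).mul_left _).tsum_add (h3.mul_left _), tsum_mul_left,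
    tsum_mul_left] at hsum
  change euclid w ^ 2 ≤ B * euclid w * _ + euclid w ^ 2 / B * M at hsum
  have h6 : euclid w ^ 2 / B * M ≤ euclid w ^ 2 / 2 := by
    rw [div_mul_eq_mul_div, div_le_div_iff₀ hB0 two_pos, hB]
    nlinarith [sq_nonneg (euclid w)]
  set e := ∑' z, step p z * |dot w z|
  rcases hw.eq_or_lt with h0 | h0
  · rw [← h0, zero_div]
    exact tsum_nonneg fun z => mul_nonneg (step_nonneg p z) (abs_nonneg _)
  · have h7 : euclid w * euclid w ≤ euclid w * (2 * B * e) := by nlinarith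
    have h8 := le_of_mul_le_mul_left h7 h0
    rw [div_le_iff₀ (by positivity)]
    calc euclid w ≤ 2 * B * e := h8
      _ = e * (4 * (M + 1)) := by rw [hB]; ring

end Moments

/-! ### Radial Taylor expansion -/

/-- `x ↦ q(|x|²)` is a `C³` function on the plane with third derivative controlled by `M`. -/
structure RadialC3 (q q1 q2 q3 : ℝ → ℝ) (M : ℝ) : Prop where
  deriv0 : ∀ x, 0 ≤ x → HasDerivAt q (q1 x) x
  deriv1 : ∀ x, 0 ≤ x → HasDerivAt q1 (q2 x) x
  deriv2 : ∀ x, 0 ≤ x → HasDerivAt q2 (q3 x) x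
  bound2 : ∀ y, 0 ≤ y → |q2 (y ^ 2)| * y ≤ M
  bound3 : ∀ y, 0 ≤ y → |q3 (y ^ 2)| * y ^ 3 ≤ M

lemma RadialC3.nonneg {q q1 q2 q3 : ℝ → ℝ} {M : ℝ} (h : RadialC3 q q1 q2 q3 M) : 0 ≤ M := by
  simpa using h.bound2 0 le_rfl

/-- The bound on `f3` is integrated three times by the mean value inequality. The sharp constant `K
/ 6` is not needed. -/
lemma taylor_third_order {f f1 f2 f3 : ℝ → ℝ} {K : ℝ}
    (h0 : ∀ t ∈ Set.Icc (0 : ℝ) 1, HasDerivAt f (f1 t) t)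
    (h1 : ∀ t ∈ Set.Icc (0 : ℝ) 1, HasDerivAt f1 (f2 t) t)
    (h2 : ∀ t ∈ Set.Icc (0 : ℝ) 1, HasDerivAt f2 (f3 t) t)
    (hK : ∀ t ∈ Set.Icc (0 : ℝ) 1, |f3 t| ≤ K) :
    |f 1 - f 0 - f1 0 - f2 0 / 2| ≤ K := by
  have hK0 : 0 ≤ K := (abs_nonneg _).trans (hK 0 ⟨le_rfl, zero_le_one⟩)
  have mono : ∀ (g g' : ℝ → ℝ), (∀ t ∈ Set.Icc (0 : ℝ) 1, HasDerivAt g (g' t) t) →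
      (∀ t ∈ Set.Icc (0 : ℝ) 1, |g' t| ≤ K) → ∀ t ∈ Set.Icc (0 : ℝ) 1, |g t - g 0| ≤ K := by
    intro g g' hg hb t ht
    have h := norm_image_sub_le_of_norm_deriv_le_segment' (f := g) (f' := g') (a := 0) (b := 1)
      (C := K) (fun x hx => (hg x hx).hasDerivWithinAt)
      (fun x hx => hb x (Set.Ico_subset_Icc_self hx)) t ht
    rw [Real.norm_eq_abs, sub_zero] at h
    exact h.trans (mul_le_of_le_one_right hK0 ht.2)
  have e2 := mono f2 f3 h2 hK
  have e1 := mono (fun t => f1 t - t * f2 0) (fun t => f2 t - f2 0)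
    (fun t ht => (h1 t ht).sub (by simpa using (hasDerivAt_id t).mul_const (f2 0))) e2
  have e0 := mono (fun t => f t - t * f1 0 - t ^ 2 / 2 * f2 0) (fun t => f1 t - f1 0 - t * f2 0)
    (fun t ht => by
      refine ((h0 t ht).sub (by simpa using (hasDerivAt_id t).mul_const (f1 0))).sub ?_
      have := (((hasDerivAt_id t).pow 2).div_const 2).mul_const (f2 0)
      refine this.congr_deriv ?_
      simp only [id, Nat.cast_ofNat]; ring)
    (fun t ht => by
      have := e1 t ht
      convert this using 2
      ring) 1 ⟨zero_le_one, le_rfl⟩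
  convert e0 using 2
  ring

/-- Taylor's formula is applied along the segment from `w` to `w + z`, that is to `q ∘ X` with `X t
= |w + t z|² / s²`. Cauchy–Schwarz gives `|X'| ≤ 2 √X |z| / s`, which is exactly what the weighted
bounds in `RadialC3` absorb. The constant is `20 = 8 + 3 · 4`, from the two terms of the third
derivative. -/
lemma RadialC3.taylor {q q1 q2 q3 : ℝ → ℝ} {M : ℝ} (h : RadialC3 q q1 q2 q3 M) {s : ℝ}
    (hs : 0 < s) (w z : ℤ × ℤ) :
    |q (euclid (w + z) ^ 2 / s ^ 2) - q (euclid w ^ 2 / s ^ 2)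
      - (q1 (euclid w ^ 2 / s ^ 2) * (2 * dot w z + euclid z ^ 2) / s ^ 2
        + q2 (euclid w ^ 2 / s ^ 2) * (2 * dot w z ^ 2) / s ^ 4)|
      ≤ 20 * M * (euclid z ^ 3 / s ^ 3) := by
  set X : ℝ → ℝ := fun t => (euclid w ^ 2 + 2 * dot w z * t + euclid z ^ 2 * t ^ 2) / s ^ 2 with hX
  set X1 : ℝ → ℝ := fun t => (2 * dot w z + 2 * euclid z ^ 2 * t) / s ^ 2 with hX1
  set X2 : ℝ := 2 * euclid z ^ 2 / s ^ 2 with hX2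
  have hM := h.nonneg
  have hwz := dot_sq_le w z
  have hX0 : ∀ t, 0 ≤ X t := by
    intro t
    apply div_nonneg _ (by positivity)
    have hz := euclid_nonneg z
    rcases hz.eq_or_lt with h0 | h0
    · rw [← h0] at hwz ⊢
      have : dot w z = 0 := by nlinarith
      rw [this]; nlinarith [sq_nonneg (euclid w)]
    -- Nonnegativity of `X` comes from completing the square. It is needed because the derivatives
    -- of `q` are only available on the half-line.
    · have h5 : 0 ≤ euclid z ^ 2 * (euclid w ^ 2 + 2 * dot w z * t + euclid z ^ 2 * t ^ 2) := by
        nlinarith [sq_nonneg (euclid z ^ 2 * t + dot w z)]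
      by_contra hneg
      push Not at hneg
      exact absurd h5 (not_le.mpr (mul_neg_of_pos_of_neg (by positivity) hneg))
  have hd0 : ∀ t, HasDerivAt X (X1 t) t := by
    intro t
    have h1 := ((((hasDerivAt_id t).const_mul (2 * dot w z)).const_add (euclid w ^ 2)).add
      (((hasDerivAt_id t).pow 2).const_mul (euclid z ^ 2))).div_const (s ^ 2)
    refine h1.congr_deriv ?_
    simp only [hX1, id, Nat.cast_ofNat]
    ring
  have hd1 : ∀ t, HasDerivAt X1 X2 t := by
    intro t
    have h1 := (((hasDerivAt_id t).const_mul (2 * euclid z ^ 2)).const_add (2 * dot w z)).div_const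
      (s ^ 2)
    refine h1.congr_deriv ?_
    rw [hX2, mul_one]
  have hX1sq : ∀ t, X1 t ^ 2 ≤ 4 * X t * (euclid z ^ 2 / s ^ 2) := by
    intro t
    simp only [hX1, hX]
    have e : 4 * ((euclid w ^ 2 + 2 * dot w z * t + euclid z ^ 2 * t ^ 2) / s ^ 2)
        * (euclid z ^ 2 / s ^ 2) = 4 * (euclid w ^ 2 + 2 * dot w z * t + euclid z ^ 2 * t ^ 2)
        * euclid z ^ 2 / (s ^ 2) ^ 2 := by field_simp
    rw [div_pow, e]
    apply div_le_div_of_nonneg_right _ (by positivity)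
    nlinarith
  set f : ℝ → ℝ := fun t => q (X t)
  set f1 : ℝ → ℝ := fun t => q1 (X t) * X1 t
  set f2 : ℝ → ℝ := fun t => q2 (X t) * X1 t ^ 2 + q1 (X t) * X2
  set f3 : ℝ → ℝ := fun t => q3 (X t) * X1 t ^ 3 + 3 * (q2 (X t) * X1 t * X2)
  have key := taylor_third_order (f := f) (f1 := f1) (f2 := f2) (f3 := f3)
    (K := 20 * M * (euclid z ^ 3 / s ^ 3))
    (fun t _ => (h.deriv0 _ (hX0 t)).comp t (hd0 t))
    (fun t _ => by
      have := ((h.deriv1 _ (hX0 t)).comp t (hd0 t)).mul (hd1 t)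
      refine this.congr_deriv ?_
      simp only [f2, Function.comp]; ring)
    (fun t _ => by
      have h1 := ((h.deriv2 _ (hX0 t)).comp t (hd0 t)).mul ((hd1 t).pow 2)
      have h2 := ((h.deriv1 _ (hX0 t)).comp t (hd0 t)).mul_const X2
      refine (h1.add h2).congr_deriv ?_
      simp only [f3, Function.comp, Pi.pow_apply]; push_cast; ring)
    (fun t _ => by
      set y := Real.sqrt (X t) with hy
      have hy0 : 0 ≤ y := Real.sqrt_nonneg _
      have hyX : y ^ 2 = X t := Real.sq_sqrt (hX0 t)
      set c := euclid z / s with hc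
      have hc0 : 0 ≤ c := div_nonneg (euclid_nonneg z) hs.le
      have hX1b : |X1 t| ≤ 2 * y * c := by
        apply abs_le_of_sq_le_sq _ (by positivity)
        have := hX1sq t
        rw [← hyX] at this
        calc X1 t ^ 2 ≤ _ := this
          _ = _ := by rw [hc]; ring
      have hX2b : X2 = 2 * c ^ 2 := by rw [hX2, hc]; ring
      have b2 := h.bound2 y hy0
      have b3 := h.bound3 y hy0
      rw [hyX] at b2 b3
      have t1 : |q3 (X t) * X1 t ^ 3| ≤ 8 * M * c ^ 3 := by
        rw [abs_mul, abs_pow]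
        calc |q3 (X t)| * |X1 t| ^ 3 ≤ |q3 (X t)| * (2 * y * c) ^ 3 := by gcongr
          _ = (|q3 (X t)| * y ^ 3) * (8 * c ^ 3) := by ring
          _ ≤ M * (8 * c ^ 3) := by gcongr
          _ = _ := by ring
      have t2 : |q2 (X t) * X1 t * X2| ≤ 4 * M * c ^ 3 := by
        rw [abs_mul, abs_mul, hX2b, abs_of_nonneg (by positivity : (0 : ℝ) ≤ 2 * c ^ 2)]
        calc |q2 (X t)| * |X1 t| * (2 * c ^ 2) ≤ |q2 (X t)| * (2 * y * c) * (2 * c ^ 2) := by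
              gcongr
          _ = (|q2 (X t)| * y) * (4 * c ^ 3) := by ring
          _ ≤ M * (4 * c ^ 3) := by gcongr
          _ = _ := by ring
      calc |f3 t| ≤ |q3 (X t) * X1 t ^ 3| + |3 * (q2 (X t) * X1 t * X2)| := abs_add_le _ _
        _ ≤ 8 * M * c ^ 3 + 3 * (4 * M * c ^ 3) := by
            rw [abs_mul 3, abs_of_pos (by norm_num : (0 : ℝ) < 3)]
            gcongr
        _ = 20 * M * c ^ 3 := by ring
        _ = _ := by rw [hc, div_pow])
  convert key using 2
  have e1 : X 1 = euclid (w + z) ^ 2 / s ^ 2 := by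
    simp only [hX]; rw [euclid_add_sq]; ring
  have e0 : X 0 = euclid w ^ 2 / s ^ 2 := by simp [hX]
  simp only [f, f1, f2, e1, e0, hX1, hX2]
  field_simp
  ring

/-! ### The generator of the walk on radial functions -/

section Expectation

variable {p : PMF (ℤ × ℤ)} {q q1 q2 q3 : ℝ → ℝ} {M : ℝ}

/-- The radial function `y ↦ q(|y - c|² / s²)`. -/
noncomputable def radial (q : ℝ → ℝ) (s : ℝ) (c y : ℤ × ℤ) : ℝ := q (euclid (y - c) ^ 2 / s ^ 2)

/-- Symmetry removes the linear term and the identity covariance makes the quadratic part isotropic.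
What remains is half the Laplacian of `q(|·|² / s²)`. -/
lemma RadialC3.hasSum_main (hp : IsSymmetric p) (hcov : HasIdentityCovariance p) {s : ℝ}
    (hs : 0 < s) (w : ℤ × ℤ) (a b : ℝ) :
    HasSum (fun z => step p z * (a * (2 * dot w z + euclid z ^ 2) / s ^ 2
        + b * (2 * dot w z ^ 2) / s ^ 4))
      (2 / s ^ 2 * (a + euclid w ^ 2 / s ^ 2 * b)) := by
  have h := (((hasSum_dot hp hcov w).mul_left (2 * a / s ^ 2)).add
    ((hasSum_euclid_sq hcov).mul_left (a / s ^ 2))).add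
    ((hasSum_dot_sq hcov w).mul_left (2 * b / s ^ 4))
  have e : 2 / s ^ 2 * (a + euclid w ^ 2 / s ^ 2 * b)
      = 2 * a / s ^ 2 * 0 + a / s ^ 2 * 2 + 2 * b / s ^ 4 * euclid w ^ 2 := by
    field_simp
    ring
  rw [e]
  refine h.congr_fun' fun z => ?_
  ring

/-- The generator of the walk applied to a smooth radial function. -/
theorem RadialC3.abs_transOp_sub_le (h : RadialC3 q q1 q2 q3 M) (hp : IsSymmetric p)
    (hcov : HasIdentityCovariance p) (h3 : Summable fun z => step p z * euclid z ^ 3) {s : ℝ}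
    (hs : 0 < s) (c w : ℤ × ℤ) :
    (Summable fun z => step p z * radial q s c (w + z)) ∧
    |transOp p (radial q s c) w - radial q s c w
      - 2 / s ^ 2 * (q1 (euclid (w - c) ^ 2 / s ^ 2)
        + euclid (w - c) ^ 2 / s ^ 2 * q2 (euclid (w - c) ^ 2 / s ^ 2))|
      ≤ 20 * M * thirdMoment p / s ^ 3 := by
  set A := euclid (w - c) ^ 2 / s ^ 2 with hA
  set m : ℤ × ℤ → ℝ := fun z => q1 A * (2 * dot (w - c) z + euclid z ^ 2) / s ^ 2
        + q2 A * (2 * dot (w - c) z ^ 2) / s ^ 4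
  have hm := RadialC3.hasSum_main hp hcov hs (w - c) (q1 A) (q2 A)
  set d : ℤ × ℤ → ℝ := fun z => radial q s c (w + z) - q A - m z
  have hd : ∀ z, |d z| ≤ 20 * M * (euclid z ^ 3 / s ^ 3) := by
    intro z
    have := h.taylor hs (w - c) z
    simp only [d, m, radial]
    rwa [show w + z - c = w - c + z by abel]
  have hds : ∀ z, ‖step p z * d z‖ ≤ 20 * M / s ^ 3 * (step p z * euclid z ^ 3) := by
    intro z
    rw [norm_mul, Real.norm_eq_abs, Real.norm_eq_abs, abs_of_nonneg (step_nonneg p z)]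
    calc step p z * |d z| ≤ step p z * (20 * M * (euclid z ^ 3 / s ^ 3)) :=
          mul_le_mul_of_nonneg_left (hd z) (step_nonneg p z)
      _ = _ := by ring
  have hdsum : Summable fun z => step p z * d z :=
    Summable.of_norm_bounded (h3.mul_left _) hds
  have htot := (hdsum.hasSum.add hm).add ((hasSum_step p).mul_right (q A))
  have hfun : (fun z => step p z * d z + step p z * m z + step p z * q A)
      = fun z => step p z * radial q s c (w + z) := by
    funext z
    simp only [d]
    ring
  have htot' := htot
  change HasSum (fun z => step p z * d z + step p z * m z + step p z * q A) _ at htot'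
  rw [hfun] at htot'
  refine ⟨htot'.summable, ?_⟩
  have hd_le : |∑' z, step p z * d z| ≤ 20 * M * thirdMoment p / s ^ 3 := by
    have h1 := tsum_of_norm_bounded (h3.mul_left (20 * M / s ^ 3)).hasSum hds
    rw [Real.norm_eq_abs, tsum_mul_left] at h1
    calc _ ≤ _ := h1
      _ = _ := by rw [thirdMoment]; ring
  rw [transOp, htot'.tsum_eq]
  convert hd_le using 2
  simp only [radial]
  ring

end Expectation

end PlanarWalk

namespace PlanarWalk

/-- A symmetric, strongly aperiodic walk with identity covariance and finite third moment. -/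
structure RegularWalk (p : PMF (ℤ × ℤ)) : Prop where
  symm : IsSymmetric p
  aper : IsStronglyAperiodic p
  cov : HasIdentityCovariance p
  third : Summable fun z => step p z * euclid z ^ 3

/-! ### The exponential barrier -/

lemma mul_exp_le (y : ℝ) : y * Real.exp (-8 * y ^ 2) ≤ 1 := by
  have h := Real.quadratic_le_exp_of_nonneg (show 0 ≤ 8 * y ^ 2 by positivity)
  rw [show -8 * y ^ 2 = -(8 * y ^ 2) by ring, Real.exp_neg, ← div_eq_mul_inv,
    div_le_one (Real.exp_pos _)]
  nlinarith [sq_nonneg (y - 1), sq_nonneg (y ^ 2)]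

lemma cube_mul_exp_le (y : ℝ) : y ^ 3 * Real.exp (-8 * y ^ 2) ≤ 1 := by
  have h := Real.quadratic_le_exp_of_nonneg (show 0 ≤ 8 * y ^ 2 by positivity)
  rw [show -8 * y ^ 2 = -(8 * y ^ 2) by ring, Real.exp_neg, ← div_eq_mul_inv,
    div_le_one (Real.exp_pos _)]
  nlinarith [sq_nonneg (y ^ 2 - y), sq_nonneg (y ^ 2), sq_nonneg y]

/-- With rate `8`, the factor `-8 + 64 x` of the generator is at least `8` once `x ≥ 1/4`. The
Gaussian is therefore strictly subharmonic on the outer half `R/2 ≤ |w| < R` of the disc. -/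
lemma radialC3_exp : RadialC3 (fun x => Real.exp (-8 * x)) (fun x => -8 * Real.exp (-8 * x))
    (fun x => 64 * Real.exp (-8 * x)) (fun x => -512 * Real.exp (-8 * x)) 512 where
  deriv0 x _ := by
    have := ((hasDerivAt_id x).const_mul (-8)).exp
    refine this.congr_deriv ?_
    simp only [id]; ring
  deriv1 x _ := by
    have := (((hasDerivAt_id x).const_mul (-8)).exp).const_mul (-8)
    refine this.congr_deriv ?_
    simp only [id]; ring
  deriv2 x _ := by
    have := (((hasDerivAt_id x).const_mul (-8)).exp).const_mul 64
    refine this.congr_deriv ?_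
    simp only [id]; ring
  bound2 y _ := by
    rw [abs_of_pos (by positivity)]
    nlinarith [mul_exp_le y]
  bound3 y _ := by
    rw [abs_mul, abs_of_pos (Real.exp_pos _), show |(-512 : ℝ)| = 512 by norm_num]
    nlinarith [cube_mul_exp_le y]

/-- The bump `w ↦ exp(-8 |w - c|² / R²)`. -/
noncomputable def expBump (R : ℝ) (c w : ℤ × ℤ) : ℝ :=
  radial (fun x => Real.exp (-8 * x)) R c w

lemma expBump_mem_Icc (R : ℝ) (c w : ℤ × ℤ) : expBump R c w ∈ Set.Icc (0 : ℝ) 1 := by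
  refine ⟨(Real.exp_pos _).le, ?_⟩
  rw [expBump, radial, Real.exp_le_one_iff]
  have : 0 ≤ euclid (w - c) ^ 2 / R ^ 2 := by positivity
  linarith

lemma bdd_expBump (R : ℝ) (c : ℤ × ℤ) : Bdd (expBump R c) := .of_mem_Icc (expBump_mem_Icc R c)

variable {p : PMF (ℤ × ℤ)}

lemma transOp_expBump (hp : RegularWalk p) {R : ℝ} (hR : 0 < R) (c w : ℤ × ℤ) :
    |transOp p (expBump R c) w - expBump R c w
      - 2 / R ^ 2 * ((-8 + 64 * (euclid (w - c) ^ 2 / R ^ 2)) * expBump R c w)|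
      ≤ 10240 * thirdMoment p / R ^ 3 := by
  have := (radialC3_exp.abs_transOp_sub_le hp.symm hp.cov hp.third hR c w).2
  rw [← show expBump R c = radial (fun x => Real.exp (-8 * x)) R c from rfl,
    ← show expBump R c w = Real.exp (-8 * (euclid (w - c) ^ 2 / R ^ 2)) from rfl] at this
  convert this using 2
  · ring
  · ring

/-- The radius beyond which the continuum approximation is effective. -/
noncomputable def baseRadius (p : PMF (ℤ × ℤ)) : ℝ :=
  10240 * (thirdMoment p + 1) ^ 2 * Real.exp 8

lemma one_le_exp_eight : (1 : ℝ) ≤ Real.exp 8 := Real.one_le_exp (by norm_num)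

lemma le_baseRadius (p : PMF (ℤ × ℤ)) : 10240 * (thirdMoment p + 1) * Real.exp 8 ≤ baseRadius p := by
  have := thirdMoment_nonneg p
  have := one_le_exp_eight
  rw [baseRadius]
  gcongr
  nlinarith

lemma one_le_baseRadius (p : PMF (ℤ × ℤ)) : 1 ≤ baseRadius p := by
  have := thirdMoment_nonneg p
  have := one_le_exp_eight
  have := le_baseRadius p
  nlinarith

lemma error_le_of_baseRadius_le {R : ℝ} (hR : baseRadius p ≤ R) :
    10240 * thirdMoment p / R ^ 3 ≤ Real.exp (-8) / R ^ 2 := by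
  have h1 := le_baseRadius p
  have h0 := one_le_baseRadius p
  have hR0 : 0 < R := by linarith
  have h2 : 10240 * thirdMoment p * Real.exp 8 ≤ R := by
    have := thirdMoment_nonneg p
    have := one_le_exp_eight
    nlinarith
  rw [div_le_div_iff₀ (by positivity) (by positivity), Real.exp_neg]
  have h3 : 10240 * thirdMoment p ≤ (Real.exp 8)⁻¹ * R := by
    rw [inv_mul_eq_div, le_div_iff₀ (Real.exp_pos _)]
    exact h2
  calc 10240 * thirdMoment p * R ^ 2 ≤ (Real.exp 8)⁻¹ * R * R ^ 2 := by gcongr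
    _ = _ := by ring

lemma transOp_expBump_ge (hp : RegularWalk p) {R : ℝ} (hR : baseRadius p ≤ R) (c w : ℤ × ℤ) :
    -17 / R ^ 2 ≤ transOp p (expBump R c) w - expBump R c w := by
  have hR0 : 0 < R := by linarith [one_le_baseRadius p]
  have h1 := abs_le.mp (transOp_expBump hp hR0 c w)
  have h2 := error_le_of_baseRadius_le hR
  have hE := expBump_mem_Icc R c w
  have h3 : -16 / R ^ 2
      ≤ 2 / R ^ 2 * ((-8 + 64 * (euclid (w - c) ^ 2 / R ^ 2)) * expBump R c w) := by
    rw [show -16 / R ^ 2 = 2 / R ^ 2 * (-8) by ring]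
    apply mul_le_mul_of_nonneg_left _ (by positivity)
    have : 0 ≤ euclid (w - c) ^ 2 / R ^ 2 := by positivity
    nlinarith [hE.1, hE.2, mul_nonneg this hE.1]
  have h4 : Real.exp (-8) / R ^ 2 ≤ 1 / R ^ 2 := by
    gcongr
    exact Real.exp_le_one_iff.mpr (by norm_num)
  have h5 : -17 / R ^ 2 = -16 / R ^ 2 - 1 / R ^ 2 := by ring
  linarith [h1.1]

lemma transOp_expBump_ge_of_annulus (hp : RegularWalk p) {R : ℝ} (hR : baseRadius p ≤ R)
    {c w : ℤ × ℤ} (h1 : R / 2 ≤ euclid (w - c)) (h2 : euclid (w - c) < R) :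
    Real.exp (-8) / R ^ 2 ≤ transOp p (expBump R c) w - expBump R c w := by
  have hR0 : 0 < R := by linarith [one_le_baseRadius p]
  have h3 := abs_le.mp (transOp_expBump hp hR0 c w)
  have h4 := error_le_of_baseRadius_le hR
  have hA1 : 1 / 4 ≤ euclid (w - c) ^ 2 / R ^ 2 := by
    rw [le_div_iff₀ (by positivity)]; nlinarith
  have hA2 : euclid (w - c) ^ 2 / R ^ 2 ≤ 1 := by
    rw [div_le_one (by positivity)]
    exact pow_le_pow_left₀ (euclid_nonneg _) h2.le 2
  have hE : Real.exp (-8) ≤ expBump R c w := by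
    rw [expBump, radial, Real.exp_le_exp]; linarith
  have hE0 := Real.exp_pos (-8)
  have h5 : 16 * (Real.exp (-8) / R ^ 2)
      ≤ 2 / R ^ 2 * ((-8 + 64 * (euclid (w - c) ^ 2 / R ^ 2)) * expBump R c w) := by
    rw [show 16 * (Real.exp (-8) / R ^ 2) = 2 / R ^ 2 * (8 * Real.exp (-8)) by ring]
    apply mul_le_mul_of_nonneg_left _ (by positivity)
    nlinarith
  have h6 : 0 ≤ Real.exp (-8) / R ^ 2 := by positivity
  linarith [h3.1]

/-- The barrier `(exp(-8 |w|² / R²) - exp(-8))⁺`, supported in the disc of radius `R`. -/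
noncomputable def barrier (R : ℝ) (w : ℤ × ℤ) : ℝ := max (expBump R 0 w - Real.exp (-8)) 0

lemma barrier_nonneg (R : ℝ) (w : ℤ × ℤ) : 0 ≤ barrier R w := le_max_right _ _

lemma bdd_barrier (R : ℝ) : Bdd (barrier R) := by
  apply Bdd.of_mem_Icc (a := 0) (b := 1)
  intro w
  have := expBump_mem_Icc R 0 w
  have := Real.exp_pos (-8)
  exact ⟨barrier_nonneg R w, max_le (by linarith [this, (expBump_mem_Icc R 0 w).2]) zero_le_one⟩

lemma barrier_eq_zero {R : ℝ} (hR : 0 < R) {w : ℤ × ℤ} (h : R ≤ euclid w) : barrier R w = 0 := by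
  apply max_eq_right
  rw [sub_nonpos, expBump, radial, Real.exp_le_exp, sub_zero]
  have : 1 ≤ euclid w ^ 2 / R ^ 2 := by
    rw [one_le_div (by positivity)]
    exact pow_le_pow_left₀ hR.le h 2
  linarith

lemma barrier_eq {R : ℝ} (hR : 0 < R) {w : ℤ × ℤ} (h : euclid w < R) :
    barrier R w = expBump R 0 w - Real.exp (-8) := by
  apply max_eq_left
  rw [sub_nonneg, expBump, radial, Real.exp_le_exp, sub_zero]
  have : euclid w ^ 2 / R ^ 2 ≤ 1 := by
    rw [div_le_one (by positivity)]
    exact pow_le_pow_left₀ (euclid_nonneg _) h.le 2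
  linarith

/-- Taking the positive part only raises the values seen after a step, while inside the disc it
changes nothing at `w`. Lower bounds on the drift of the Gaussian thus pass to the barrier. -/
lemma le_transOp_barrier (R : ℝ) (w : ℤ × ℤ) :
    transOp p (expBump R 0) w - Real.exp (-8) ≤ transOp p (barrier R) w := by
  have h := transOp_mono (p := p) ((bdd_expBump R 0).sub (Bdd.const (Real.exp (-8))))
    (bdd_barrier R) (fun z => le_max_left _ _) w
  rwa [transOp_sub (bdd_expBump R 0) (Bdd.const _), transOp_const] at h

lemma transOp_barrier_ge (hp : RegularWalk p) {R : ℝ} (hR : baseRadius p ≤ R) {w : ℤ × ℤ}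
    (h : euclid w < R) : -17 / R ^ 2 ≤ transOp p (barrier R) w - barrier R w := by
  have hR0 : 0 < R := by linarith [one_le_baseRadius p]
  rw [barrier_eq hR0 h]
  linarith [le_transOp_barrier (p := p) R w, transOp_expBump_ge hp hR 0 w]

lemma transOp_barrier_ge_of_annulus (hp : RegularWalk p) {R : ℝ} (hR : baseRadius p ≤ R)
    {w : ℤ × ℤ} (h1 : R / 2 ≤ euclid w) (h2 : euclid w < R) :
    Real.exp (-8) / R ^ 2 ≤ transOp p (barrier R) w - barrier R w := by
  have hR0 : 0 < R := by linarith [one_le_baseRadius p]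
  rw [barrier_eq hR0 h2]
  linarith [le_transOp_barrier (p := p) R w,
    transOp_expBump_ge_of_annulus hp hR (c := 0) (w := w) (by simpa using h1) (by simpa using h2)]

/-! ### Doubling for nonnegative harmonic functions -/

/-- The mass of a nonnegative harmonic function on a disc is controlled by its mass on the disc
of half the radius. -/
theorem sum_discF_le_half (hp : RegularWalk p) {R : ℝ} (hR : baseRadius p ≤ R)
    {f : ℤ × ℤ → ℝ} (hf0 : ∀ z, 0 ≤ f z) (hf : Bdd f)
    (hharm : ∀ z, euclid z < R → transOp p f z = f z) :
    ∑ w ∈ discF 0 R, f w ≤ (1 + 17 * Real.exp 8) * ∑ w ∈ discF 0 (R / 2), f w := by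
  have hR0 : 0 < R := by linarith [one_le_baseRadius p]
  have hparts := sum_mul_transOp_sub hp.symm (discF 0 R) (f := f) (v := barrier R) hf
    (fun z hz => barrier_eq_zero hR0 (by simpa using hz)) (fun z hz _ => hharm z (by simpa using hz))
  -- Summation by parts leaves minus a nonnegative term, coming from the values of `f` outside the
  -- disc. The drift of the barrier is at least `e⁻⁸ / R²` on the outer half and never below `-17 /
  -- R²`, so the inner mass must control the outer mass.
  have hle : ∑ w ∈ discF 0 R, f w * (transOp p (barrier R) w - barrier R w) ≤ 0 := by
    rw [hparts, neg_nonpos]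
    refine Finset.sum_nonneg fun z _ => mul_nonneg (barrier_nonneg R z) (transOp_nonneg ?_ z)
    exact fun w => Set.indicator_nonneg (fun z _ => hf0 z) w
  have hsub : discF 0 (R / 2) ⊆ discF 0 R := by
    intro w hw
    rw [mem_discF] at hw ⊢
    linarith
  rw [← Finset.sum_sdiff hsub] at hle ⊢
  have h1 : Real.exp (-8) / R ^ 2 * ∑ w ∈ discF 0 R \ discF 0 (R / 2), f w
      ≤ ∑ w ∈ discF 0 R \ discF 0 (R / 2), f w * (transOp p (barrier R) w - barrier R w) := by
    rw [Finset.mul_sum]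
    refine Finset.sum_le_sum fun w hw => ?_
    simp only [Finset.mem_sdiff, mem_discF, sub_zero, not_lt] at hw
    rw [mul_comm]
    exact mul_le_mul_of_nonneg_left (transOp_barrier_ge_of_annulus hp hR hw.2 hw.1) (hf0 w)
  have h2 : -17 / R ^ 2 * ∑ w ∈ discF 0 (R / 2), f w
      ≤ ∑ w ∈ discF 0 (R / 2), f w * (transOp p (barrier R) w - barrier R w) := by
    rw [Finset.mul_sum]
    refine Finset.sum_le_sum fun w hw => ?_
    rw [mul_comm]
    have := hsub hw
    simp only [mem_discF, sub_zero] at this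
    exact mul_le_mul_of_nonneg_left (transOp_barrier_ge hp hR this) (hf0 w)
  set a := ∑ w ∈ discF 0 R \ discF 0 (R / 2), f w
  set b := ∑ w ∈ discF 0 (R / 2), f w
  have h3 : Real.exp (-8) / R ^ 2 * a ≤ 17 / R ^ 2 * b := by
    have : -17 / R ^ 2 * b = -(17 / R ^ 2 * b) := by ring
    linarith
  have h4 : Real.exp (-8) * a ≤ 17 * b := by
    rw [div_mul_eq_mul_div, div_mul_eq_mul_div, div_le_div_iff_of_pos_right (by positivity)] at h3
    exact h3
  rw [Real.exp_neg, inv_mul_eq_div, div_le_iff₀ (Real.exp_pos _)] at h4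
  linarith

/-! ### The exit probability near the boundary -/

/-- The linear Taylor term is isolated; the two quadratic terms and the cubic remainder are given
up. For `|w|` of order `R` the linear term has mean absolute size of order `1 / R` and dominates. -/
lemma le_abs_expBump_sub {R : ℝ} (hR : 0 < R) {w : ℤ × ℤ} (h2 : euclid w < R) (z : ℤ × ℤ) :
    16 * Real.exp (-8) / R ^ 2 * |dot w z| - 136 / R ^ 2 * euclid z ^ 2
      - 10240 / R ^ 3 * euclid z ^ 3 ≤ |expBump R 0 (w + z) - expBump R 0 w| := by
  have ht := radialC3_exp.taylor hR w z
  simp only [expBump, radial, sub_zero]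
  set A := euclid w ^ 2 / R ^ 2 with hA
  have hA0 : 0 ≤ A := by positivity
  have hA1 : A ≤ 1 := by
    rw [hA, div_le_one (by positivity)]
    exact pow_le_pow_left₀ (euclid_nonneg _) h2.le 2
  set e := Real.exp (-8 * A)
  have he1 : Real.exp (-8) ≤ e := Real.exp_le_exp.mpr (by linarith)
  have he2 : e ≤ 1 := Real.exp_le_one_iff.mpr (by linarith)
  have he0 : 0 < e := Real.exp_pos _
  set d := Real.exp (-8 * (euclid (w + z) ^ 2 / R ^ 2)) - e
  have hlin : |16 * e / R ^ 2 * dot w z| ≤ |d| + 8 * e / R ^ 2 * euclid z ^ 2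
      + 64 * e * (2 * dot w z ^ 2) / R ^ 4 + 20 * 512 * (euclid z ^ 3 / R ^ 3) := by
    have e1 : 16 * e / R ^ 2 * dot w z
        = (d - (-8 * e * (2 * dot w z + euclid z ^ 2) / R ^ 2
          + 64 * e * (2 * dot w z ^ 2) / R ^ 4))
          - d - 8 * e / R ^ 2 * euclid z ^ 2 + 64 * e * (2 * dot w z ^ 2) / R ^ 4 := by
      ring
    have n1 : 0 ≤ 8 * e / R ^ 2 * euclid z ^ 2 := by positivity
    have n2 : 0 ≤ 64 * e * (2 * dot w z ^ 2) / R ^ 4 := by positivity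
    have hd1 := neg_abs_le d
    have hd2 := le_abs_self d
    obtain ⟨t1, t2⟩ := abs_le.mp ht
    rw [abs_le]
    constructor <;> linarith
  rw [abs_mul, abs_of_pos (by positivity : 0 < 16 * e / R ^ 2)] at hlin
  have b1 : 16 * Real.exp (-8) / R ^ 2 * |dot w z| ≤ 16 * e / R ^ 2 * |dot w z| := by gcongr
  have b2 : 8 * e / R ^ 2 * euclid z ^ 2 ≤ 8 * 1 / R ^ 2 * euclid z ^ 2 := by gcongr
  have b3 : 64 * e * (2 * dot w z ^ 2) / R ^ 4 ≤ 128 / R ^ 2 * euclid z ^ 2 := by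
    have hd : dot w z ^ 2 ≤ R ^ 2 * euclid z ^ 2 := by
      refine (dot_sq_le w z).trans ?_
      gcongr
      exact euclid_nonneg w
    calc 64 * e * (2 * dot w z ^ 2) / R ^ 4 ≤ 64 * 1 * (2 * (R ^ 2 * euclid z ^ 2)) / R ^ 4 := by
          gcongr
      _ = _ := by field_simp; ring
  have b4 : 20 * 512 * (euclid z ^ 3 / R ^ 3) = 10240 / R ^ 3 * euclid z ^ 3 := by ring
  have b5 : 136 / R ^ 2 * euclid z ^ 2 = 8 * 1 / R ^ 2 * euclid z ^ 2 + 128 / R ^ 2 * euclid z ^ 2 := by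
    ring
  linarith

/-- One step of the walk from the outer half of the disc sees a barrier of height `≥ c / R`. -/
lemma le_transOp_barrier_annulus (hp : RegularWalk p) {R : ℝ} (hR : baseRadius p ≤ R)
    {w : ℤ × ℤ} (h1 : R / 2 ≤ euclid w) (h2 : euclid w < R) :
    Real.exp (-8) / (2 * (thirdMoment p + 1)) / R ≤ transOp p (barrier R) w := by
  have hR1 : 1 ≤ R := (one_le_baseRadius p).trans hR
  have hR0 : 0 < R := by linarith
  set M := thirdMoment p with hM
  have hM0 : 0 ≤ M := thirdMoment_nonneg p
  have hE := bdd_expBump R 0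
  have hEd : Bdd fun z => expBump R 0 z - expBump R 0 w := hE.sub (Bdd.const _)
  have hEa : Bdd fun z => |expBump R 0 z - expBump R 0 w| := by
    obtain ⟨B, hB⟩ := hEd
    exact ⟨B, fun z => by rw [abs_abs]; exact hB z⟩
  -- The left side is the positive part of the increment of the Gaussian. Its mean is at least half
  -- the mean absolute increment, because the drift at `w` is nonnegative. This gives order `1 / R`
  -- even where the barrier itself is near `0`.
  have hpt : ∀ z, (1 / 2) * ((expBump R 0 z - expBump R 0 w) + |expBump R 0 z - expBump R 0 w|)
      ≤ barrier R z := by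
    intro z
    have hw := barrier_nonneg R w
    rw [barrier_eq hR0 h2] at hw
    have h3 : expBump R 0 z - Real.exp (-8) ≤ barrier R z := le_max_left _ _
    have h4 := barrier_nonneg R z
    rcases abs_cases (expBump R 0 z - expBump R 0 w) with h | h <;> rw [h.1] <;> linarith
  have hmono := transOp_mono (p := p) ((Bdd.const (1 / 2)).mul (hEd.add hEa)) (bdd_barrier R) hpt w
  rw [transOp_const_mul, transOp_add hEd hEa, transOp_sub hE (Bdd.const _), transOp_const] at hmono
  have hgen := transOp_expBump_ge_of_annulus hp hR (c := 0) (w := w) (by simpa using h1)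
    (by simpa using h2)
  have hgen0 : 0 ≤ Real.exp (-8) / R ^ 2 := by positivity
  have habs : 2 * (Real.exp (-8) / (2 * (M + 1)) / R)
      ≤ transOp p (fun z => |expBump R 0 z - expBump R 0 w|) w := by
    have s1 := (summable_step_mul_abs_dot hp.cov w).mul_left (16 * Real.exp (-8) / R ^ 2)
    have s2 := (hasSum_euclid_sq hp.cov).summable.mul_left (136 / R ^ 2)
    have s3 := hp.third.mul_left (10240 / R ^ 3)
    have hle := ((s1.sub s2).sub s3).tsum_le_tsum (fun z => by
      have := mul_le_mul_of_nonneg_left (le_abs_expBump_sub hR0 h2 z) (step_nonneg p z)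
      calc _ = _ := ?_
        _ ≤ _ := this
      ring) (hEa.summable (p := p) w)
    rw [(s1.sub s2).tsum_sub s3, s1.tsum_sub s2, tsum_mul_left, tsum_mul_left, tsum_mul_left,
      (hasSum_euclid_sq hp.cov).tsum_eq] at hle
    change _ ≤ transOp p (fun z => |expBump R 0 z - expBump R 0 w|) w at hle
    refine le_trans ?_ hle
    have hdot := le_tsum_abs_dot hp.cov hp.third w
    rw [← hM] at hdot
    have hd1 : R / (8 * (M + 1)) ≤ ∑' z, step p z * |dot w z| := by
      refine le_trans ?_ hdot
      rw [div_le_div_iff₀ (by positivity) (by positivity)]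
      nlinarith
    have hd2 : 2 * (Real.exp (-8) / (M + 1) / R)
        ≤ 16 * Real.exp (-8) / R ^ 2 * ∑' z, step p z * |dot w z| := by
      calc 2 * (Real.exp (-8) / (M + 1) / R) = 16 * Real.exp (-8) / R ^ 2 * (R / (8 * (M + 1))) := by
            field_simp; ring
        _ ≤ _ := by gcongr
    -- Here the factor `(thirdMoment p + 1) ^ 2` in `baseRadius` is used: the quadratic and cubic
    -- errors take at most half of the linear term.
    have hd3 : 136 / R ^ 2 * 2 + 10240 / R ^ 3 * M ≤ Real.exp (-8) / (M + 1) / R := by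
      have hb : 10240 * (M + 1) ^ 2 * Real.exp 8 ≤ R := hR
      have e1 : 10240 / R ^ 3 * M ≤ 10240 / R ^ 2 * M := by
        apply mul_le_mul_of_nonneg_right _ hM0
        exact div_le_div_of_nonneg_left (by norm_num) (by positivity)
          (pow_le_pow_right₀ hR1 (by norm_num))
      have e2 : (10240 * (M + 1)) / R ^ 2 ≤ Real.exp (-8) / (M + 1) / R := by
        rw [Real.exp_neg, div_div, div_le_div_iff₀ (by positivity) (by positivity)]
        have : 10240 * (M + 1) ^ 2 ≤ (Real.exp 8)⁻¹ * R := by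
          rw [inv_mul_eq_div, le_div_iff₀ (Real.exp_pos _)]; exact hb
        nlinarith
      have e3 : 136 / R ^ 2 * 2 + 10240 / R ^ 2 * M ≤ (10240 * (M + 1)) / R ^ 2 := by
        rw [show 136 / R ^ 2 * 2 + 10240 / R ^ 2 * M = (272 + 10240 * M) / R ^ 2 by ring]
        gcongr
        linarith
      linarith
    have e4 : 2 * (Real.exp (-8) / (2 * (M + 1)) / R) = Real.exp (-8) / (M + 1) / R := by
      field_simp
    change _ ≤ _ - _ * 2 - _ * M
    linarith
  linarith

/-- The average of the probability to exit the disc of radius `R` at `y` is at least a multiple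
of `1 / R` times the probability to jump from `y` into the disc. -/
theorem sum_step_le_sum_discF (hp : RegularWalk p) {R : ℝ} (hR : baseRadius p ≤ R)
    {f : ℤ × ℤ → ℝ} (hf0 : ∀ z, 0 ≤ f z) (hf : Bdd f)
    (hharm : ∀ z, euclid z < R → transOp p f z = f z) {y : ℤ × ℤ} (hy : R ≤ euclid y)
    (hfy : f y = 1) :
    Real.exp (-8) / (2 * (thirdMoment p + 1)) / R * ∑ w ∈ discF 0 R, step p (w - y)
      ≤ 17 / R ^ 2 * ∑ w ∈ discF 0 (R / 2), f w := by
  classical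
  have hR1 : 1 ≤ R := (one_le_baseRadius p).trans hR
  have hR0 : 0 < R := by linarith
  have hyD : y ∉ discF 0 R := by simpa using hy
  -- The point `y` is added to the disc so that it contributes `P (barrier R) y`, with weight `f y =
  -- 1`. The barrier vanishes at `y`, so harmonicity there is not required.
  have hparts := sum_mul_transOp_sub hp.symm (insert y (discF 0 R)) (f := f) (v := barrier R) hf
    (fun z hz => barrier_eq_zero hR0 (by
      simp only [Finset.mem_insert, mem_discF, sub_zero, not_or, not_lt] at hz
      exact hz.2))
    (fun z _ hz => hharm z (by
      by_contra! h
      exact hz (barrier_eq_zero hR0 h)))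
  have hle : ∑ w ∈ insert y (discF 0 R), f w * (transOp p (barrier R) w - barrier R w) ≤ 0 := by
    rw [hparts, neg_nonpos]
    refine Finset.sum_nonneg fun z _ => mul_nonneg (barrier_nonneg R z) (transOp_nonneg ?_ z)
    exact fun w => Set.indicator_nonneg (fun z _ => hf0 z) w
  rw [Finset.sum_insert hyD, hfy, one_mul, barrier_eq_zero hR0 hy, sub_zero] at hle
  have hsub : discF 0 (R / 2) ⊆ discF 0 R := by
    intro w hw
    rw [mem_discF] at hw ⊢
    linarith
  rw [transOp_eq_sum (discF 0 R) (fun z hz => barrier_eq_zero hR0 (by simpa using hz)),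
    ← Finset.sum_add_distrib, ← Finset.sum_sdiff hsub] at hle
  rw [← Finset.sum_sdiff hsub]
  set c := Real.exp (-8) / (2 * (thirdMoment p + 1)) / R with hc
  have hM0 := thirdMoment_nonneg p
  have hc1 : c ≤ Real.exp (-8) := by
    rw [hc, div_div]
    apply div_le_self (Real.exp_pos _).le
    nlinarith
  have h1 : c * ∑ w ∈ discF 0 R \ discF 0 (R / 2), step p (w - y)
      ≤ ∑ w ∈ discF 0 R \ discF 0 (R / 2), (step p (w - y) * barrier R w
        + f w * (transOp p (barrier R) w - barrier R w)) := by
    rw [Finset.mul_sum]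
    refine Finset.sum_le_sum fun w hw => ?_
    simp only [Finset.mem_sdiff, mem_discF, sub_zero, not_lt] at hw
    -- Near the boundary the barrier is too small to be used alone. Since `f w` is at least the
    -- probability of jumping straight to `y`, the drift term raises `barrier R w` to `transOp p
    -- (barrier R) w`, which is of order `1 / R`.
    have hfw : step p (w - y) ≤ f w := by
      have := step_mul_le_transOp (p := p) hf hf0 w (y - w)
      rw [hharm w hw.1, add_sub_cancel, hfy, mul_one, step_sub_comm hp.symm] at this
      exact this
    have hb := transOp_barrier_ge_of_annulus hp hR hw.2 hw.1
    have hb0 : 0 ≤ Real.exp (-8) / R ^ 2 := by positivity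
    have hP := le_transOp_barrier_annulus hp hR hw.2 hw.1
    have hs := step_nonneg p (w - y)
    nlinarith
  have h2 : c * (∑ w ∈ discF 0 (R / 2), step p (w - y)) + -17 / R ^ 2 * ∑ w ∈ discF 0 (R / 2), f w
      ≤ ∑ w ∈ discF 0 (R / 2), (step p (w - y) * barrier R w
        + f w * (transOp p (barrier R) w - barrier R w)) := by
    rw [Finset.mul_sum, Finset.mul_sum, ← Finset.sum_add_distrib]
    refine Finset.sum_le_sum fun w hw => ?_
    have hwR := hsub hw
    simp only [mem_discF, sub_zero] at hwR hw
    have hb := transOp_barrier_ge hp hR hwR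
    have hcb : c ≤ barrier R w := by
      refine hc1.trans ?_
      rw [barrier_eq hR0 hwR, le_sub_iff_add_le, expBump, radial, sub_zero]
      have hA : euclid w ^ 2 / R ^ 2 ≤ 1 / 4 := by
        rw [div_le_iff₀ (by positivity)]
        nlinarith [euclid_nonneg w]
      have e1 : Real.exp (-2) ≤ Real.exp (-8 * (euclid w ^ 2 / R ^ 2)) :=
        Real.exp_le_exp.mpr (by linarith)
      have e2 : Real.exp (-8) * Real.exp 6 = Real.exp (-2) := by
        rw [← Real.exp_add]; norm_num
      have e3 := Real.add_one_le_exp (6 : ℝ)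
      nlinarith [Real.exp_pos (-8)]
    have hs := step_nonneg p (w - y)
    nlinarith [hf0 w]
  have h3 : -17 / R ^ 2 * ∑ w ∈ discF 0 (R / 2), f w = -(17 / R ^ 2 * ∑ w ∈ discF 0 (R / 2), f w) := by
    ring
  rw [mul_add]
  linarith

end PlanarWalk

namespace PlanarWalk

/-! ### Smoothing by a lazy factor in a normed algebra -/

/-- This is `2 ^ n` times the variance of a simple random walk after `n` steps, read off from the
variance of Bernstein polynomials at `1/2`. -/
lemma sum_choose_mul_sq (n : ℕ) :
    ∑ i ∈ Finset.range (n + 1), (n.choose i : ℝ) * (2 * i - n) ^ 2 = (n : ℝ) * 2 ^ n := by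
  have h := congrArg (Polynomial.eval (1 / 2 : ℝ)) (bernsteinPolynomial.variance ℝ n)
  simp only [Polynomial.eval_finsetSum, bernsteinPolynomial, nsmul_eq_mul, Polynomial.eval_mul,
    Polynomial.eval_pow, Polynomial.eval_sub, Polynomial.eval_natCast, Polynomial.eval_X,
    Polynomial.eval_one] at h
  have h2 : ∀ i ∈ Finset.range (n + 1), (n.choose i : ℝ) * (2 * i - n) ^ 2
      = 4 * 2 ^ n * (((n : ℝ) * (1 / 2) - i) ^ 2
        * ((n.choose i : ℝ) * (1 / 2) ^ i * (1 - 1 / 2) ^ (n - i))) := by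
    intro i hi
    have hin : i ≤ n := by rw [Finset.mem_range] at hi; omega
    have e : ((1 / 2 : ℝ)) ^ i * (1 - 1 / 2) ^ (n - i) * 2 ^ n = 1 := by
      rw [show (1 - 1 / 2 : ℝ) = 1 / 2 by norm_num, ← pow_add, Nat.add_sub_cancel' hin, ← mul_pow]
      norm_num
    calc (n.choose i : ℝ) * (2 * i - n) ^ 2 = (n.choose i : ℝ) * (2 * i - n) ^ 2
          * ((1 / 2 : ℝ) ^ i * (1 - 1 / 2) ^ (n - i) * 2 ^ n) := by rw [e, mul_one]
      _ = _ := by ring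
  rw [Finset.sum_congr rfl h2, ← Finset.mul_sum, h]
  ring

section NormedAlgebra

variable {𝔸 : Type*} [NormedRing 𝔸] [NormedAlgebra ℝ 𝔸]

/-- The coefficient of `T ^ i` on the left is a difference of neighbouring binomial coefficients,
and this is a multiple of `2 i - (j + 1)`. The cancellation in the factor `T - 1` becomes visible in
this form. -/
lemma succ_smul_sub_one_mul_one_add_pow (T : 𝔸) (j : ℕ) :
    ((j + 1 : ℕ) : ℝ) • ((T - 1) * (1 + T) ^ j)
      = ∑ i ∈ Finset.range (j + 2), (((j + 1).choose i : ℝ) * (2 * i - (j + 1 : ℕ))) • T ^ i := by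
  have hpow : ∀ n : ℕ, (1 + T) ^ n = ∑ i ∈ Finset.range (n + 1), (n.choose i : ℝ) • T ^ i := by
    intro n
    rw [add_comm, (Commute.one_right T).add_pow]
    refine Finset.sum_congr rfl fun i _ => ?_
    rw [one_pow, mul_one, Algebra.smul_def, map_natCast, Nat.cast_comm]
  have h1 : ((j + 1 : ℕ) : ℝ) • (T * (1 + T) ^ j)
      = ∑ i ∈ Finset.range (j + 2), (((j + 1).choose i : ℝ) * i) • T ^ i := by
    rw [Finset.sum_range_succ', hpow, Finset.mul_sum, Finset.smul_sum]
    simp only [Nat.cast_zero, mul_zero, zero_smul, add_zero]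
    refine Finset.sum_congr rfl fun i _ => ?_
    rw [mul_smul_comm, smul_smul, ← pow_succ']
    congr 1
    exact_mod_cast Nat.add_one_mul_choose_eq j i
  have h2 : (T - 1) * (1 + T) ^ j = (2 : ℝ) • (T * (1 + T) ^ j) - (1 + T) ^ (j + 1) := by
    rw [pow_succ', two_smul]
    noncomm_ring
  rw [h2, smul_sub, smul_comm, h1, hpow, Finset.smul_sum, Finset.smul_sum,
    ← Finset.sum_sub_distrib]
  refine Finset.sum_congr rfl fun i _ => ?_
  rw [smul_smul, smul_smul, ← sub_smul]
  congr 1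
  ring

variable [NormOneClass 𝔸]

/-- After the triangle inequality the coefficients sum to the mean absolute position of a simple
random walk, up to normalisation. Cauchy–Schwarz and the variance bound it by `√n`, which is the
gain over the trivial estimate. -/
lemma norm_sub_one_mul_one_add_pow_le {T : 𝔸} (hT : ‖T‖ ≤ 1) (j : ℕ) :
    ‖(T - 1) * (1 + T) ^ j‖ ≤ 2 * 2 ^ j / Real.sqrt (j + 1 : ℕ) := by
  set n := j + 1 with hn
  have hn0 : (0 : ℝ) < n := by positivity
  have h1 : (n : ℝ) * ‖(T - 1) * (1 + T) ^ j‖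
      ≤ ∑ i ∈ Finset.range (n + 1), (n.choose i : ℝ) * |2 * (i : ℝ) - n| := by
    have e : (n : ℝ) * ‖(T - 1) * (1 + T) ^ j‖ = ‖(n : ℝ) • ((T - 1) * (1 + T) ^ j)‖ := by
      rw [norm_smul, Real.norm_of_nonneg hn0.le]
    rw [e, hn, succ_smul_sub_one_mul_one_add_pow]
    refine (norm_sum_le _ _).trans (Finset.sum_le_sum fun i _ => ?_)
    rw [norm_smul, norm_mul, Real.norm_eq_abs, Real.norm_eq_abs, Nat.abs_cast]
    apply mul_le_of_le_one_right (by positivity)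
    exact (norm_pow_le T i).trans (pow_le_one₀ (norm_nonneg _) hT)
  have h2 : (∑ i ∈ Finset.range (n + 1), (n.choose i : ℝ) * |2 * (i : ℝ) - n|) ^ 2
      ≤ 2 ^ n * (n * 2 ^ n) := by
    have h := Finset.sum_sq_le_sum_mul_sum_of_sq_le_mul (Finset.range (n + 1))
      (r := fun i => (n.choose i : ℝ) * |2 * (i : ℝ) - n|) (f := fun i => (n.choose i : ℝ))
      (g := fun i => (n.choose i : ℝ) * (2 * i - n) ^ 2)
      (fun i _ => by positivity) (fun i _ => by positivity)
      (fun i _ => by rw [mul_pow, sq_abs]; exact le_of_eq (by ring))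
    rw [sum_choose_mul_sq] at h
    have h3 : ∑ i ∈ Finset.range (n + 1), (n.choose i : ℝ) = 2 ^ n := by
      exact_mod_cast Nat.sum_range_choose n
    rwa [h3] at h
  have h4 : ∑ i ∈ Finset.range (n + 1), (n.choose i : ℝ) * |2 * (i : ℝ) - n|
      ≤ 2 ^ n * Real.sqrt n := by
    apply abs_le_of_sq_le_sq' _ (by positivity) |>.2
    rw [mul_pow, Real.sq_sqrt hn0.le]
    calc _ ≤ _ := h2
      _ = _ := by ring
  have hs : 0 < Real.sqrt n := Real.sqrt_pos.mpr hn0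
  rw [le_div_iff₀ hs]
  have h5 : (n : ℝ) * ‖(T - 1) * (1 + T) ^ j‖ ≤ 2 ^ n * Real.sqrt n := h1.trans h4
  have h6 : (n : ℝ) = Real.sqrt n * Real.sqrt n := (Real.mul_self_sqrt hn0.le).symm
  have h7 : Real.sqrt n * (‖(T - 1) * (1 + T) ^ j‖ * Real.sqrt n)
      ≤ Real.sqrt n * (2 * 2 ^ j) := by
    calc _ = (Real.sqrt n * Real.sqrt n) * ‖(T - 1) * (1 + T) ^ j‖ := by ring
      _ ≤ 2 ^ n * Real.sqrt n := by rw [← h6]; exact h5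
      _ = _ := by rw [hn, pow_succ]; ring
  exact le_of_mul_le_mul_left h7 hs

/-- Cauchy–Schwarz reduces the expectation of `1 / √(m + 1)`, for `m` binomial, to that of `1 / (m +
1)`. The latter is summed by absorbing `1 / (m + 1)` into the binomial coefficient. -/
lemma sum_binomial_div_sqrt_le {c : ℝ} (hc : 0 < c) (hc1 : c ≤ 1) (N : ℕ) :
    ∑ m ∈ Finset.range (N + 1), (N.choose m : ℝ) * c ^ m * (1 - c) ^ (N - m)
      * (1 / Real.sqrt (m + 1 : ℕ)) ≤ 1 / Real.sqrt (c * (N + 1 : ℕ)) := by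
  have hc2 : 0 ≤ 1 - c := by linarith
  set w : ℕ → ℝ := fun m => (N.choose m : ℝ) * c ^ m * (1 - c) ^ (N - m) with hw
  have hw0 : ∀ m, 0 ≤ w m := fun m => by positivity
  have hbin : ∀ n : ℕ, ∑ m ∈ Finset.range (n + 1), (n.choose m : ℝ) * c ^ m * (1 - c) ^ (n - m)
      = 1 := by
    intro n
    have := add_pow c (1 - c) n
    rw [add_sub_cancel, one_pow] at this
    conv_rhs => rw [this]
    exact Finset.sum_congr rfl fun i _ => by ring
  have h1 := Finset.sum_sq_le_sum_mul_sum_of_sq_le_mul (Finset.range (N + 1))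
    (r := fun m => w m * (1 / Real.sqrt (m + 1 : ℕ))) (f := w)
    (g := fun m => w m * (1 / (m + 1 : ℕ))) (fun i _ => hw0 i)
    (fun i _ => mul_nonneg (hw0 i) (by positivity))
    (fun i _ => by
      rw [mul_pow, div_pow, Real.sq_sqrt (by positivity)]
      exact le_of_eq (by ring))
  have h2 : ∑ m ∈ Finset.range (N + 1), w m = 1 := hbin N
  rw [h2, one_mul] at h1
  have h3 : ∑ m ∈ Finset.range (N + 1), w m * (1 / (m + 1 : ℕ)) ≤ 1 / (c * (N + 1 : ℕ)) := by
    rw [le_div_iff₀ (by positivity), Finset.sum_mul]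
    have h4 : ∀ m ∈ Finset.range (N + 1), w m * (1 / (m + 1 : ℕ)) * (c * (N + 1 : ℕ))
        = ((N + 1).choose (m + 1) : ℝ) * c ^ (m + 1) * (1 - c) ^ (N + 1 - (m + 1)) := by
      intro m _
      have h5 : ((N + 1 : ℕ) : ℝ) * N.choose m = (N + 1).choose (m + 1) * (m + 1 : ℕ) := by
        exact_mod_cast Nat.add_one_mul_choose_eq N m
      have h6 : ((m + 1 : ℕ) : ℝ) ≠ 0 := by positivity
      have h7 : ((N + 1).choose (m + 1) : ℝ) = ((N + 1 : ℕ) : ℝ) * N.choose m / (m + 1 : ℕ) := by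
        rw [h5]; field_simp
      rw [h7, Nat.add_sub_add_right]
      simp only [hw]
      rw [pow_succ]
      field_simp
    rw [Finset.sum_congr rfl h4]
    have h8 := hbin (N + 1)
    rw [Finset.sum_range_succ'] at h8
    have h9 : 0 ≤ ((N + 1).choose 0 : ℝ) * c ^ 0 * (1 - c) ^ (N + 1 - 0) := by positivity
    linarith
  rw [one_div, ← Real.sqrt_inv, ← one_div]
  apply Real.le_sqrt_of_sq_le
  exact h1.trans h3

/-- A power of an operator with a lazy translation factor is smooth in the direction of the
translation. -/
theorem norm_sub_one_mul_lazy_pow_le {T Q : 𝔸} (hcomm : Commute T Q) (hT : ‖T‖ ≤ 1) {c : ℝ}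
    (hc : 0 < c) (hc1 : c ≤ 1) (hQ : ‖Q‖ ≤ 1 - c) (N : ℕ) :
    ‖(T - 1) * ((c / 2) • (1 + T) + Q) ^ N‖ ≤ 2 / Real.sqrt (c * (N + 1 : ℕ)) := by
  have hcomm' : Commute ((c / 2) • (1 + T)) Q :=
    (((Commute.one_left Q).add_left hcomm)).smul_left _
  -- In the expansion the number `m` of lazy factors is weighted like a binomial variable with
  -- parameters `N` and `c`. The term with `m` lazy factors gains `1 / √(m + 1)`.
  rw [hcomm'.add_pow, Finset.mul_sum]
  refine (norm_sum_le _ _).trans ?_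
  have hterm : ∀ m ∈ Finset.range (N + 1),
      ‖(T - 1) * (((c / 2) • (1 + T)) ^ m * Q ^ (N - m) * (N.choose m : 𝔸))‖
        ≤ 2 * ((N.choose m : ℝ) * c ^ m * (1 - c) ^ (N - m) * (1 / Real.sqrt (m + 1 : ℕ))) := by
    intro m _
    have e : (T - 1) * (((c / 2) • (1 + T)) ^ m * Q ^ (N - m) * (N.choose m : 𝔸))
        = ((N.choose m : ℝ) * (c / 2) ^ m) • (((T - 1) * (1 + T) ^ m) * Q ^ (N - m)) := by
      have e1 : (N.choose m : 𝔸) = algebraMap ℝ 𝔸 (N.choose m : ℝ) := by simp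
      rw [e1, ← Algebra.commutes, ← Algebra.smul_def, smul_pow, mul_smul_comm, smul_mul_assoc,
        mul_smul_comm, smul_smul, mul_assoc]
    have hq : ‖Q ^ (N - m)‖ ≤ (1 - c) ^ (N - m) :=
      (norm_pow_le Q _).trans (pow_le_pow_left₀ (norm_nonneg _) hQ _)
    rw [e, norm_smul, Real.norm_of_nonneg (by positivity)]
    calc (N.choose m : ℝ) * (c / 2) ^ m * ‖((T - 1) * (1 + T) ^ m) * Q ^ (N - m)‖
        ≤ (N.choose m : ℝ) * (c / 2) ^ m * ((2 * 2 ^ m / Real.sqrt (m + 1 : ℕ)) * (1 - c) ^ (N - m)) := by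
          gcongr
          refine (norm_mul_le _ _).trans ?_
          exact mul_le_mul (norm_sub_one_mul_one_add_pow_le hT m) hq (norm_nonneg _) (by positivity)
      _ = _ := by
          rw [div_pow]
          field_simp
  refine (Finset.sum_le_sum hterm).trans ?_
  rw [← Finset.mul_sum]
  calc _ ≤ 2 * (1 / Real.sqrt (c * (N + 1 : ℕ))) := by
        gcongr
        exact sum_binomial_div_sqrt_le hc hc1 N
    _ = _ := by ring

lemma norm_sub_one_mul_pow_le {T P : 𝔸} (hcomm : Commute T P) (hT : ‖T‖ ≤ 1) {c : ℝ}
    (hc : 0 < c) (hc1 : c ≤ 1) (hQ : ‖P - (c / 2) • (1 + T)‖ ≤ 1 - c) (N : ℕ) :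
    ‖(T - 1) * P ^ N‖ ≤ 2 / Real.sqrt (c * (N + 1 : ℕ)) := by
  have h := norm_sub_one_mul_lazy_pow_le (Q := P - (c / 2) • (1 + T))
    (hcomm.sub_right (((Commute.one_right _).add_right (Commute.refl _)).smul_right _)) hT hc hc1
    hQ N
  rwa [add_sub_cancel] at h

end NormedAlgebra

/-! ### The walk as an operator on bounded functions -/

open BoundedContinuousFunction

variable {p : PMF (ℤ × ℤ)}

/-- A bounded function on the lattice as a bounded continuous function. -/
noncomputable def toBCF (u : ℤ × ℤ → ℝ) (hu : Bdd u) : (ℤ × ℤ) →ᵇ ℝ :=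
  .ofNormedAddCommGroupDiscrete u hu.choose hu.choose_spec

@[simp] lemma toBCF_apply (u : ℤ × ℤ → ℝ) (hu : Bdd u) (x : ℤ × ℤ) : toBCF u hu x = u x := rfl

lemma bdd_coe (u : (ℤ × ℤ) →ᵇ ℝ) : Bdd u := ⟨‖u‖, fun z => u.norm_coe_le_norm z⟩

lemma bdd_transOp {u : ℤ × ℤ → ℝ} (hu : Bdd u) : Bdd (transOp p u) := by
  obtain ⟨B, hB⟩ := hu
  exact ⟨B, abs_transOp_le hB⟩

/-- Nontriviality gives the identity operator norm one, the `NormOneClass` assumption of the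
preceding estimates. -/
instance : Nontrivial ((ℤ × ℤ) →ᵇ ℝ) :=
  ⟨toBCF (fun _ => 0) (Bdd.const 0), toBCF (fun _ => 1) (Bdd.const 1), fun h => by
    simpa using DFunLike.congr_fun h 0⟩

/-- The transition operator on bounded functions. -/
noncomputable def transCLM (p : PMF (ℤ × ℤ)) : ((ℤ × ℤ) →ᵇ ℝ) →L[ℝ] ((ℤ × ℤ) →ᵇ ℝ) :=
  LinearMap.mkContinuous
    { toFun := fun u => toBCF (transOp p u) (bdd_transOp (bdd_coe u))
      map_add' := fun u v => by
        ext x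
        exact transOp_add (bdd_coe u) (bdd_coe v) x
      map_smul' := fun c u => by
        ext x
        exact transOp_const_mul c u x } 1
    (fun u => by
      rw [one_mul]
      exact (norm_le (norm_nonneg u)).mpr fun x => abs_transOp_le (fun z => u.norm_coe_le_norm z) x)

@[simp] lemma transCLM_apply (u : (ℤ × ℤ) →ᵇ ℝ) (x : ℤ × ℤ) :
    transCLM p u x = transOp p u x := rfl

/-- The translation operator on bounded functions. -/
noncomputable def shiftCLM (e : ℤ × ℤ) : ((ℤ × ℤ) →ᵇ ℝ) →L[ℝ] ((ℤ × ℤ) →ᵇ ℝ) :=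
  LinearMap.mkContinuous
    { toFun := fun u => u.compContinuous ⟨fun x => x + e, continuous_of_discreteTopology⟩
      map_add' := fun u v => by ext x; rfl
      map_smul' := fun c u => by ext x; rfl } 1
    (fun u => by
      rw [one_mul]
      exact (norm_le (norm_nonneg u)).mpr fun x => u.norm_coe_le_norm _)

@[simp] lemma shiftCLM_apply (e : ℤ × ℤ) (u : (ℤ × ℤ) →ᵇ ℝ) (x : ℤ × ℤ) :
    shiftCLM e u x = u (x + e) := rfl

lemma norm_shiftCLM_le (e : ℤ × ℤ) : ‖shiftCLM e‖ ≤ 1 :=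
  LinearMap.mkContinuous_norm_le _ zero_le_one _

lemma commute_shiftCLM_transCLM (e : ℤ × ℤ) : Commute (shiftCLM e) (transCLM p) := by
  ext u x
  simp only [mul_apply_eq_comp, shiftCLM_apply, transCLM_apply, transOp]
  refine tsum_congr fun z => ?_
  rw [add_right_comm]

lemma transCLM_pow_apply (n : ℕ) (u : (ℤ × ℤ) →ᵇ ℝ) (x : ℤ × ℤ) :
    (transCLM p ^ n) u x = (transOp p)^[n] u x := by
  induction n generalizing x with
  | zero => rfl
  | succ n ih =>
    rw [pow_succ', mul_apply_eq_comp, transCLM_apply, Function.iterate_succ_apply']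
    congr 1
    funext z
    exact ih z

/-- Domination of operators on nonnegative functions. -/
def Dominates (A B : ((ℤ × ℤ) →ᵇ ℝ) →L[ℝ] ((ℤ × ℤ) →ᵇ ℝ)) : Prop :=
  ∀ u : (ℤ × ℤ) →ᵇ ℝ, (∀ x, 0 ≤ u x) → ∀ x, B u x ≤ A u x

lemma transCLM_pow_nonneg (n : ℕ) {u : (ℤ × ℤ) →ᵇ ℝ} (hu : ∀ x, 0 ≤ u x) (x : ℤ × ℤ) :
    0 ≤ (transCLM p ^ n) u x := by
  induction n generalizing x with
  | zero => exact hu x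
  | succ n ih =>
    rw [pow_succ', mul_apply_eq_comp, transCLM_apply]
    exact transOp_nonneg ih x

lemma transCLM_pow_mono (n : ℕ) {u v : (ℤ × ℤ) →ᵇ ℝ} (huv : ∀ x, u x ≤ v x) (x : ℤ × ℤ) :
    (transCLM p ^ n) u x ≤ (transCLM p ^ n) v x := by
  have := transCLM_pow_nonneg (p := p) n (u := v - u) (fun x => sub_nonneg.mpr (huv x)) x
  rw [map_sub] at this
  exact sub_nonneg.mp this

/-! ### Displacements reachable at even times -/

lemma dominates_mul {m n : ℕ} {a b : ℝ} (hb : 0 ≤ b) {e e' : ℤ × ℤ}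
    (h : Dominates (transCLM p ^ m) (a • shiftCLM e))
    (h' : Dominates (transCLM p ^ n) (b • shiftCLM e')) :
    Dominates (transCLM p ^ (m + n)) ((a * b) • shiftCLM (e + e')) := by
  intro u hu x
  have hv : ∀ y, 0 ≤ (b • shiftCLM e') u y := fun y => mul_nonneg hb (hu _)
  have h1 := h _ hv x
  have h2 := transCLM_pow_mono (p := p) m (h' u hu) x
  rw [pow_add, mul_apply_eq_comp]
  refine le_trans (le_of_eq ?_) (h1.trans h2)
  change a * b * u (x + (e + e')) = a * (b * u (x + e + e'))
  rw [add_assoc, mul_assoc]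

lemma dominates_step (z : ℤ × ℤ) : Dominates (transCLM p ^ 1) (step p z • shiftCLM z) := by
  intro u hu x
  rw [pow_one]
  exact step_mul_le_transOp (bdd_coe u) hu x z

lemma dominates_zero : Dominates (transCLM p ^ 0) ((1 : ℝ) • shiftCLM 0) := by
  intro u _ x
  change 1 * u (x + 0) ≤ u x
  simp

lemma step_pos_iff {z : ℤ × ℤ} : 0 < step p z ↔ z ∈ p.support := by
  rw [step, PMF.mem_support_iff, ENNReal.toReal_pos_iff]
  constructor
  · exact fun h => h.1.ne'
  · exact fun h => ⟨pos_iff_ne_zero.mpr h, lt_top_iff_ne_top.mpr (p.apply_ne_top z)⟩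

/-- By strong aperiodicity every displacement is possible at all large even times. -/
lemma exists_dominates_even (hp : RegularWalk p) (e : ℤ × ℤ) :
    ∃ k₀ : ℕ, ∀ k, k₀ ≤ k → ∃ c : ℝ, 0 < c ∧ Dominates (transCLM p ^ (2 * k)) (c • shiftCLM e) := by
  obtain ⟨s, hs⟩ := p.support_nonempty
  have hs0 : 0 < step p s := step_pos_iff.mpr hs
  -- Both `-s + z` and its negative are displacements of two possible steps, by symmetry. Strong
  -- aperiodicity at the point `-s` says that these displacements generate the lattice.
  have hpair : ∀ z ∈ p.support, ∃ c : ℝ, 0 < c ∧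
      Dominates (transCLM p ^ (2 * 1)) (c • shiftCLM (-s + z)) ∧
      Dominates (transCLM p ^ (2 * 1)) (c • shiftCLM (-(-s + z))) := by
    intro z hz
    have hz0 : 0 < step p z := step_pos_iff.mpr hz
    refine ⟨step p s * step p z, mul_pos hs0 hz0, ?_, ?_⟩
    · have := dominates_mul (step_nonneg p z) (dominates_step (p := p) (-s)) (dominates_step z)
      rwa [step_neg hp.symm] at this
    · have := dominates_mul (step_nonneg p (-z)) (dominates_step (p := p) s) (dominates_step (-z))
      rwa [step_neg hp.symm, show s + -z = -(-s + z) by abel] at this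
  have hmain : ∀ e ∈ AddSubgroup.closure ((fun z => -s + z) '' p.support),
      (∃ k : ℕ, ∃ c : ℝ, 0 < c ∧ Dominates (transCLM p ^ (2 * k)) (c • shiftCLM e)) ∧
      (∃ k : ℕ, ∃ c : ℝ, 0 < c ∧ Dominates (transCLM p ^ (2 * k)) (c • shiftCLM (-e))) := by
    intro e he
    induction he using AddSubgroup.closure_induction with
    | mem x hx =>
      obtain ⟨z, hz, rfl⟩ := hx
      obtain ⟨c, hc, h1, h2⟩ := hpair z hz
      exact ⟨⟨1, c, hc, h1⟩, ⟨1, c, hc, h2⟩⟩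
    | zero =>
      exact ⟨⟨0, 1, one_pos, dominates_zero⟩, ⟨0, 1, one_pos, by rw [neg_zero]; exact dominates_zero⟩⟩
    | add x y _ _ hx hy =>
      obtain ⟨⟨k1, c1, hc1, h1⟩, ⟨k2, c2, hc2, h2⟩⟩ := hx
      obtain ⟨⟨k3, c3, hc3, h3⟩, ⟨k4, c4, hc4, h4⟩⟩ := hy
      refine ⟨⟨k1 + k3, c1 * c3, mul_pos hc1 hc3, ?_⟩, ⟨k2 + k4, c2 * c4, mul_pos hc2 hc4, ?_⟩⟩
      · rw [mul_add]; exact dominates_mul hc3.le h1 h3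
      · rw [mul_add, neg_add]; exact dominates_mul hc4.le h2 h4
    | neg x _ hx =>
      refine ⟨hx.2, ?_⟩
      rw [neg_neg]
      exact hx.1
  -- Loops made of `-s` and `s` exist at every even length, so a displacement possible at one even
  -- time stays possible at all later even times.
  have hzero : ∀ k : ℕ, ∃ c : ℝ, 0 < c ∧ Dominates (transCLM p ^ (2 * k)) (c • shiftCLM 0) := by
    intro k
    induction k with
    | zero => exact ⟨1, one_pos, dominates_zero⟩
    | succ k ih =>
      obtain ⟨c, hc, h⟩ := ih
      obtain ⟨c', hc', h', _⟩ := hpair s hs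
      refine ⟨c * c', mul_pos hc hc', ?_⟩
      rw [neg_add_cancel] at h'
      have := dominates_mul hc'.le h h'
      rwa [add_zero, ← mul_add] at this
  have hmem : e ∈ AddSubgroup.closure ((fun z => -s + z) '' p.support) := by
    rw [hp.aper (-s)]; trivial
  obtain ⟨⟨k₀, c, hc, h⟩, -⟩ := hmain e hmem
  refine ⟨k₀, fun k hk => ?_⟩
  obtain ⟨c', hc', h'⟩ := hzero (k - k₀)
  refine ⟨c * c', mul_pos hc hc', ?_⟩
  have := dominates_mul hc'.le h h'
  rwa [add_zero, ← mul_add, Nat.add_sub_cancel' hk] at this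

lemma transCLM_pow_const (n : ℕ) (c : ℝ) (x : ℤ × ℤ) :
    (transCLM p ^ n) (toBCF (fun _ => c) (Bdd.const c)) x = c := by
  induction n generalizing x with
  | zero => rfl
  | succ n ih =>
    rw [pow_succ', mul_apply_eq_comp, transCLM_apply]
    have : ((transCLM p ^ n) (toBCF (fun _ => c) (Bdd.const c)) : ℤ × ℤ → ℝ) = fun _ => c :=
      funext ih
    rw [this, transOp_const]

/-- The powers of the transition operator smooth out in a direction in which a lazy step is
possible. -/
lemma norm_shift_sub_one_mul_pow_le {m : ℕ} {e : ℤ × ℤ} {c₀ c₁ : ℝ} (hc₀ : 0 < c₀) (hc₁ : 0 < c₁)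
    (h₀ : Dominates (transCLM p ^ m) (c₀ • shiftCLM 0))
    (h₁ : Dominates (transCLM p ^ m) (c₁ • shiftCLM e)) :
    ∃ C : ℝ, 0 ≤ C ∧ ∀ N : ℕ,
      ‖(shiftCLM e - 1) * transCLM p ^ (m * N)‖ ≤ C / Real.sqrt (N + 1 : ℕ) := by
  set c := min c₀ c₁ with hc
  have hcpos : 0 < c := lt_min hc₀ hc₁
  set Q := transCLM p ^ m - (c / 2) • (1 + shiftCLM e) with hQ
  have hQpos : ∀ u : (ℤ × ℤ) →ᵇ ℝ, (∀ x, 0 ≤ u x) → ∀ x, 0 ≤ Q u x := by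
    intro u hu x
    have e0 := h₀ u hu x
    have e1 := h₁ u hu x
    change c₀ * u (x + 0) ≤ _ at e0
    change c₁ * u (x + e) ≤ _ at e1
    rw [add_zero] at e0
    change 0 ≤ (transCLM p ^ m) u x - c / 2 * (u x + u (x + e))
    have hx := hu x
    have hxe := hu (x + e)
    have hc0 : c ≤ c₀ := min_le_left _ _
    have hc1 : c ≤ c₁ := min_le_right _ _
    nlinarith
  have hQconst : ∀ (a : ℝ) (x : ℤ × ℤ), Q (toBCF (fun _ => a) (Bdd.const a)) x = a - c * a := by
    intro a x
    change (transCLM p ^ m) (toBCF (fun _ => a) (Bdd.const a)) x - c / 2 * (a + a) = _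
    rw [transCLM_pow_const]
    ring
  have hc1 : c ≤ 1 := by
    have := hQpos (toBCF (fun _ => 1) (Bdd.const 1)) (fun _ => zero_le_one) 0
    rw [hQconst] at this
    linarith
  -- A positive operator on bounded functions has as norm the supremum of its image of the constant
  -- `1`, which is `1 - c` here.
  have hQnorm : ‖Q‖ ≤ 1 - c := by
    refine ContinuousLinearMap.opNorm_le_bound _ (by linarith) fun u => ?_
    refine (norm_le (mul_nonneg (by linarith) (norm_nonneg _))).mpr fun x => ?_
    have hux : ∀ y, |u y| ≤ ‖u‖ := fun y => u.norm_coe_le_norm y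
    have g1 := hQpos (toBCF (fun _ => ‖u‖) (Bdd.const _) - u)
      (fun y => sub_nonneg.mpr (abs_le.mp (hux y)).2) x
    have g2 := hQpos (toBCF (fun _ => ‖u‖) (Bdd.const _) + u)
      (fun y => by
        have := (abs_le.mp (hux y)).1
        change 0 ≤ ‖u‖ + u y
        linarith) x
    rw [map_sub] at g1
    rw [map_add] at g2
    change 0 ≤ Q (toBCF (fun _ => ‖u‖) (Bdd.const _)) x - Q u x at g1
    change 0 ≤ Q (toBCF (fun _ => ‖u‖) (Bdd.const _)) x + Q u x at g2
    rw [hQconst] at g1 g2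
    rw [Real.norm_eq_abs, abs_le]
    constructor <;> linarith
  refine ⟨2 / Real.sqrt c, by positivity, fun N => ?_⟩
  have h := norm_sub_one_mul_pow_le (𝔸 := ((ℤ × ℤ) →ᵇ ℝ) →L[ℝ] ((ℤ × ℤ) →ᵇ ℝ))
    (T := shiftCLM e) (P := transCLM p ^ m) ((commute_shiftCLM_transCLM e).pow_right m)
    (norm_shiftCLM_le e) hcpos hc1 hQnorm N
  rw [← pow_mul, Real.sqrt_mul hcpos.le] at h
  rw [div_div]
  exact h

lemma abs_shift_nsmul_le {e : ℤ × ℤ} {v : ℤ × ℤ → ℝ} {K : ℝ} (h : ∀ x, |v (x + e) - v x| ≤ K)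
    (x : ℤ × ℤ) (k : ℤ) : |v (x + k • e) - v x| ≤ |(k : ℝ)| * K := by
  have hnat : ∀ (k : ℕ) (x : ℤ × ℤ), |v (x + k • e) - v x| ≤ k * K := by
    intro k
    induction k with
    | zero => intro x; simp
    | succ k ih =>
      intro x
      have e1 : v (x + (k + 1) • e) - v x
          = (v (x + k • e + e) - v (x + k • e)) + (v (x + k • e) - v x) := by
        rw [succ_nsmul, add_assoc]; ring
      rw [e1]
      refine (abs_add_le _ _).trans ?_
      have := h (x + k • e)
      have := ih x
      push_cast
      linarith
  obtain ⟨n, rfl | rfl⟩ := k.eq_nat_or_neg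
  · simpa using hnat n x
  · have := hnat n (x + (-(n : ℤ)) • e)
    rw [abs_sub_comm]
    simpa using this

/-- The walk at time `m N` from points at distance `d` has total variation distance
`O(d / √N)`. -/
theorem exists_abs_iterate_transOp_sub_le (hp : RegularWalk p) :
    ∃ m : ℕ, ∃ C : ℝ, 0 < m ∧ 0 ≤ C ∧ ∀ (N : ℕ) (u : ℤ × ℤ → ℝ) (B : ℝ), (∀ z, |u z| ≤ B) →
      ∀ x h : ℤ × ℤ, |(transOp p)^[m * N] u (x + h) - (transOp p)^[m * N] u x|
        ≤ C * euclid h * B / Real.sqrt (N + 1 : ℕ) := by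
  obtain ⟨k0, hk0⟩ := exists_dominates_even hp 0
  obtain ⟨k1, hk1⟩ := exists_dominates_even hp (1, 0)
  obtain ⟨k2, hk2⟩ := exists_dominates_even hp (0, 1)
  -- One common time serves the zero displacement and both coordinate displacements; the extra `1`
  -- makes it positive.
  set k := k0 + k1 + k2 + 1 with hk
  obtain ⟨c0, hc0, h0⟩ := hk0 k (by omega)
  obtain ⟨c1, hc1, h1⟩ := hk1 k (by omega)
  obtain ⟨c2, hc2, h2⟩ := hk2 k (by omega)
  obtain ⟨C1, hC1, H1⟩ := norm_shift_sub_one_mul_pow_le hc0 hc1 h0 h1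
  obtain ⟨C2, hC2, H2⟩ := norm_shift_sub_one_mul_pow_le hc0 hc2 h0 h2
  refine ⟨2 * k, C1 + C2, by omega, by positivity, fun N u B hu x h => ?_⟩
  have hB : 0 ≤ B := (abs_nonneg _).trans (hu 0)
  set U := toBCF u ⟨B, hu⟩
  have hU : ‖U‖ ≤ B := (norm_le hB).mpr hu
  set v : ℤ × ℤ → ℝ := (transOp p)^[2 * k * N] u
  have hv : ∀ y, v y = (transCLM p ^ (2 * k * N)) U y := fun y => (transCLM_pow_apply _ U y).symm
  set s := Real.sqrt (N + 1 : ℕ)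
  have hs : 0 < s := Real.sqrt_pos.mpr (by positivity)
  have hdir : ∀ (e : ℤ × ℤ) (C : ℝ), 0 ≤ C →
      ‖(shiftCLM e - 1) * transCLM p ^ (2 * k * N)‖ ≤ C / s → ∀ y, |v (y + e) - v y| ≤ C / s * B := by
    intro e C hC hn y
    rw [hv, hv]
    have g1 := ((shiftCLM e - 1) * transCLM p ^ (2 * k * N)).le_opNorm U
    have g2 := (((shiftCLM e - 1) * transCLM p ^ (2 * k * N)) U).norm_coe_le_norm y
    calc _ ≤ _ := g2
      _ ≤ _ := g1
      _ ≤ C / s * B := mul_le_mul hn hU (norm_nonneg _) (by positivity)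
  have d1 := abs_shift_nsmul_le (hdir _ C1 hC1 (H1 N)) x h.1
  have d2 := abs_shift_nsmul_le (hdir _ C2 hC2 (H2 N)) (x + h.1 • ((1, 0) : ℤ × ℤ)) h.2
  have hxh : x + h = x + h.1 • ((1, 0) : ℤ × ℤ) + h.2 • ((0, 1) : ℤ × ℤ) := by
    ext <;> simp
  rw [hxh]
  have t := abs_sub_le (v (x + h.1 • ((1, 0) : ℤ × ℤ) + h.2 • ((0, 1) : ℤ × ℤ)))
    (v (x + h.1 • ((1, 0) : ℤ × ℤ))) (v x)
  have b1 : |(h.1 : ℝ)| * (C1 / s * B) ≤ euclid h * (C1 / s * B) := by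
    gcongr
    exact abs_fst_le_euclid h
  have b2 : |(h.2 : ℝ)| * (C2 / s * B) ≤ euclid h * (C2 / s * B) := by
    gcongr
    exact abs_snd_le_euclid h
  calc _ ≤ _ := t
    _ ≤ euclid h * (C2 / s * B) + euclid h * (C1 / s * B) := by linarith
    _ = _ := by ring

end PlanarWalk

namespace PlanarWalk

/-! ### The regularised logarithm -/

/-- At the junction the two one-sided derivatives agree, so they combine into a derivative. Used
three times, this glues the logarithm to its Taylor polynomial with third-order matching. -/
lemma hasDerivAt_piecewise {f g f' g' : ℝ → ℝ} (hf : ∀ x, x ≤ 1 → HasDerivAt f (f' x) x)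
    (hg : ∀ x, 1 ≤ x → HasDerivAt g (g' x) x) (h : f 1 = g 1) (h' : f' 1 = g' 1) (x : ℝ) :
    HasDerivAt (fun x => if x ≤ 1 then f x else g x) (if x ≤ 1 then f' x else g' x) x := by
  rcases lt_trichotomy x 1 with hx | rfl | hx
  · rw [if_pos hx.le]
    refine (hf x hx.le).congr_of_eventuallyEq ?_
    filter_upwards [eventually_le_nhds hx] with y hy
    rw [if_pos hy]
  · rw [if_pos le_rfl]
    have h1 : HasDerivWithinAt (fun x => if x ≤ 1 then f x else g x) (f' 1) (Set.Iic 1) 1 := by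
      refine (hf 1 le_rfl).hasDerivWithinAt.congr (fun y hy => ?_) ?_
      · rw [if_pos (Set.mem_Iic.mp hy)]
      · rw [if_pos le_rfl]
    have h2 : HasDerivWithinAt (fun x => if x ≤ 1 then f x else g x) (f' 1) (Set.Ici 1) 1 := by
      rw [h']
      refine (hg 1 le_rfl).hasDerivWithinAt.congr (fun y hy => ?_) ?_
      · rcases (Set.mem_Ici.mp hy).eq_or_lt with e | e
        · rw [← e, if_pos le_rfl, h]
        · rw [if_neg (not_le.mpr e)]
      · rw [if_pos le_rfl, h]
    have h3 := h1.union h2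
    rw [Set.Iic_union_Ici] at h3
    exact h3.hasDerivAt Filter.univ_mem
  · rw [if_neg (not_le.mpr hx)]
    refine (hg x hx.le).congr_of_eventuallyEq ?_
    filter_upwards [eventually_gt_nhds hx] with y hy
    rw [if_neg (not_le.mpr hy)]

/-- `½ log x` for `x ≥ 1`, continued by its Taylor polynomial of order three for `x ≤ 1`. -/
noncomputable def regLog (x : ℝ) : ℝ :=
  if x ≤ 1 then ((x - 1) - (x - 1) ^ 2 / 2 + (x - 1) ^ 3 / 3) / 2 else Real.log x / 2

/-- The derivative of `regLog`. -/
noncomputable def regLog1 (x : ℝ) : ℝ :=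
  if x ≤ 1 then (1 - (x - 1) + (x - 1) ^ 2) / 2 else x⁻¹ / 2

/-- The second derivative of `regLog`. -/
noncomputable def regLog2 (x : ℝ) : ℝ :=
  if x ≤ 1 then (-1 + 2 * (x - 1)) / 2 else -(x ^ 2)⁻¹ / 2

/-- The third derivative of `regLog`. -/
noncomputable def regLog3 (x : ℝ) : ℝ := if x ≤ 1 then 1 else (x ^ 3)⁻¹

lemma radialC3_regLog : RadialC3 regLog regLog1 regLog2 regLog3 2 where
  deriv0 x _ := by
    refine hasDerivAt_piecewise (f' := fun x => (1 - (x - 1) + (x - 1) ^ 2) / 2)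
      (g' := fun x => x⁻¹ / 2) (fun x _ => ?_) (fun x hx => ?_) (by norm_num) (by norm_num) x
    · have hy := (hasDerivAt_id x).sub_const 1
      have := ((hy.sub ((hy.pow 2).div_const 2)).add ((hy.pow 3).div_const 3)).div_const 2
      refine this.congr_deriv ?_
      simp only [id]
      push_cast
      ring
    · exact (Real.hasDerivAt_log (by positivity)).div_const 2
  deriv1 x _ := by
    refine hasDerivAt_piecewise (f' := fun x => (-1 + 2 * (x - 1)) / 2)
      (g' := fun x => -(x ^ 2)⁻¹ / 2) (fun x _ => ?_) (fun x hx => ?_) (by norm_num)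
      (by norm_num) x
    · have hy := (hasDerivAt_id x).sub_const 1
      have := ((hy.const_sub 1).add (hy.pow 2)).div_const 2
      refine this.congr_deriv ?_
      simp only [id]
      push_cast
      ring
    · exact (hasDerivAt_inv (by positivity)).div_const 2
  deriv2 x _ := by
    refine hasDerivAt_piecewise (f' := fun _ => 1)
      (g' := fun x => (x ^ 3)⁻¹) (fun x _ => ?_) (fun x hx => ?_) (by norm_num)
      (by norm_num) x
    · have hy := (hasDerivAt_id x).sub_const 1
      have := ((hy.const_mul 2).const_add (-1)).div_const 2
      refine this.congr_deriv ?_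
      norm_num
    · have hx0 : x ≠ 0 := by positivity
      have := (((hasDerivAt_pow 2 x).inv (by positivity)).neg).div_const 2
      refine this.congr_deriv ?_
      field_simp
      norm_num
      ring
  bound2 y hy := by
    rw [regLog2]
    split_ifs with h
    · have hy1 : y ≤ 1 := by nlinarith
      rw [abs_of_nonpos (by linarith)]
      nlinarith
    · have hy1 : 1 ≤ y := by nlinarith
      have h1 : ((y ^ 2) ^ 2)⁻¹ * y ≤ 1 := by
        rw [inv_mul_le_one₀ (by positivity), ← pow_mul]
        exact le_self_pow₀ hy1 (by norm_num)
      rw [abs_div, abs_neg, abs_of_pos (by positivity), abs_of_pos two_pos]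
      linarith
  bound3 y hy := by
    rw [regLog3]
    split_ifs with h
    · have hy1 : y ≤ 1 := by nlinarith
      rw [abs_one, one_mul]
      linarith [pow_le_one₀ (n := 3) hy hy1]
    · have hy1 : 1 ≤ y := by nlinarith
      have h1 : ((y ^ 2) ^ 3)⁻¹ * y ^ 3 ≤ 1 := by
        rw [inv_mul_le_one₀ (by positivity), ← pow_mul]
        exact pow_le_pow_right₀ hy1 (by norm_num)
      rw [abs_of_pos (by positivity)]
      linarith

/-- The left side is the radial Laplacian up to scaling. It vanishes for `x ≥ 1`, where the function
is a planar logarithm, and the cubic continuation makes it a perfect square below `1`. This dictates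
the shape of `bump`, whose factor is `3 = 2 · 3/2`. -/
lemma regLog1_add_mul_regLog2 (x : ℝ) :
    regLog1 x + x * regLog2 x = 3 / 2 * (max (1 - x) 0) ^ 2 := by
  rw [regLog1, regLog2]
  split_ifs with h
  · rw [max_eq_left (by linarith)]; ring
  · push Not at h
    rw [max_eq_right (by linarith)]
    field_simp
    norm_num

lemma abs_regLog_le {x : ℝ} (h0 : 0 ≤ x) (h1 : x ≤ 1) : |regLog x| ≤ 1 := by
  rw [regLog, if_pos h1, abs_le]
  constructor <;> nlinarith [mul_nonneg h0 h0, mul_nonneg (mul_nonneg h0 h0) h0,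
    mul_nonneg h0 (sub_nonneg.mpr h1), mul_nonneg h0 (sq_nonneg (1 - x)),
    pow_nonneg (sub_nonneg.mpr h1) 3]

/-! ### Smooth bumps on the plane -/

/-- The bump `3 s⁻² ((1 - |w - c|² / s²)⁺)²`. -/
noncomputable def bump (s : ℝ) (c w : ℤ × ℤ) : ℝ :=
  3 / s ^ 2 * (max (1 - euclid (w - c) ^ 2 / s ^ 2) 0) ^ 2

lemma bump_nonneg (s : ℝ) (c w : ℤ × ℤ) : 0 ≤ bump s c w := by
  unfold bump; positivity

lemma bump_le (s : ℝ) (c w : ℤ × ℤ) : bump s c w ≤ 3 / s ^ 2 := by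
  have h : max (1 - euclid (w - c) ^ 2 / s ^ 2) 0 ≤ 1 :=
    max_le (by have : 0 ≤ euclid (w - c) ^ 2 / s ^ 2 := by positivity
               linarith) zero_le_one
  have h2 : (max (1 - euclid (w - c) ^ 2 / s ^ 2) 0) ^ 2 ≤ 1 :=
    pow_le_one₀ (le_max_right _ _) h
  exact mul_le_of_le_one_right (by positivity) h2

lemma bump_eq_zero {s : ℝ} (hs : 0 < s) {c w : ℤ × ℤ} (h : s ≤ euclid (w - c)) :
    bump s c w = 0 := by
  have : 1 ≤ euclid (w - c) ^ 2 / s ^ 2 := by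
    rw [one_le_div (by positivity)]
    exact pow_le_pow_left₀ hs.le h 2
  rw [bump, max_eq_right (by linarith)]
  ring

lemma le_bump {s : ℝ} (hs : 0 < s) {c w : ℤ × ℤ} (h : euclid (w - c) ≤ s / 2) :
    27 / (16 * s ^ 2) ≤ bump s c w := by
  have h1 : euclid (w - c) ^ 2 / s ^ 2 ≤ 1 / 4 := by
    rw [div_le_iff₀ (by positivity)]
    nlinarith [euclid_nonneg (w - c)]
  have h2 : 3 / 4 ≤ max (1 - euclid (w - c) ^ 2 / s ^ 2) 0 := le_max_of_le_left (by linarith)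
  calc 27 / (16 * s ^ 2) = 3 / s ^ 2 * (3 / 4) ^ 2 := by field_simp; norm_num
    _ ≤ _ := by unfold bump; gcongr

lemma abs_bump_sub_le {s : ℝ} (hs : 0 < s) (c c' w : ℤ × ℤ) :
    |bump s c w - bump s c' w| ≤ 12 / s ^ 3 * euclid (c - c') := by
  have key : ∀ t u : ℝ, 0 ≤ t → 0 ≤ u →
      |(max (1 - t ^ 2) 0) ^ 2 - (max (1 - u ^ 2) 0) ^ 2| ≤ 4 * |t - u| := by
    intro t u ht hu
    have hA : |max (1 - t ^ 2) 0 - max (1 - u ^ 2) 0| ≤ 2 * |t - u| := by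
      rcases le_total t 1 with h1 | h1 <;> rcases le_total u 1 with h2 | h2
      · rw [max_eq_left (by nlinarith), max_eq_left (by nlinarith)]
        have : 1 - t ^ 2 - (1 - u ^ 2) = (u + t) * (u - t) := by ring
        rw [this, abs_mul, abs_sub_comm u t, abs_of_nonneg (by linarith)]
        gcongr
        linarith
      · rw [max_eq_left (by nlinarith), max_eq_right (by nlinarith), sub_zero,
          abs_of_nonneg (by nlinarith), abs_of_nonpos (by linarith)]
        nlinarith
      · rw [max_eq_right (by nlinarith), max_eq_left (by nlinarith), zero_sub, abs_neg,
          abs_of_nonneg (by nlinarith), abs_of_nonneg (by linarith)]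
        nlinarith
      · rw [max_eq_right (by nlinarith), max_eq_right (by nlinarith), sub_zero, abs_zero]
        positivity
    have hb : ∀ r : ℝ, max (1 - r ^ 2) 0 ≤ 1 := fun r => max_le (by nlinarith [sq_nonneg r]) zero_le_one
    have h3 : |max (1 - t ^ 2) 0 + max (1 - u ^ 2) 0| ≤ 2 := by
      rw [abs_of_nonneg (add_nonneg (le_max_right _ _) (le_max_right _ _))]
      linarith [hb t, hb u]
    rw [sq_sub_sq, abs_mul]
    calc _ ≤ 2 * (2 * |t - u|) := mul_le_mul h3 hA (abs_nonneg _) zero_le_two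
      _ = _ := by ring
  have h := key (euclid (w - c) / s) (euclid (w - c') / s)
    (div_nonneg (euclid_nonneg _) hs.le) (div_nonneg (euclid_nonneg _) hs.le)
  rw [← sub_div, abs_div, abs_of_pos hs, div_pow, div_pow] at h
  have h2 : |euclid (w - c) - euclid (w - c')| ≤ euclid (c - c') := by
    rw [abs_le]
    have e1 := euclid_sub_le w c c'
    have e2 := euclid_sub_le w c' c
    rw [euclid_sub_comm c' c] at e2
    constructor <;> linarith
  rw [bump, bump, ← mul_sub, abs_mul, abs_of_pos (by positivity : 0 < 3 / s ^ 2)]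
  calc _ ≤ 3 / s ^ 2 * (4 * (|euclid (w - c) - euclid (w - c')| / s)) := by gcongr
    _ ≤ 3 / s ^ 2 * (4 * (euclid (c - c') / s)) := by gcongr
    _ = _ := by ring

lemma le_sum_bump {s : ℝ} (hs : 0 < s) (c : ℤ × ℤ) {E : Finset (ℤ × ℤ)} (hE : discF c s ⊆ E) :
    1 / 10 ≤ ∑ w ∈ E, bump s c w := by
  have hsub : discF c (s / 2) ⊆ E := by
    refine Finset.Subset.trans (fun w hw => ?_) hE
    rw [mem_discF] at hw ⊢
    linarith
  have h1 : ∑ w ∈ discF c (s / 2), (27 / (16 * s ^ 2)) ≤ ∑ w ∈ E, bump s c w := by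
    refine (Finset.sum_le_sum fun w hw => ?_).trans
      (Finset.sum_le_sum_of_subset_of_nonneg hsub fun w _ _ => bump_nonneg s c w)
    rw [mem_discF] at hw
    exact le_bump hs hw.le
  rw [Finset.sum_const, nsmul_eq_mul] at h1
  have h2 := le_card_discF c (half_pos hs)
  have h3 : (s / 2) ^ 2 / 4 * (27 / (16 * s ^ 2)) ≤ ((discF c (s / 2)).card : ℝ) * (27 / (16 * s ^ 2)) := by
    gcongr
  have h4 : (s / 2) ^ 2 / 4 * (27 / (16 * s ^ 2)) = 27 / 256 := by field_simp; norm_num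
  rw [h4] at h3
  linarith

lemma sum_bump_le {s : ℝ} (hs : 1 ≤ s) (c : ℤ × ℤ) (E : Finset (ℤ × ℤ)) :
    ∑ w ∈ E, bump s c w ≤ 75 := by
  classical
  have h1 : ∑ w ∈ E, bump s c w ≤ ∑ w ∈ discF c s, bump s c w := by
    calc ∑ w ∈ E, bump s c w ≤ ∑ w ∈ E ∪ discF c s, bump s c w :=
          Finset.sum_le_sum_of_subset_of_nonneg Finset.subset_union_left
            fun w _ _ => bump_nonneg s c w
      _ = _ := by
          symm
          refine Finset.sum_subset Finset.subset_union_right fun w _ hw => ?_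
          exact bump_eq_zero (by linarith) (by simpa using hw)
  have h2 : ∑ w ∈ discF c s, bump s c w ≤ (discF c s).card * (3 / s ^ 2) := by
    rw [← nsmul_eq_mul]
    exact Finset.sum_le_card_nsmul _ _ _ fun w _ => bump_le s c w
  have h3 := card_discF_le c hs
  have h4 : ((discF c s).card : ℝ) * (3 / s ^ 2) ≤ 25 * s ^ 2 * (3 / s ^ 2) := by gcongr
  have h5 : 25 * s ^ 2 * (3 / s ^ 2) = 75 := by field_simp; norm_num
  linarith

/-! ### The approximate mean value property -/

variable {p : PMF (ℤ × ℤ)}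

/-- The probability of a jump of length at least `s`. -/
noncomputable def tail (p : PMF (ℤ × ℤ)) (s : ℝ) : ℝ :=
  ∑' z, step p z * {z | s ≤ euclid z}.indicator 1 z

lemma abs_indicator_one_le (E : Set (ℤ × ℤ)) (z : ℤ × ℤ) :
    |E.indicator (1 : ℤ × ℤ → ℝ) z| ≤ 1 := by
  by_cases h : z ∈ E
  · rw [Set.indicator_of_mem h]; simp
  · rw [Set.indicator_of_notMem h]; simp

lemma tail_nonneg (p : PMF (ℤ × ℤ)) (s : ℝ) : 0 ≤ tail p s :=
  tsum_nonneg fun z => mul_nonneg (step_nonneg p z) (Set.indicator_nonneg (fun _ _ => zero_le_one) z)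

/-- If `g(x + z)` vanishes for `|z| < s` and is at most `1` then `P g(x)` is at most the tail. -/
lemma tsum_step_mul_le_tail {g : ℤ × ℤ → ℝ} {s : ℝ} (hg : ∀ z, |g z| ≤ 1)
    (h0 : ∀ z, euclid z < s → g z = 0) : ∑' z, step p z * g z ≤ tail p s := by
  refine (summable_step_mul hg).tsum_le_tsum (fun z => ?_)
    (summable_step_mul (abs_indicator_one_le {z | s ≤ euclid z}))
  refine mul_le_mul_of_nonneg_left ?_ (step_nonneg p z)
  by_cases hz : s ≤ euclid z
  · rw [Set.indicator_of_mem (show z ∈ {z | s ≤ euclid z} from hz)]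
    exact (abs_le.mp (hg z)).2
  · rw [h0 z (not_le.mp hz)]
    exact Set.indicator_nonneg (fun _ _ => zero_le_one) z

/-- The compactly supported radial function whose Laplacian is the difference of the bumps of
widths `a` and `ρ`. -/
noncomputable def kern (a ρ : ℝ) (c w : ℤ × ℤ) : ℝ :=
  radial regLog a c w - radial regLog ρ c w + (Real.log a - Real.log ρ)

lemma regLog_sq_div {a t : ℝ} (ha : 0 < a) (h : a ≤ t) :
    regLog (t ^ 2 / a ^ 2) = Real.log t - Real.log a := by
  have ht : 0 < t := ha.trans_le h
  rcases h.eq_or_lt with rfl | h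
  · rw [div_self (by positivity), regLog]; simp
  · have : 1 < t ^ 2 / a ^ 2 := by
      rw [one_lt_div (by positivity)]
      exact pow_lt_pow_left₀ h ha.le (by norm_num)
    rw [regLog, if_neg (not_le.mpr this), Real.log_div (by positivity) (by positivity),
      Real.log_pow, Real.log_pow]
    push_cast
    ring

/-- Beyond `ρ` both terms are exact logarithms and their difference is constant. The additive
constant in `kern` cancels it. -/
lemma kern_eq_zero {a ρ : ℝ} (ha : 0 < a) (haρ : a ≤ ρ) {c w : ℤ × ℤ} (h : ρ ≤ euclid (w - c)) :
    kern a ρ c w = 0 := by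
  rw [kern, radial, radial, regLog_sq_div ha (haρ.trans h), regLog_sq_div (ha.trans_le haρ) h]
  ring

lemma abs_kern_le {a ρ : ℝ} (ha : 0 < a) (haρ : a ≤ ρ) (c w : ℤ × ℤ) :
    |kern a ρ c w| ≤ 2 + 2 * (Real.log ρ - Real.log a) := by
  have hlog : Real.log a ≤ Real.log ρ := Real.log_le_log ha haρ
  rcases le_or_gt ρ (euclid (w - c)) with h | h
  · rw [kern_eq_zero ha haρ h, abs_zero]; linarith
  · have hw := euclid_nonneg (w - c)
    have h1 : |radial regLog ρ c w| ≤ 1 := by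
      refine abs_regLog_le (by positivity) ?_
      rw [div_le_one (by have := ha.trans_le haρ; positivity)]
      exact pow_le_pow_left₀ hw h.le 2
    have h2 : |radial regLog a c w| ≤ 1 + (Real.log ρ - Real.log a) := by
      rcases le_total (euclid (w - c)) a with h3 | h3
      · have : |radial regLog a c w| ≤ 1 := by
          refine abs_regLog_le (by positivity) ?_
          rw [div_le_one (by positivity)]
          exact pow_le_pow_left₀ hw h3 2
        linarith
      · rw [radial, regLog_sq_div ha h3]
        have e1 : Real.log a ≤ Real.log (euclid (w - c)) := Real.log_le_log ha h3
        have e2 : Real.log (euclid (w - c)) ≤ Real.log ρ := Real.log_le_log (by linarith) h.le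
        rw [abs_of_nonneg (by linarith)]
        linarith
    rw [abs_le] at h1 h2 ⊢
    rw [kern]
    constructor <;> linarith [h1.1, h1.2, h2.1, h2.2]

lemma abs_transOp_kern_sub_le (hp : RegularWalk p) {a ρ : ℝ} (ha : 0 < a) (haρ : a ≤ ρ)
    (c w : ℤ × ℤ) :
    |transOp p (kern a ρ c) w - kern a ρ c w - (bump a c w - bump ρ c w)|
      ≤ 80 * thirdMoment p / a ^ 3 := by
  have hρ : 0 < ρ := ha.trans_le haρ
  obtain ⟨s1, h1⟩ := radialC3_regLog.abs_transOp_sub_le hp.symm hp.cov hp.third ha c w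
  obtain ⟨s2, h2⟩ := radialC3_regLog.abs_transOp_sub_le hp.symm hp.cov hp.third hρ c w
  have hT : transOp p (kern a ρ c) w = transOp p (radial regLog a c) w
      - transOp p (radial regLog ρ c) w + (Real.log a - Real.log ρ) := by
    simp only [transOp, kern, mul_add, mul_sub (step p _) (radial _ _ _ _)]
    rw [(s1.sub s2).tsum_add ((summable_step p).mul_right _), s1.tsum_sub s2, tsum_mul_right,
      tsum_step, one_mul]
  rw [regLog1_add_mul_regLog2] at h1 h2
  have b1 : 2 / a ^ 2 * (3 / 2 * (max (1 - euclid (w - c) ^ 2 / a ^ 2) 0) ^ 2) = bump a c w := by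
    rw [bump]; ring
  have b2 : 2 / ρ ^ 2 * (3 / 2 * (max (1 - euclid (w - c) ^ 2 / ρ ^ 2) 0) ^ 2) = bump ρ c w := by
    rw [bump]; ring
  rw [b1] at h1
  rw [b2] at h2
  have hM := thirdMoment_nonneg p
  have h3 : 20 * 2 * thirdMoment p / ρ ^ 3 ≤ 20 * 2 * thirdMoment p / a ^ 3 := by gcongr
  have h4 : 80 * thirdMoment p / a ^ 3
      = 20 * 2 * thirdMoment p / a ^ 3 + 20 * 2 * thirdMoment p / a ^ 3 := by ring
  rw [hT, kern]
  rw [abs_le] at h1 h2 ⊢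
  constructor <;> linarith [h1.1, h1.2, h2.1, h2.2]

/-- Averages of a harmonic function over bumps of different widths nearly agree. -/
theorem abs_sum_bump_sub_le (hp : RegularWalk p) {a ρ : ℝ} (ha : 1 ≤ a) (haρ : a ≤ ρ)
    (c : ℤ × ℤ) {f : ℤ × ℤ → ℝ} (hf : ∀ z, f z ∈ Set.Icc (0 : ℝ) 1)
    (hharm : ∀ z, euclid (z - c) < ρ → transOp p f z = f z) :
    |∑ w ∈ discF c (2 * ρ), bump a c w * f w - ∑ w ∈ discF c (2 * ρ), bump ρ c w * f w|
      ≤ 80 * thirdMoment p / a ^ 3 * (∑ w ∈ discF c (2 * ρ), f w)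
        + 100 * ρ ^ 2 * (2 + 2 * (Real.log ρ - Real.log a)) * tail p ρ := by
  have ha0 : 0 < a := by linarith
  have hρ0 : 0 < ρ := by linarith
  set E := discF c (2 * ρ) with hE
  have hfb : Bdd f := .of_mem_Icc hf
  have hparts := sum_mul_transOp_sub hp.symm E (f := f) (v := kern a ρ c) hfb
    (fun z hz => kern_eq_zero ha0 haρ (by
      rw [hE, mem_discF, not_lt] at hz; linarith))
    (fun z _ hz => hharm z (by
      by_contra! h
      exact hz (kern_eq_zero ha0 haρ h)))
  set K := 2 + 2 * (Real.log ρ - Real.log a) with hK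
  have hlog : Real.log a ≤ Real.log ρ := Real.log_le_log ha0 haρ
  have hK0 : 0 ≤ K := by rw [hK]; linarith
  have htail0 := tail_nonneg p ρ
  -- The kernel lives within `ρ` of `c` and `E` has radius `2 ρ`, so only jumps of length at least
  -- `ρ` connect its support to the outside of `E`.
  have hrhs : |∑ w ∈ E, f w * (transOp p (kern a ρ c) w - kern a ρ c w)|
      ≤ 100 * ρ ^ 2 * K * tail p ρ := by
    rw [hparts, abs_neg]
    refine (Finset.abs_sum_le_sum_abs _ _).trans ?_
    have hterm : ∀ z ∈ E, |kern a ρ c z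
        * transOp p (fun w => (E : Set (ℤ × ℤ))ᶜ.indicator f w) z| ≤ K * tail p ρ := by
      intro z _
      rw [abs_mul]
      rcases le_or_gt ρ (euclid (z - c)) with h | h
      · rw [kern_eq_zero ha0 haρ h, abs_zero, zero_mul]
        positivity
      · have hnn : ∀ w, 0 ≤ (E : Set (ℤ × ℤ))ᶜ.indicator f w :=
          fun w => Set.indicator_nonneg (fun z _ => (hf z).1) w
        rw [abs_of_nonneg (transOp_nonneg hnn z)]
        refine mul_le_mul (abs_kern_le ha0 haρ c z) ?_ (transOp_nonneg hnn z) hK0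
        refine tsum_step_mul_le_tail (fun w => ?_) (fun w hw => ?_)
        · rw [abs_of_nonneg (hnn _)]
          exact Set.indicator_apply_le' (fun _ => (hf _).2) (fun _ => zero_le_one)
        · refine Set.indicator_of_notMem ?_ f
          rw [Set.notMem_compl_iff, Finset.mem_coe, hE, mem_discF]
          have := euclid_add_le (z - c) w
          rw [show z + w - c = z - c + w by abel]
          linarith
    refine (Finset.sum_le_card_nsmul _ _ _ hterm).trans ?_
    rw [nsmul_eq_mul]
    have hcard := card_discF_le c (r := 2 * ρ) (by linarith)
    calc (E.card : ℝ) * (K * tail p ρ) ≤ 25 * (2 * ρ) ^ 2 * (K * tail p ρ) := by gcongr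
      _ = _ := by ring
  have hdiff : |∑ w ∈ E, f w * (transOp p (kern a ρ c) w - kern a ρ c w)
      - (∑ w ∈ E, bump a c w * f w - ∑ w ∈ E, bump ρ c w * f w)|
      ≤ 80 * thirdMoment p / a ^ 3 * ∑ w ∈ E, f w := by
    rw [← Finset.sum_sub_distrib, ← Finset.sum_sub_distrib, Finset.mul_sum]
    refine (Finset.abs_sum_le_sum_abs _ _).trans (Finset.sum_le_sum fun w _ => ?_)
    have e : f w * (transOp p (kern a ρ c) w - kern a ρ c w)
        - (bump a c w * f w - bump ρ c w * f w)
        = (transOp p (kern a ρ c) w - kern a ρ c w - (bump a c w - bump ρ c w)) * f w := by ring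
    rw [e, abs_mul, abs_of_nonneg (hf w).1]
    exact mul_le_mul_of_nonneg_right (abs_transOp_kern_sub_le hp ha0 haρ c w) (hf w).1
  rw [abs_le] at hrhs hdiff ⊢
  constructor <;> linarith [hrhs.1, hrhs.2, hdiff.1, hdiff.2]

end PlanarWalk

namespace PlanarWalk

variable {p : PMF (ℤ × ℤ)}

/-! ### Local regularity of harmonic functions -/

/-- A Lipschitz cutoff, equal to `1` on the disc of radius `ρ` about `x` and vanishing off the
disc of radius `2ρ`. -/
noncomputable def cutoff (ρ : ℝ) (x w : ℤ × ℤ) : ℝ := max 0 (min 1 (2 - euclid (w - x) / ρ))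

lemma cutoff_mem_Icc (ρ : ℝ) (x w : ℤ × ℤ) : cutoff ρ x w ∈ Set.Icc (0 : ℝ) 1 :=
  ⟨le_max_left _ _, max_le zero_le_one (min_le_left _ _)⟩

lemma cutoff_eq_one {ρ : ℝ} (hρ : 0 < ρ) {x w : ℤ × ℤ} (h : euclid (w - x) ≤ ρ) :
    cutoff ρ x w = 1 := by
  have : euclid (w - x) / ρ ≤ 1 := (div_le_one hρ).mpr h
  rw [cutoff, min_eq_left (by linarith), max_eq_right zero_le_one]

lemma cutoff_eq_zero {ρ : ℝ} (hρ : 0 < ρ) {x w : ℤ × ℤ} (h : 2 * ρ ≤ euclid (w - x)) :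
    cutoff ρ x w = 0 := by
  have : 2 ≤ euclid (w - x) / ρ := (le_div_iff₀ hρ).mpr h
  exact max_eq_left ((min_le_right _ _).trans (by linarith))

lemma abs_cutoff_sub_le {ρ : ℝ} (hρ : 0 < ρ) (x w z : ℤ × ℤ) :
    |cutoff ρ x (w + z) - cutoff ρ x w| ≤ euclid z / ρ := by
  have h1 := abs_max_sub_max_le_abs (min 1 (2 - euclid (w + z - x) / ρ))
    (min 1 (2 - euclid (w - x) / ρ)) 0
  rw [max_comm _ (0 : ℝ), max_comm _ (0 : ℝ)] at h1
  have h2 := abs_min_sub_min_le_max 1 (2 - euclid (w + z - x) / ρ) 1 (2 - euclid (w - x) / ρ)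
  rw [sub_self, abs_zero, max_eq_right (abs_nonneg _)] at h2
  refine (h1.trans h2).trans ?_
  have h3 := euclid_add_le (w - x) z
  have h4 := euclid_add_le (w + z - x) (-z)
  rw [show w - x + z = w + z - x by abel] at h3
  rw [show w + z - x + -z = w - x by abel, euclid_neg] at h4
  rw [show 2 - euclid (w + z - x) / ρ - (2 - euclid (w - x) / ρ)
    = (euclid (w - x) - euclid (w + z - x)) / ρ by ring, abs_div, abs_of_pos hρ]
  gcongr
  rw [abs_le]
  constructor <;> linarith

/-! ### Near-invariance of a harmonic function times a cutoff -/

section Cutoff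

variable {ρ S : ℝ} {x : ℤ × ℤ} {f : ℤ × ℤ → ℝ}

/-- This is a discrete product rule. `f` is harmonic wherever the cutoff is nonzero, so only
increments of the cutoff remain. -/
lemma transOp_mul_cutoff_sub (hρ : 0 < ρ) (hf : ∀ z, f z ∈ Set.Icc (0 : ℝ) 1)
    (hharm : ∀ z, euclid (z - x) < 2 * ρ → transOp p f z = f z) (w : ℤ × ℤ) :
    transOp p (fun z => f z * cutoff ρ x z) w - f w * cutoff ρ x w
      = ∑' z, step p z * (f (w + z) * (cutoff ρ x (w + z) - cutoff ρ x w)) := by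
  have hfb : Bdd f := .of_mem_Icc hf
  have hcb : Bdd (cutoff ρ x) := .of_mem_Icc (cutoff_mem_Icc ρ x)
  have h1 : f w * cutoff ρ x w = cutoff ρ x w * transOp p f w := by
    rcases le_or_gt (2 * ρ) (euclid (w - x)) with h | h
    · rw [cutoff_eq_zero hρ h]; ring
    · rw [hharm w h]; ring
  rw [h1, ← transOp_const_mul, ← transOp_sub (hfb.mul hcb) ((Bdd.const _).mul hfb), transOp]
  exact tsum_congr fun z => by ring

lemma abs_tsum_step_mul_le_of_le {g b : ℤ × ℤ → ℝ} {B : ℝ} (hgb : ∀ z, |g z| ≤ b z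
      + {z | ρ ≤ euclid z}.indicator 1 z) (hb : HasSum (fun z => step p z * b z) B) :
    |∑' z, step p z * g z| ≤ B + tail p ρ := by
  have h2 : HasSum (fun z => step p z * {z | ρ ≤ euclid z}.indicator 1 z) (tail p ρ) :=
    (summable_step_mul (abs_indicator_one_le {z | ρ ≤ euclid z})).hasSum
  rw [← Real.norm_eq_abs]
  refine tsum_of_norm_bounded (hb.add h2) fun z => ?_
  rw [Real.norm_eq_abs, abs_mul, abs_of_nonneg (step_nonneg p z), ← mul_add]
  exact mul_le_mul_of_nonneg_left (hgb z) (step_nonneg p z)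

/-- A landing point within `3 ρ` of `x` is charged at the local bound `S`. A landing point further
away matters only if the starting point was within `2 ρ`, hence only after a jump of length at least
`ρ`, and is charged at the trivial bound `1`. -/
lemma abs_mul_cutoff_diff_le (hρ : 0 < ρ) (hf : ∀ z, f z ∈ Set.Icc (0 : ℝ) 1)
    (hS : ∀ z, euclid (z - x) < 3 * ρ → f z ≤ S) (hS0 : 0 ≤ S) {w z : ℤ × ℤ} {b : ℝ}
    (hb0 : 0 ≤ b) (hb : |cutoff ρ x (w + z) - cutoff ρ x w| ≤ b) :
    |f (w + z) * (cutoff ρ x (w + z) - cutoff ρ x w)|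
      ≤ S * b + {z | ρ ≤ euclid z}.indicator 1 z := by
  have hind : 0 ≤ {z : ℤ × ℤ | ρ ≤ euclid z}.indicator (1 : ℤ × ℤ → ℝ) z :=
    Set.indicator_nonneg (fun _ _ => zero_le_one) z
  rw [abs_mul, abs_of_nonneg (hf _).1]
  rcases lt_or_ge (euclid (w + z - x)) (3 * ρ) with h | h
  · have := mul_le_mul (hS _ h) hb (abs_nonneg _) hS0
    linarith
  · have hSb : 0 ≤ S * b := mul_nonneg hS0 hb0
    rw [cutoff_eq_zero hρ (by linarith), zero_sub, abs_neg, abs_of_nonneg (cutoff_mem_Icc _ _ _).1]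
    rcases le_or_gt (2 * ρ) (euclid (w - x)) with h2 | h2
    · rw [cutoff_eq_zero hρ h2, mul_zero]; linarith
    · have hz : ρ ≤ euclid z := by
        have := euclid_add_le (w - x) z
        rw [show w - x + z = w + z - x by abel] at this
        linarith
      rw [Set.indicator_of_mem (show z ∈ {z : ℤ × ℤ | ρ ≤ euclid z} from hz), Pi.one_apply]
      have := mul_le_one₀ (hf (w + z)).2 (cutoff_mem_Icc ρ x w).1 (cutoff_mem_Icc ρ x w).2
      linarith

lemma hasSum_step_mul_one_add_sq (hp : RegularWalk p) (c : ℝ) :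
    HasSum (fun z => step p z * (c * (1 + euclid z ^ 2))) (c * 3) := by
  have h := ((hasSum_step p).add (hasSum_euclid_sq hp.cov)).mul_left c
  rw [show (1 : ℝ) + 2 = 3 by norm_num] at h
  exact h.congr_fun' fun z => by ring

lemma abs_transOp_mul_cutoff_sub_le (hp : RegularWalk p) (hρ : 0 < ρ)
    (hf : ∀ z, f z ∈ Set.Icc (0 : ℝ) 1)
    (hharm : ∀ z, euclid (z - x) < 2 * ρ → transOp p f z = f z)
    (hS : ∀ z, euclid (z - x) < 3 * ρ → f z ≤ S) (hS0 : 0 ≤ S) (w : ℤ × ℤ) :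
    |transOp p (fun z => f z * cutoff ρ x z) w - f w * cutoff ρ x w| ≤ 3 * S / ρ + tail p ρ := by
  rw [transOp_mul_cutoff_sub hρ hf hharm]
  rw [show 3 * S / ρ = S / ρ * 3 by ring]
  refine abs_tsum_step_mul_le_of_le (fun z => ?_) (hasSum_step_mul_one_add_sq hp (S / ρ))
  refine (abs_mul_cutoff_diff_le hρ hf hS hS0 (div_nonneg (euclid_nonneg z) hρ.le)
    (abs_cutoff_sub_le hρ x w z)).trans ?_
  have : euclid z ≤ 1 + euclid z ^ 2 := by nlinarith [sq_nonneg (euclid z - 1), euclid_nonneg z]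
  have h2 : S * (euclid z / ρ) ≤ S / ρ * (1 + euclid z ^ 2) := by
    rw [show S * (euclid z / ρ) = S / ρ * euclid z by ring]
    gcongr
  linarith

/-- Well inside, the cutoff stays equal to `1` unless the jump is at least `ρ / 4`. Bounding that
event by `(4 |z| / ρ)³` uses the third moment and improves the order from `ρ⁻¹` to `ρ⁻³`. -/
lemma abs_transOp_mul_cutoff_sub_le_of_near (hp : RegularWalk p) (hρ : 0 < ρ)
    (hf : ∀ z, f z ∈ Set.Icc (0 : ℝ) 1)
    (hharm : ∀ z, euclid (z - x) < 2 * ρ → transOp p f z = f z)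
    (hS : ∀ z, euclid (z - x) < 3 * ρ → f z ≤ S) (hS0 : 0 ≤ S) {w : ℤ × ℤ}
    (hw : euclid (w - x) ≤ 3 / 4 * ρ) :
    |transOp p (fun z => f z * cutoff ρ x z) w - f w * cutoff ρ x w|
      ≤ 64 * thirdMoment p * S / ρ ^ 3 + tail p ρ := by
  rw [transOp_mul_cutoff_sub hρ hf hharm]
  have hsum : HasSum (fun z => step p z * (64 * S / ρ ^ 3 * euclid z ^ 3))
      (64 * thirdMoment p * S / ρ ^ 3) := by
    have h := hp.third.hasSum.mul_left (64 * S / ρ ^ 3)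
    rw [← thirdMoment, show 64 * S / ρ ^ 3 * thirdMoment p = 64 * thirdMoment p * S / ρ ^ 3 by ring]
      at h
    exact h.congr_fun' fun z => by ring
  refine abs_tsum_step_mul_le_of_le (fun z => ?_) hsum
  have hz := euclid_nonneg z
  have hb : |cutoff ρ x (w + z) - cutoff ρ x w| ≤ (4 * euclid z / ρ) ^ 3 := by
    rcases lt_or_ge (euclid z) (ρ / 4) with h | h
    · have h1 : euclid (w + z - x) ≤ ρ := by
        have := euclid_add_le (w - x) z
        rw [show w - x + z = w + z - x by abel] at this
        linarith
      rw [cutoff_eq_one hρ h1, cutoff_eq_one hρ (by linarith), sub_self, abs_zero]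
      positivity
    · have h1 : 1 ≤ 4 * euclid z / ρ := by rw [one_le_div hρ]; linarith
      have h2 : |cutoff ρ x (w + z) - cutoff ρ x w| ≤ 1 := by
        have := cutoff_mem_Icc ρ x (w + z)
        have := cutoff_mem_Icc ρ x w
        rw [abs_le]
        constructor <;> linarith [(cutoff_mem_Icc ρ x (w + z)).1, (cutoff_mem_Icc ρ x (w + z)).2,
          (cutoff_mem_Icc ρ x w).1, (cutoff_mem_Icc ρ x w).2]
      exact h2.trans (one_le_pow₀ h1)
  refine (abs_mul_cutoff_diff_le hρ hf hS hS0 (by positivity) hb).trans (le_of_eq ?_)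
  congr 1
  rw [div_pow, mul_pow]
  ring

/-- Iterating an almost-invariance bound governed by a function with bounded drift. -/
lemma abs_iterate_transOp_sub_le {u G : ℤ × ℤ → ℝ} (hu : Bdd u) (hG : Bdd G) {α κ γ : ℝ}
    (hκ : 0 ≤ κ) (hγ : 0 ≤ γ) (h : ∀ w, |transOp p u w - u w| ≤ α + κ * G w)
    (hdrift : ∀ w, transOp p G w ≤ G w + γ) (k : ℕ) :
    Bdd ((transOp p)^[k] u) ∧
      ∀ w, |(transOp p)^[k] u w - u w| ≤ k * α + κ * (k * G w + γ * k ^ 2) := by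
  induction k with
  | zero => exact ⟨hu, fun w => by simp⟩
  | succ k ih =>
    obtain ⟨hb, ih⟩ := ih
    have hb' : Bdd ((transOp p)^[k + 1] u) := by
      rw [Function.iterate_succ']
      exact bdd_transOp hb
    refine ⟨hb', fun w => ?_⟩
    rw [Function.iterate_succ_apply']
    set v := (transOp p)^[k] u
    have hmaj : Bdd fun z => k * α + κ * (k * G z + γ * k ^ 2) :=
      (Bdd.const _).add ((Bdd.const _).mul (((Bdd.const _).mul hG).add (Bdd.const _)))
    have e1 : transOp p (fun z => k * α + κ * (k * G z + γ * k ^ 2)) w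
        = k * α + κ * (k * transOp p G w + γ * k ^ 2) := by
      rw [transOp_add (Bdd.const _) ((Bdd.const _).mul (((Bdd.const _).mul hG).add (Bdd.const _))),
        transOp_const, transOp_const_mul, transOp_add ((Bdd.const _).mul hG) (Bdd.const _),
        transOp_const, transOp_const_mul]
    have h1 : transOp p v w - transOp p u w ≤ k * α + κ * (k * transOp p G w + γ * k ^ 2) := by
      rw [← transOp_sub hb hu, ← e1]
      exact transOp_mono (hb.sub hu) hmaj (fun z => (abs_le.mp (ih z)).2) w
    have h2 : transOp p u w - transOp p v w ≤ k * α + κ * (k * transOp p G w + γ * k ^ 2) := by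
      rw [← transOp_sub hu hb, ← e1]
      exact transOp_mono (hu.sub hb) hmaj (fun z => by linarith [(abs_le.mp (ih z)).1]) w
    have h3 := abs_le.mp (h w)
    have h4 : κ * (k * transOp p G w) ≤ κ * (k * (G w + γ)) := by
      gcongr
      exact hdrift w
    have h5 : 0 ≤ κ * (γ * (k + 1)) := by positivity
    push_cast
    rw [abs_le]
    constructor <;> nlinarith [h3.1, h3.2]

/-- The large error of order `S / ρ` per step is incurred only at distance more than `3ρ/4` from
`x`. The function `1 - expBump ρ y` vanishes at `y`, is at least `1/3` in that region and grows in
mean by at most `17 / ρ²` per step. The expected cost over `t` steps is therefore of order `S t² /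
ρ³`; the constant is `153 = 9 · 17`. -/
lemma abs_iterate_mul_cutoff_sub_le (hp : RegularWalk p) (hρ : baseRadius p ≤ ρ)
    (hf : ∀ z, f z ∈ Set.Icc (0 : ℝ) 1)
    (hharm : ∀ z, euclid (z - x) < 2 * ρ → transOp p f z = f z)
    (hS : ∀ z, euclid (z - x) < 3 * ρ → f z ≤ S) (hS0 : 0 ≤ S) {y : ℤ × ℤ}
    (hy : euclid (y - x) ≤ ρ / 2) (t : ℕ) :
    |(transOp p)^[t] (fun z => f z * cutoff ρ x z) y - f y|
      ≤ t * tail p ρ + S * ((64 * thirdMoment p * t + 153 * t ^ 2) / ρ ^ 3) := by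
  have hρ1 : 1 ≤ ρ := (one_le_baseRadius p).trans hρ
  have hρ0 : 0 < ρ := by linarith
  have hM := thirdMoment_nonneg p
  have hfb : Bdd f := .of_mem_Icc hf
  have hcb : Bdd (cutoff ρ x) := .of_mem_Icc (cutoff_mem_Icc ρ x)
  set G : ℤ × ℤ → ℝ := fun w => 1 - expBump ρ y w with hG
  have hGb : Bdd G := (Bdd.const 1).sub (bdd_expBump ρ y)
  have hG0 : ∀ w, 0 ≤ G w := fun w => sub_nonneg.mpr (expBump_mem_Icc ρ y w).2
  have hkey : ∀ w, |transOp p (fun z => f z * cutoff ρ x z) w - f w * cutoff ρ x w|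
      ≤ (64 * thirdMoment p * S / ρ ^ 3 + tail p ρ) + 9 * S / ρ * G w := by
    intro w
    have ht := tail_nonneg p ρ
    have h0 : 0 ≤ 64 * thirdMoment p * S / ρ ^ 3 := by positivity
    rcases le_or_gt (euclid (w - x)) (3 / 4 * ρ) with h | h
    · have h1 := abs_transOp_mul_cutoff_sub_le_of_near hp hρ0 hf hharm hS hS0 h
      have h2 : 0 ≤ 9 * S / ρ * G w := mul_nonneg (by positivity) (hG0 w)
      linarith
    · have h1 := abs_transOp_mul_cutoff_sub_le hp hρ0 hf hharm hS hS0 w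
      have h2 : 1 / 3 ≤ G w := by
        have h3 : ρ / 4 ≤ euclid (w - y) := by
          have := euclid_sub_le w y x
          linarith
        have h4 : 1 / 16 ≤ euclid (w - y) ^ 2 / ρ ^ 2 := by
          rw [le_div_iff₀ (by positivity)]
          nlinarith
        have h5 : expBump ρ y w ≤ Real.exp (-(1 / 2)) := by
          rw [expBump, radial, Real.exp_le_exp]; linarith
        have h6 : Real.exp (-(1 / 2)) ≤ 2 / 3 := by
          rw [Real.exp_neg, inv_le_comm₀ (Real.exp_pos _) (by norm_num)]
          have := Real.add_one_le_exp (1 / 2 : ℝ)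
          norm_num at this ⊢
          linarith
        simp only [hG]
        linarith
      have h3 : 3 * S / ρ ≤ 9 * S / ρ * G w := by
        rw [show 3 * S / ρ = 9 * S / ρ * (1 / 3) by ring]
        gcongr
      linarith
  have hdrift : ∀ w, transOp p G w ≤ G w + 17 / ρ ^ 2 := by
    intro w
    rw [hG, transOp_sub (Bdd.const 1) (bdd_expBump ρ y), transOp_const]
    have := transOp_expBump_ge hp hρ y w
    rw [neg_div] at this
    linarith
  have hit := (abs_iterate_transOp_sub_le (p := p) (hfb.mul hcb) hGb (by positivity)
    (by positivity) hkey hdrift t).2 y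
  have hGy : G y = 0 := by simp [hG, expBump, radial]
  rw [hGy, cutoff_eq_one hρ0 (by linarith), mul_one] at hit
  refine hit.trans (le_of_eq ?_)
  field_simp
  ring

end Cutoff

/-- Regularity of harmonic functions at mesoscopic scales: on the scale `l ^ 22` a function that
is harmonic at scale `l ^ 32` is nearly constant. -/
theorem exists_abs_sub_le_of_harmonic (hp : RegularWalk p) :
    ∃ C : ℝ, 0 ≤ C ∧ ∀ l : ℝ, 1 ≤ l → baseRadius p ≤ l ^ 32 → ∀ (f : ℤ × ℤ → ℝ) (S : ℝ)
      (x h : ℤ × ℤ), 0 ≤ S → (∀ z, f z ∈ Set.Icc (0 : ℝ) 1) →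
      (∀ z, euclid (z - x) < 2 * l ^ 32 → transOp p f z = f z) →
      (∀ z, euclid (z - x) < 3 * l ^ 32 → f z ≤ S) → euclid h ≤ l ^ 22 → 2 * l ^ 22 ≤ l ^ 32 →
      |f (x + h) - f x| ≤ C * (S / l + (l ^ 32) ^ 2 * tail p (l ^ 32)) := by
  obtain ⟨m, C, hm, hC, H⟩ := exists_abs_iterate_transOp_sub_le hp
  set M := thirdMoment p with hMdef
  have hM : 0 ≤ M := thirdMoment_nonneg p
  refine ⟨C + 4 * m * (64 * M) + 4 * m ^ 2 * 306 + 4 * m, by positivity, ?_⟩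
  intro l hl hbase f S x h hS0 hf hharm hS hh hl22
  set ρ := l ^ 32 with hρ
  have hl0 : 0 < l := by linarith
  have hρ0 : 0 < ρ := by positivity
  -- The exponents balance three demands: displacements `l ^ 22` are smoothed to `l ^ 22 / √N ≤ 1 /
  -- l`; the cutoff costs `N² / ρ³ ≤ l ^ 92 / l ^ 96`; and long jumps cost `N tail ≤ ρ² tail`, up to
  -- constants.
  set N := ⌈l ^ 46⌉₊ with hN
  have hN1 : l ^ 46 ≤ N := Nat.le_ceil _
  have hN2 : (N : ℝ) ≤ 2 * l ^ 46 := by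
    have h1 := Nat.ceil_lt_add_one (show 0 ≤ l ^ 46 by positivity)
    have h2 : 1 ≤ l ^ 46 := one_le_pow₀ hl
    linarith
  have ht := tail_nonneg p ρ
  set u : ℤ × ℤ → ℝ := fun z => f z * cutoff ρ x z with hu
  have hub : ∀ z, |u z| ≤ S := by
    intro z
    have hc := cutoff_mem_Icc ρ x z
    simp only [hu]
    rw [abs_of_nonneg (mul_nonneg (hf z).1 hc.1)]
    rcases lt_or_ge (euclid (z - x)) (2 * ρ) with h1 | h1
    · exact (mul_le_of_le_one_right (hf z).1 hc.2).trans (hS z (by linarith))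
    · rw [cutoff_eq_zero hρ0 h1, mul_zero]; exact hS0
  have g1 := abs_iterate_mul_cutoff_sub_le hp hbase hf hharm hS hS0 (y := x)
    (by simp; positivity) (m * N)
  have g2 := abs_iterate_mul_cutoff_sub_le hp hbase hf hharm hS hS0 (y := x + h)
    (by rw [add_sub_cancel_left]; linarith) (m * N)
  have g3 := H N u S hub x h
  have hmN : ((m * N : ℕ) : ℝ) ≤ 2 * m * l ^ 46 := by
    push_cast
    calc (m : ℝ) * N ≤ m * (2 * l ^ 46) := by gcongr
      _ = _ := by ring
  have hsq : l ^ 23 ≤ Real.sqrt (N + 1 : ℕ) := by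
    apply Real.le_sqrt_of_sq_le
    rw [← pow_mul]
    push_cast
    linarith
  have b1 : C * euclid h * S / Real.sqrt (N + 1 : ℕ) ≤ C * (S / l) := by
    calc C * euclid h * S / Real.sqrt (N + 1 : ℕ) ≤ C * l ^ 22 * S / l ^ 23 := by gcongr
      _ = _ := by field_simp
  have b2 : ((m * N : ℕ) : ℝ) * tail p ρ ≤ 2 * m * (ρ ^ 2 * tail p ρ) := by
    have h1 : l ^ 46 ≤ ρ ^ 2 := by
      rw [hρ, ← pow_mul]; exact pow_le_pow_right₀ hl (by norm_num)
    calc ((m * N : ℕ) : ℝ) * tail p ρ ≤ (2 * m * l ^ 46) * tail p ρ := by gcongr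
      _ ≤ (2 * m * ρ ^ 2) * tail p ρ := by gcongr
      _ = _ := by ring
  have b3 : (64 * M * ((m * N : ℕ) : ℝ) + 153 * ((m * N : ℕ) : ℝ) ^ 2) / ρ ^ 3
      ≤ (2 * m * (64 * M) + 2 * m ^ 2 * 306) / l := by
    rw [div_le_div_iff₀ (by positivity) hl0]
    have h1 : l ^ 46 * l ≤ ρ ^ 3 := by
      rw [hρ, ← pow_mul, ← pow_succ]; exact pow_le_pow_right₀ hl (by norm_num)
    have h2 : (l ^ 46) ^ 2 * l ≤ ρ ^ 3 := by
      rw [hρ, ← pow_mul, ← pow_mul, ← pow_succ]; exact pow_le_pow_right₀ hl (by norm_num)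
    calc (64 * M * ((m * N : ℕ) : ℝ) + 153 * ((m * N : ℕ) : ℝ) ^ 2) * l
        ≤ (64 * M * (2 * m * l ^ 46) + 153 * (2 * m * l ^ 46) ^ 2) * l := by gcongr
      _ = (2 * m * (64 * M)) * (l ^ 46 * l) + (2 * m ^ 2 * 306) * ((l ^ 46) ^ 2 * l) := by ring
      _ ≤ (2 * m * (64 * M)) * ρ ^ 3 + (2 * m ^ 2 * 306) * ρ ^ 3 := by gcongr
      _ = _ := by ring
  have b3' := mul_le_mul_of_nonneg_left b3 hS0
  set T := (transOp p)^[m * N] u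
  set J := ρ ^ 2 * tail p ρ
  have hJ : 0 ≤ J := by positivity
  have hSl : 0 ≤ S / l := by positivity
  have e1 : f (x + h) - f x = -(T (x + h) - f (x + h)) + (T (x + h) - T x) + (T x - f x) := by ring
  have e2 : |f (x + h) - f x| ≤ |T (x + h) - f (x + h)| + |T (x + h) - T x| + |T x - f x| := by
    rw [e1]
    refine (abs_add_le _ _).trans (add_le_add ((abs_add_le _ _).trans ?_) le_rfl)
    rw [abs_neg]
  have e3 : S * ((2 * m * (64 * M) + 2 * m ^ 2 * 306) / l)
      = (2 * m * (64 * M) + 2 * m ^ 2 * 306) * (S / l) := by ring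
  rw [e3] at b3'
  have e4 : (C + 4 * m * (64 * M) + 4 * m ^ 2 * 306 + 4 * m) * (S / l + J)
      = (C * (S / l) + 2 * ((2 * m * (64 * M) + 2 * m ^ 2 * 306) * (S / l)) + 2 * (2 * m * J))
        + (4 * m * (S / l) + (C + 4 * m * (64 * M) + 4 * m ^ 2 * 306) * J) := by ring
  have e5 : 0 ≤ 4 * m * (S / l) + (C + 4 * m * (64 * M) + 4 * m ^ 2 * 306) * J := by positivity
  rw [e4]
  linarith

/-! ### Harnack inequalities -/

/-- The error caused by long jumps. -/
noncomputable def jumpError (p : PMF (ℤ × ℤ)) (ρ : ℝ) : ℝ := ρ ^ 2 * (1 + Real.log ρ) * tail p ρ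

lemma jumpError_nonneg {ρ : ℝ} (hρ : 1 ≤ ρ) : 0 ≤ jumpError p ρ := by
  have := Real.log_nonneg hρ
  have := tail_nonneg p ρ
  unfold jumpError
  positivity

/-- The total mass of the bump. -/
noncomputable def bumpMass (a ρ : ℝ) : ℝ := ∑ w ∈ discF 0 (2 * ρ), bump a 0 w

lemma sum_bump_eq_bumpMass (a ρ : ℝ) (x : ℤ × ℤ) :
    ∑ w ∈ discF x (2 * ρ), bump a x w = bumpMass a ρ := by
  refine Finset.sum_nbij' (fun w => w - x) (fun w => w + x) ?_ ?_ ?_ ?_ ?_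
  · intro w hw; simpa using hw
  · intro w hw; simpa using hw
  · intro w _; simp
  · intro w _; simp
  · intro w _; simp [bump]

/-- The approximate mean value property on the scale `ρ = l ^ 32`. -/
theorem exists_approx_mean_value (hp : RegularWalk p) :
    ∃ C : ℝ, 0 ≤ C ∧ ∀ l : ℝ, 2 ≤ l → baseRadius p ≤ l ^ 32 → ∀ (f : ℤ × ℤ → ℝ) (S : ℝ)
      (x : ℤ × ℤ), 0 ≤ S → (∀ z, f z ∈ Set.Icc (0 : ℝ) 1) →
      (∀ z, euclid (z - x) < 2 * l ^ 32 → transOp p f z = f z) →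
      (∀ z, euclid (z - x) < 3 * l ^ 32 → f z ≤ S) →
      |bumpMass (l ^ 22) (l ^ 32) * f x - ∑ w ∈ discF x (2 * l ^ 32), bump (l ^ 32) x w * f w|
        ≤ C * (S / l + jumpError p (l ^ 32)
          + (∑ w ∈ discF x (2 * l ^ 32), f w) / (l ^ 32) ^ 2 / l) := by
  obtain ⟨C, hC, H⟩ := exists_abs_sub_le_of_harmonic hp
  set M := thirdMoment p with hMdef
  have hM : 0 ≤ M := thirdMoment_nonneg p
  refine ⟨75 * C + 80 * M + 200, by positivity, ?_⟩
  intro l hl hbase f S x hS0 hf hharm hS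
  have hl0 : 0 < l := by linarith
  have hl1 : 1 ≤ l := by linarith
  set ρ := l ^ 32 with hρ
  set a := l ^ 22 with ha
  have hρ1 : 1 ≤ ρ := one_le_pow₀ hl1
  have ha1 : 1 ≤ a := one_le_pow₀ hl1
  have haρ2 : 2 * a ≤ ρ := by
    rw [hρ, ha, show (32 : ℕ) = 22 + 10 by norm_num, pow_add, mul_comm]
    gcongr
    exact hl.trans (le_self_pow₀ hl1 (by norm_num))
  have haρ : a ≤ ρ := by linarith
  set E := discF x (2 * ρ) with hE
  have hlog := Real.log_nonneg hρ1
  have hloga := Real.log_nonneg ha1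
  have ht := tail_nonneg p ρ
  have hJ0 := jumpError_nonneg (p := p) hρ1
  have htail : ρ ^ 2 * tail p ρ ≤ jumpError p ρ := by
    rw [jumpError]
    have : ρ ^ 2 * tail p ρ * 1 ≤ ρ ^ 2 * tail p ρ * (1 + Real.log ρ) := by gcongr; linarith
    linarith
  -- On the scale `a` the function is nearly constant, so its bump average is nearly `f x` times the
  -- mass. The passage from `a` to `ρ` below costs `a⁻³ ∑ f`, affordable since `ρ² l = l ^ 65 ≤ l ^
  -- 66 = a³`.
  have h1 : |bumpMass a ρ * f x - ∑ w ∈ E, bump a x w * f w|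
      ≤ 75 * (C * (S / l + jumpError p ρ)) := by
    rw [← sum_bump_eq_bumpMass a ρ x, Finset.sum_mul, ← Finset.sum_sub_distrib]
    refine (Finset.abs_sum_le_sum_abs _ _).trans ?_
    have hterm : ∀ w ∈ E, |bump a x w * f x - bump a x w * f w|
        ≤ bump a x w * (C * (S / l + jumpError p ρ)) := by
      intro w _
      rw [← mul_sub, abs_mul, abs_of_nonneg (bump_nonneg a x w)]
      rcases le_or_gt a (euclid (w - x)) with h | h
      · rw [bump_eq_zero (by linarith) h]; simp
      · apply mul_le_mul_of_nonneg_left _ (bump_nonneg a x w)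
        have := H l hl1 hbase f S x (w - x) hS0 hf hharm hS h.le haρ2
        rw [add_sub_cancel, abs_sub_comm] at this
        refine this.trans ?_
        gcongr
    refine (Finset.sum_le_sum hterm).trans ?_
    rw [← Finset.sum_mul]
    have : 0 ≤ C * (S / l + jumpError p ρ) := by positivity
    exact mul_le_mul_of_nonneg_right (sum_bump_le ha1 x E) this
  have h2 := abs_sum_bump_sub_le hp ha1 haρ x hf
    (fun z hz => hharm z (by linarith))
  rw [← hE, ← hMdef] at h2
  have hF : 0 ≤ ∑ w ∈ E, f w := Finset.sum_nonneg fun w _ => (hf w).1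
  have h3 : 80 * M / a ^ 3 * ∑ w ∈ E, f w ≤ 80 * M * ((∑ w ∈ E, f w) / ρ ^ 2 / l) := by
    have : ρ ^ 2 * l ≤ a ^ 3 := by
      rw [hρ, ha, ← pow_mul, ← pow_mul, ← pow_succ]
      exact pow_le_pow_right₀ hl1 (by norm_num)
    rw [div_div, div_mul_eq_mul_div, mul_div_assoc]
    gcongr
  have h4 : 100 * ρ ^ 2 * (2 + 2 * (Real.log ρ - Real.log a)) * tail p ρ ≤ 200 * jumpError p ρ := by
    rw [jumpError, show 200 * (ρ ^ 2 * (1 + Real.log ρ) * tail p ρ)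
      = 100 * ρ ^ 2 * (2 + 2 * Real.log ρ) * tail p ρ by ring]
    gcongr
    linarith
  set A := (∑ w ∈ E, f w) / ρ ^ 2 / l
  have hA : 0 ≤ A := by positivity
  have hSl : 0 ≤ S / l := by positivity
  have h5 := abs_sub_le (bumpMass a ρ * f x) (∑ w ∈ E, bump a x w * f w)
    (∑ w ∈ E, bump ρ x w * f w)
  have e : (75 * C + 80 * M + 200) * (S / l + jumpError p ρ + A)
      = (75 * (C * (S / l + jumpError p ρ)) + 80 * M * A + 200 * jumpError p ρ)
        + (75 * C * A + 80 * M * (S / l + jumpError p ρ) + 200 * (S / l + A)) := by ring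
  have e0 : 0 ≤ 75 * C * A + 80 * M * (S / l + jumpError p ρ) + 200 * (S / l + A) := by positivity
  rw [e]
  linarith

lemma le_bumpMass {a ρ : ℝ} (ha : 0 < a) (h : a ≤ 2 * ρ) : 1 / 10 ≤ bumpMass a ρ :=
  le_sum_bump ha 0 fun w hw => by rw [mem_discF] at hw ⊢; linarith

lemma bumpMass_le {a ρ : ℝ} (ha : 1 ≤ a) : bumpMass a ρ ≤ 75 := sum_bump_le ha 0 _

/-- The average of `f` over the disc of radius `256 ρ`, up to a constant factor. -/
noncomputable def discAvg (f : ℤ × ℤ → ℝ) (ρ : ℝ) : ℝ := (∑ w ∈ discF 0 (256 * ρ), f w) / ρ ^ 2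

lemma sum_discF_le_of_subset {f : ℤ × ℤ → ℝ} (hf : ∀ z, 0 ≤ f z) {x : ℤ × ℤ} {s t : ℝ}
    (h : euclid x + s ≤ t) : ∑ w ∈ discF x s, f w ≤ ∑ w ∈ discF 0 t, f w := by
  refine Finset.sum_le_sum_of_subset_of_nonneg (fun w hw => ?_) fun w _ _ => hf w
  rw [mem_discF] at hw ⊢
  have := euclid_le_add_sub w x
  rw [sub_zero]
  linarith

/-- A harmonic function is bounded by its average, up to the error from long jumps. -/
theorem exists_le_discAvg (hp : RegularWalk p) :
    ∃ C : ℝ, 0 ≤ C ∧ ∀ l : ℝ, 2 ≤ l → baseRadius p ≤ l ^ 32 → ∀ f : ℤ × ℤ → ℝ,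
      (∀ z, f z ∈ Set.Icc (0 : ℝ) 1) →
      (∀ z, euclid z < 256 * l ^ 32 → transOp p f z = f z) →
      ∀ x, euclid x < 64 * l ^ 32 → f x ≤ C * (discAvg f (l ^ 32) + jumpError p (l ^ 32)) := by
  obtain ⟨C, hC, H⟩ := exists_approx_mean_value hp
  -- Bootstrap: the mean value property turns a bound `S` on a disc into `S / l` plus admissible
  -- terms on a disc smaller by `3 ρ`. The start is the trivial bound of `f` by its own sum, `ρ²`
  -- times the average. Since `ρ² = l ^ 64`, exactly `64` rounds remove the excess, and the radius
  -- `256 ρ` shrinks to `64 ρ`.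
  have main : ∀ k : ℕ, k ≤ 64 → ∃ D : ℝ, 0 ≤ D ∧ ∀ l : ℝ, 2 ≤ l → baseRadius p ≤ l ^ 32 →
      ∀ f : ℤ × ℤ → ℝ, (∀ z, f z ∈ Set.Icc (0 : ℝ) 1) →
      (∀ z, euclid z < 256 * l ^ 32 → transOp p f z = f z) →
      ∀ x, euclid x < (256 - 3 * k) * l ^ 32 →
        f x ≤ D * (discAvg f (l ^ 32) + jumpError p (l ^ 32)
          + (l ^ 32) ^ 2 * discAvg f (l ^ 32) / l ^ k) := by
    intro k
    induction k with
    | zero =>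
      refine fun _ => ⟨1, zero_le_one, fun l hl _ f hf _ x hx => ?_⟩
      have hl0 : 0 < l := by linarith
      have hl1 : 1 ≤ l := by linarith
      have h1 : f x ≤ ∑ w ∈ discF 0 (256 * l ^ 32), f w := by
        refine Finset.single_le_sum (f := f) (fun w _ => (hf w).1) ?_
        simpa using hx
      have hJ := jumpError_nonneg (p := p) (one_le_pow₀ hl1 (n := 32))
      have hA : 0 ≤ discAvg f (l ^ 32) :=
        div_nonneg (Finset.sum_nonneg fun w _ => (hf w).1) (by positivity)
      have h2 : (l ^ 32) ^ 2 * discAvg f (l ^ 32) = ∑ w ∈ discF 0 (256 * l ^ 32), f w := by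
        rw [discAvg]; field_simp
      rw [h2, one_mul, pow_zero, div_one]
      linarith
    | succ k ih =>
      intro hk
      obtain ⟨D, hD, hrec⟩ := ih (by omega)
      refine ⟨10 * (3 + 2 * C + C * D), by positivity, fun l hl hbase f hf hharm x hx => ?_⟩
      have hl0 : 0 < l := by linarith
      have hl1 : 1 ≤ l := by linarith
      set ρ := l ^ 32 with hρ
      have hρ1 : 1 ≤ ρ := one_le_pow₀ hl1
      have hρ0 : 0 < ρ := by linarith
      set A := discAvg f ρ with hAdef
      set J := jumpError p ρ with hJdef
      have hJ : 0 ≤ J := jumpError_nonneg hρ1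
      have hA : 0 ≤ A := div_nonneg (Finset.sum_nonneg fun w _ => (hf w).1) (by positivity)
      push_cast at hx
      have hk' : (k : ℝ) + 1 ≤ 64 := by exact_mod_cast hk
      set S := D * (A + J + ρ ^ 2 * A / l ^ k) with hSdef
      have hQ : 0 ≤ ρ ^ 2 * A / l ^ k := by positivity
      have hS0 : 0 ≤ S := by positivity
      have hS : ∀ z, euclid (z - x) < 3 * ρ → f z ≤ S := by
        intro z hz
        refine hrec l hl hbase f hf hharm z ?_
        have := euclid_le_add_sub z x
        rw [← hρ]
        linarith
      have hin : ∀ z, euclid (z - x) < 2 * ρ → transOp p f z = f z := by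
        intro z hz
        refine hharm z ?_
        have := euclid_le_add_sub z x
        have : 0 ≤ (k : ℝ) * ρ := by positivity
        linarith
      have hmv := (abs_le.mp (H l hl hbase f S x hS0 hf hin hS)).2
      rw [← hρ, ← hJdef] at hmv
      have hF : (∑ w ∈ discF x (2 * ρ), f w) / ρ ^ 2 ≤ A := by
        rw [hAdef, discAvg]
        refine div_le_div_of_nonneg_right (sum_discF_le_of_subset (fun z => (hf z).1) ?_)
          (sq_nonneg ρ)
        have : 0 ≤ (k : ℝ) * ρ := by positivity
        linarith
      have hB : ∑ w ∈ discF x (2 * ρ), bump ρ x w * f w ≤ 3 * A := by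
        calc ∑ w ∈ discF x (2 * ρ), bump ρ x w * f w
            ≤ ∑ w ∈ discF x (2 * ρ), 3 / ρ ^ 2 * f w :=
              Finset.sum_le_sum fun w _ => mul_le_mul_of_nonneg_right (bump_le ρ x w) (hf w).1
          _ = 3 * ((∑ w ∈ discF x (2 * ρ), f w) / ρ ^ 2) := by rw [← Finset.mul_sum]; ring
          _ ≤ 3 * A := by linarith
      have hmass : 1 / 10 * f x ≤ bumpMass (l ^ 22) ρ * f x := by
        refine mul_le_mul_of_nonneg_right (le_bumpMass (by positivity) ?_) (hf x).1
        have : l ^ 22 ≤ ρ := pow_le_pow_right₀ hl1 (by norm_num)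
        linarith
      have hFl : (∑ w ∈ discF x (2 * ρ), f w) / ρ ^ 2 / l ≤ A := by
        refine le_trans (div_le_self ?_ hl1) hF
        exact div_nonneg (Finset.sum_nonneg fun w _ => (hf w).1) (by positivity)
      have hSl : S / l ≤ D * (A + J) + D * (ρ ^ 2 * A / l ^ (k + 1)) := by
        have e : S / l = D * (A + J) / l + D * (ρ ^ 2 * A / l ^ (k + 1)) := by
          rw [hSdef, pow_succ]; field_simp; ring
        rw [e]
        gcongr
        exact div_le_self (by positivity) hl1
      set Q := ρ ^ 2 * A / l ^ (k + 1) with hQdef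
      have hQ0 : 0 ≤ Q := by positivity
      have h6 : C * (S / l + J + (∑ w ∈ discF x (2 * ρ), f w) / ρ ^ 2 / l)
          ≤ C * ((D * (A + J) + D * Q) + J + A) := by gcongr
      have e : 10 * (3 + 2 * C + C * D) * (A + J + Q)
          = 10 * (3 * A + C * ((D * (A + J) + D * Q) + J + A))
            + (30 * (J + Q) + 10 * C * (A + J + 2 * Q)) := by ring
      have e0 : 0 ≤ 30 * (J + Q) + 10 * C * (A + J + 2 * Q) := by positivity
      rw [e]
      linarith
  obtain ⟨D, hD, hmain⟩ := main 64 le_rfl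
  refine ⟨2 * D, by positivity, fun l hl hbase f hf hharm x hx => ?_⟩
  have hl0 : 0 < l := by linarith
  have hl1 : 1 ≤ l := by linarith
  have h := hmain l hl hbase f hf hharm x (by push_cast; linarith)
  have hJ := jumpError_nonneg (p := p) (one_le_pow₀ hl1 (n := 32))
  have e : (l ^ 32) ^ 2 * discAvg f (l ^ 32) / l ^ 64 = discAvg f (l ^ 32) := by
    rw [← pow_mul]; field_simp
  rw [e] at h
  nlinarith

/-- The doubling property iterated. -/
lemma discAvg_le (hp : RegularWalk p) {ρ : ℝ} (hρ : 2 * baseRadius p ≤ ρ) {f : ℤ × ℤ → ℝ}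
    (hf : ∀ z, f z ∈ Set.Icc (0 : ℝ) 1)
    (hharm : ∀ z, euclid z < 256 * ρ → transOp p f z = f z) :
    discAvg f ρ ≤ (1 + 17 * Real.exp 8) ^ 10 * ((∑ w ∈ discF 0 (ρ / 4), f w) / ρ ^ 2) := by
  have hb := one_le_baseRadius p
  have hfb : Bdd f := .of_mem_Icc hf
  set K := 1 + 17 * Real.exp 8 with hK
  have hK0 : 0 ≤ K := by positivity
  -- Ten halvings lead from radius `256 ρ` to `ρ / 4`.
  have main : ∀ k : ℕ, k ≤ 10 → ∑ w ∈ discF 0 (256 * ρ), f w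
      ≤ K ^ k * ∑ w ∈ discF 0 (256 * ρ / 2 ^ k), f w := by
    intro k
    induction k with
    | zero => intro _; simp
    | succ k ih =>
      intro hk
      refine (ih (by omega)).trans ?_
      have h2k : (2 : ℝ) ^ k ≤ 2 ^ 9 := pow_le_pow_right₀ (by norm_num) (by omega)
      have hr : baseRadius p ≤ 256 * ρ / 2 ^ k := by
        rw [le_div_iff₀ (by positivity)]
        nlinarith
      have := sum_discF_le_half hp hr (fun z => (hf z).1) hfb (fun z hz => hharm z
        (hz.trans_le (div_le_self (by linarith) (one_le_pow₀ (by norm_num)))))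
      rw [div_div, ← pow_succ] at this
      calc _ ≤ K ^ k * (K * ∑ w ∈ discF 0 (256 * ρ / 2 ^ (k + 1)), f w) := by gcongr
        _ = _ := by ring
  have h := main 10 le_rfl
  rw [show 256 * ρ / 2 ^ 10 = ρ / 4 by norm_num; ring] at h
  rw [discAvg, ← mul_div_assoc]
  gcongr

lemma discAvg_nonneg {f : ℤ × ℤ → ℝ} (hf : ∀ z, f z ∈ Set.Icc (0 : ℝ) 1) (ρ : ℝ) :
    0 ≤ discAvg f ρ :=
  div_nonneg (Finset.sum_nonneg fun w _ => (hf w).1) (sq_nonneg ρ)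

lemma sum_discF_div_le_discAvg {ρ : ℝ} {f : ℤ × ℤ → ℝ} (hf : ∀ z, f z ∈ Set.Icc (0 : ℝ) 1)
    (hρ0 : 0 < ρ) {y : ℤ × ℤ} (hy : euclid y ≤ ρ / 4) :
    (∑ w ∈ discF y (2 * ρ), f w) / ρ ^ 2 ≤ discAvg f ρ :=
  div_le_div_of_nonneg_right (sum_discF_le_of_subset (fun z => (hf z).1) (by linarith))
    (sq_nonneg ρ)

/-- The disc `D(0, ρ/4)` lies within `ρ / 2` of `x`, where the bump is at least `1 / ρ²`. Doubling
recovers the large disc from this small one. -/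
lemma discAvg_le_sum_bump (hp : RegularWalk p) {ρ : ℝ} (hρ : 2 * baseRadius p ≤ ρ)
    {f : ℤ × ℤ → ℝ} (hf : ∀ z, f z ∈ Set.Icc (0 : ℝ) 1)
    (hharm : ∀ z, euclid z < 256 * ρ → transOp p f z = f z) {x : ℤ × ℤ} (hx : euclid x ≤ ρ / 4) :
    discAvg f ρ ≤ (1 + 17 * Real.exp 8) ^ 10 * ∑ w ∈ discF 0 (256 * ρ), bump ρ x w * f w := by
  have hρ0 : 0 < ρ := by linarith [one_le_baseRadius p]
  refine (discAvg_le hp hρ hf hharm).trans (mul_le_mul_of_nonneg_left ?_ (by positivity))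
  rw [Finset.sum_div]
  calc ∑ w ∈ discF 0 (ρ / 4), f w / ρ ^ 2 ≤ ∑ w ∈ discF 0 (ρ / 4), bump ρ x w * f w := by
        refine Finset.sum_le_sum fun w hw => ?_
        rw [mem_discF, sub_zero] at hw
        have h2 : euclid (w - x) ≤ ρ / 2 := by
          have := euclid_add_le w (-x)
          rw [euclid_neg, ← sub_eq_add_neg] at this
          linarith
        have h3 : 1 / ρ ^ 2 ≤ bump ρ x w := by
          refine le_trans ?_ (le_bump hρ0 h2)
          rw [div_le_div_iff₀ (by positivity) (by positivity)]
          nlinarith [sq_nonneg ρ]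
        calc f w / ρ ^ 2 = 1 / ρ ^ 2 * f w := by ring
          _ ≤ _ := mul_le_mul_of_nonneg_right h3 (hf w).1
    _ ≤ _ := by
        refine Finset.sum_le_sum_of_subset_of_nonneg (fun w hw => ?_)
          fun w _ _ => mul_nonneg (bump_nonneg _ _ _) (hf w).1
        rw [mem_discF] at hw ⊢
        linarith

lemma abs_sum_bump_mul_sub_le {ρ : ℝ} (hρ0 : 0 < ρ) {f : ℤ × ℤ → ℝ}
    (hf : ∀ z, f z ∈ Set.Icc (0 : ℝ) 1) (x x' : ℤ × ℤ) :
    |∑ w ∈ discF 0 (256 * ρ), bump ρ x w * f w - ∑ w ∈ discF 0 (256 * ρ), bump ρ x' w * f w|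
      ≤ 12 * (euclid (x - x') / ρ) * discAvg f ρ := by
  rw [← Finset.sum_sub_distrib]
  refine (Finset.abs_sum_le_sum_abs _ _).trans ?_
  calc _ ≤ ∑ w ∈ discF 0 (256 * ρ), 12 / ρ ^ 3 * euclid (x - x') * f w := by
        refine Finset.sum_le_sum fun w _ => ?_
        rw [← sub_mul, abs_mul, abs_of_nonneg (hf w).1]
        exact mul_le_mul_of_nonneg_right (abs_bump_sub_le hρ0 x x' w) (hf w).1
    _ = _ := by
        rw [← Finset.mul_sum, discAvg]
        field_simp

lemma eq_zero_of_discAvg_eq_zero {ρ : ℝ} (hρ0 : 0 < ρ) {f : ℤ × ℤ → ℝ}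
    (hf : ∀ z, f z ∈ Set.Icc (0 : ℝ) 1) (h : discAvg f ρ = 0) {y : ℤ × ℤ}
    (hy : euclid y ≤ ρ / 4) : f y = 0 := by
  have h1 : f y ≤ ∑ w ∈ discF 0 (256 * ρ), f w :=
    Finset.single_le_sum (f := f) (fun w _ => (hf w).1) (by
      rw [mem_discF, sub_zero]; linarith)
  rw [discAvg, div_eq_zero_iff] at h
  have h2 : ρ ^ 2 ≠ 0 := by positivity
  rw [h.resolve_right h2] at h1
  exact le_antisymm h1 (hf y).1

/-- Two values of an approximate average that is bounded below are close relative to each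
other. -/
lemma abs_sub_le_of_approx {K B A m ε d t η a a' b b' : ℝ} (hK : 1 ≤ K) (hB : 0 ≤ B) (hA : 0 < A)
    (hm1 : 1 / 10 ≤ m) (hm2 : m ≤ 75) (hd : 0 ≤ d) (ht : 0 ≤ t) (hη : 0 ≤ η) (ha' : 0 ≤ a')
    (h : |m * a - b| ≤ ε) (h' : |m * a' - b'| ≤ ε) (hlower : A ≤ K * b')
    (hdiff : |b - b'| ≤ 12 * d * A) (hε : ε ≤ B * (t + η) * A) (htK : B * t * (4 * K) ≤ 1)
    (hηK : B * η * (4 * K) ≤ 1) :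
    |a - a'| ≤ 150 * K * (120 + 20 * B) * (d + t + η) * a' := by
  -- The approximation error takes at most half of the lower bound for `b'`. Hence `a'` is itself at
  -- least a multiple of `A`, and errors relative to `A` become errors relative to `a'`.
  have hεK : K * ε ≤ A / 2 := by
    have h1 : K * (B * (t + η)) ≤ 1 / 2 := by linarith
    calc K * ε ≤ K * (B * (t + η) * A) := by gcongr
      _ = K * (B * (t + η)) * A := by ring
      _ ≤ 1 / 2 * A := by gcongr
      _ = A / 2 := by ring
  have hfx' : A ≤ 150 * K * a' := by
    have h1 : b' - ε ≤ 75 * a' := by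
      have := mul_le_mul_of_nonneg_right hm2 ha'
      linarith [(abs_le.mp h').1]
    have h2 : K * (b' - ε) ≤ K * (75 * a') := mul_le_mul_of_nonneg_left h1 (by linarith)
    linarith
  have hfinal : m * |a - a'| ≤ 12 * d * A + 2 * ε := by
    have h1 := abs_le.mp h
    have h2 := abs_le.mp h'
    have h3 := abs_le.mp hdiff
    rw [show m * |a - a'| = |m * (a - a')| by rw [abs_mul, abs_of_nonneg (by linarith : 0 ≤ m)],
      mul_sub, abs_le]
    constructor <;> linarith [h1.1, h1.2, h2.1, h2.2, h3.1, h3.2]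
  have h7 : 1 / 10 * |a - a'| ≤ m * |a - a'| :=
    mul_le_mul_of_nonneg_right hm1 (abs_nonneg _)
  calc |a - a'| ≤ 10 * (12 * d * A + 2 * ε) := by linarith
    _ ≤ 10 * (12 * d * A + 2 * (B * (t + η) * A)) := by gcongr
    _ = (120 * d + 20 * B * (t + η)) * A := by ring
    _ ≤ ((120 + 20 * B) * (d + t + η)) * A := by
        gcongr
        have : 0 ≤ 20 * B * d + 120 * (t + η) := by positivity
        linarith
    _ ≤ ((120 + 20 * B) * (d + t + η)) * (150 * K * a') := by gcongr
    _ = _ := by ring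

/-- The bound `S` in the mean value property is now supplied by `exists_le_discAvg`, so the error is
expressed by the average and the long-jump term alone. The sum is enlarged to a disc not depending
on `y`, which makes different centres comparable. -/
lemma exists_abs_bumpMass_mul_sub_le (hp : RegularWalk p) :
    ∃ B : ℝ, 0 ≤ B ∧ ∀ l : ℝ, 2 ≤ l → baseRadius p ≤ l ^ 32 → ∀ f : ℤ × ℤ → ℝ,
      (∀ z, f z ∈ Set.Icc (0 : ℝ) 1) →
      (∀ z, euclid z < 256 * l ^ 32 → transOp p f z = f z) →
      ∀ y, euclid y ≤ l ^ 32 / 4 →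
        |bumpMass (l ^ 22) (l ^ 32) * f y
          - ∑ w ∈ discF 0 (256 * l ^ 32), bump (l ^ 32) y w * f w|
          ≤ B * (discAvg f (l ^ 32) / l + jumpError p (l ^ 32)) := by
  obtain ⟨C₁, hC₁, H₁⟩ := exists_approx_mean_value hp
  obtain ⟨C₂, hC₂, H₂⟩ := exists_le_discAvg hp
  refine ⟨C₁ * (2 * C₂ + 2), by positivity, fun l hl hbase f hf hharm y hy => ?_⟩
  have hl1 : 1 ≤ l := by linarith
  have h1 := H₁ l hl hbase f
  have h2 := H₂ l hl hbase f hf hharm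
  generalize l ^ 32 = ρ at *
  have hρ1 : 1 ≤ ρ := (one_le_baseRadius p).trans hbase
  have hρ0 : 0 < ρ := by linarith
  have hJ : 0 ≤ jumpError p ρ := jumpError_nonneg hρ1
  have hA : 0 ≤ discAvg f ρ := discAvg_nonneg hf ρ
  have hF := sum_discF_div_le_discAvg hf hρ0 hy
  replace h1 := h1 (C₂ * (discAvg f ρ + jumpError p ρ)) y (by positivity) hf
      (fun z hz => hharm z (by
        have := euclid_le_add_sub z y
        linarith))
      (fun z hz => h2 z (by
        have := euclid_le_add_sub z y
        linarith))
  have e1 : ∑ w ∈ discF y (2 * ρ), bump ρ y w * f w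
      = ∑ w ∈ discF 0 (256 * ρ), bump ρ y w * f w := by
    refine Finset.sum_subset (fun w hw => ?_) fun w _ hw => ?_
    · rw [mem_discF] at hw ⊢
      have := euclid_le_add_sub w y
      rw [sub_zero]
      linarith
    · rw [mem_discF, not_lt] at hw
      rw [bump_eq_zero hρ0 (by linarith), zero_mul]
  rw [e1] at h1
  refine h1.trans ?_
  generalize discAvg f ρ = A at *
  generalize jumpError p ρ = J at *
  generalize (∑ w ∈ discF y (2 * ρ), f w) / ρ ^ 2 = F at *
  have h2 : F / l ≤ A / l := by gcongr
  have h3 : C₂ * (A + J) / l ≤ C₂ * (A / l) + C₂ * J := by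
    rw [mul_add, add_div, mul_div_assoc]
    gcongr
    exact div_le_self (by positivity) hl1
  have hAl : 0 ≤ A / l := by positivity
  calc C₁ * (C₂ * (A + J) / l + J + F / l)
      ≤ C₁ * ((C₂ * (A / l) + C₂ * J) + J + A / l) := by gcongr
    _ ≤ C₁ * ((2 * C₂ + 2) * (A / l + J)) := by
        gcongr
        nlinarith [mul_nonneg hC₂ hAl, mul_nonneg hC₂ hJ]
    _ = _ := by ring

/-- The Harnack inequality with a Lipschitz rate at mesoscopic scales. -/
theorem exists_harnack (hp : RegularWalk p) :
    ∃ (C l₀ : ℝ), 1 ≤ C ∧ 2 ≤ l₀ ∧ ∀ l : ℝ, l₀ ≤ l → ∀ (f : ℤ × ℤ → ℝ) (η : ℝ),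
      (∀ z, f z ∈ Set.Icc (0 : ℝ) 1) →
      (∀ z, euclid z < 256 * l ^ 32 → transOp p f z = f z) →
      C * η ≤ 1 → jumpError p (l ^ 32) ≤ η * discAvg f (l ^ 32) →
      ∀ x x', euclid x ≤ l ^ 32 / 4 → euclid x' ≤ l ^ 32 / 4 →
        |f x - f x'| ≤ C * (euclid (x - x') / l ^ 32 + 1 / l + η) * f x' := by
  obtain ⟨B, hB, H⟩ := exists_abs_bumpMass_mul_sub_le hp
  obtain ⟨K, hK⟩ : ∃ K, K = (1 + 17 * Real.exp 8) ^ 10 := ⟨_, rfl⟩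
  have hK1 : 1 ≤ K := hK ▸ one_le_pow₀ (by have := Real.exp_pos 8; linarith)
  have hb := one_le_baseRadius p
  refine ⟨150 * K * (120 + 20 * B), max (2 * baseRadius p + 2) (4 * K * B), by nlinarith,
    le_max_of_le_left (by linarith), ?_⟩
  intro l hl f η hf hharm hη hJη x x' hx hx'
  have hl2 : 2 * baseRadius p + 2 ≤ l := (le_max_left _ _).trans hl
  have hlB : 4 * K * B ≤ l := (le_max_right _ _).trans hl
  have hl0 : 0 < l := by linarith
  have hl1 : 1 ≤ l := by linarith
  have hlρ : l ≤ l ^ 32 := le_self_pow₀ hl1 (by norm_num)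
  have ha1 : 1 ≤ l ^ 22 := one_le_pow₀ hl1
  have haρ : l ^ 22 ≤ l ^ 32 := pow_le_pow_right₀ hl1 (by norm_num)
  have hm1 : 1 / 10 ≤ bumpMass (l ^ 22) (l ^ 32) := le_bumpMass (by positivity) (by linarith)
  have hm2 : bumpMass (l ^ 22) (l ^ 32) ≤ 75 := bumpMass_le ha1
  have happrox := H l (by linarith) (by linarith) f hf hharm
  generalize l ^ 32 = ρ at *
  have hρ0 : 0 < ρ := by linarith
  -- If the average vanishes then `f` does too. Otherwise the hypothesis on `η` forces `η ≥ 0`,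
  -- which is not assumed.
  rcases (discAvg_nonneg hf ρ).eq_or_lt with hA0 | hA
  · rw [eq_zero_of_discAvg_eq_zero hρ0 hf hA0.symm hx, eq_zero_of_discAvg_eq_zero hρ0 hf hA0.symm
      hx']
    simp
  have hJ : 0 ≤ jumpError p ρ := jumpError_nonneg (by linarith)
  have hη0 : 0 ≤ η := by
    by_contra! h
    have := mul_neg_of_neg_of_pos h hA
    linarith
  have hBη : B * η * (4 * K) ≤ 1 := by
    refine le_trans ?_ hη
    have e : 150 * K * (120 + 20 * B) * η - B * η * (4 * K)
        = K * η * (18000 + 2996 * B) := by ring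
    have : 0 ≤ K * η * (18000 + 2996 * B) := by positivity
    linarith
  refine abs_sub_le_of_approx hK1 hB hA hm1 hm2 (div_nonneg (euclid_nonneg _) hρ0.le)
    (by positivity) hη0 (hf x').1 (happrox x hx) (happrox x' hx')
    (hK ▸ discAvg_le_sum_bump hp (by linarith) hf hharm hx')
    (abs_sum_bump_mul_sub_le hρ0 hf x x') ?_ ?_ hBη
  · rw [mul_assoc, add_mul, one_div_mul_eq_div]
    gcongr
  · rw [mul_one_div, div_mul_eq_mul_div, div_le_one hl0]; linarith

end PlanarWalk

namespace PlanarWalk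

variable {p : PMF (ℤ × ℤ)}

open Filter

/-! ### The exit distribution from a disc -/

lemma exists_step_pos (hcov : HasIdentityCovariance p) : ∃ s : ℤ × ℤ, s ≠ 0 ∧ 0 < step p s := by
  by_contra! h
  have h0 : (fun x : ℤ × ℤ => (x.1 : ℝ) ^ 2 * step p x) = fun _ => 0 := by
    funext x
    rcases eq_or_ne x 0 with rfl | hx
    · simp
    · rw [le_antisymm (h x hx) (step_nonneg p x), mul_zero]
  have h1 := hcov.1
  rw [h0] at h1
  exact zero_ne_one (hasSum_zero.unique h1)

lemma HasMoment.tail_mul_rpow_le {q : ℝ} (hq : 0 ≤ q) (h : HasMoment p q) {s : ℝ} (hs : 0 ≤ s) :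
    tail p s * s ^ q ≤ ∑' x : ℤ × ℤ, euclid x ^ q * step p x := by
  rw [tail, ← tsum_mul_right]
  refine Summable.tsum_le_tsum (fun z => ?_)
    ((summable_step_mul (abs_indicator_one_le {z | s ≤ euclid z})).mul_right _) h
  by_cases hz : s ≤ euclid z
  · rw [Set.indicator_of_mem (show z ∈ {z | s ≤ euclid z} from hz), Pi.one_apply, mul_one, mul_comm]
    exact mul_le_mul_of_nonneg_right (Real.rpow_le_rpow hs hz hq) (step_nonneg p z)
  · rw [Set.indicator_of_notMem (show z ∉ {z | s ≤ euclid z} from hz), mul_zero, zero_mul]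
    exact mul_nonneg (Real.rpow_nonneg (euclid_nonneg z) _) (step_nonneg p z)

/-- Markov's inequality for the moment of order `3 + 2β` pays for the three factors `ρ` and leaves
`ρ ^ (-2β)`. It is written as an exponential of `Real.log ρ` for comparison with Condition A. -/
lemma HasMoment.mul_jumpError_le {β : ℝ} (hβ : 0 < β) (h : HasMoment p (3 + 2 * β)) {ρ : ℝ}
    (hρ : 1 ≤ ρ) :
    ρ * jumpError p ρ ≤ (∑' x : ℤ × ℤ, euclid x ^ (3 + 2 * β) * step p x) * (1 + Real.log ρ)
      * Real.exp (-(2 * β * Real.log ρ)) := by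
  have hρ0 : 0 < ρ := by linarith
  have h1 := h.tail_mul_rpow_le (by linarith) hρ0.le
  have hlog := Real.log_nonneg hρ
  have e : ρ ^ (3 + 2 * β) = ρ ^ 3 * Real.exp (2 * β * Real.log ρ) := by
    rw [Real.rpow_add hρ0, Real.rpow_def_of_pos hρ0 (2 * β), mul_comm (Real.log ρ)]
    norm_cast
  have e2 : Real.exp (2 * β * Real.log ρ) * Real.exp (-(2 * β * Real.log ρ)) = 1 := by
    rw [← Real.exp_add]; simp
  calc ρ * jumpError p ρ
      = (Real.exp (2 * β * Real.log ρ) * Real.exp (-(2 * β * Real.log ρ))) *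
        (ρ * jumpError p ρ) := by rw [e2, one_mul]
    _ = tail p ρ * ρ ^ (3 + 2 * β) * (1 + Real.log ρ) * Real.exp (-(2 * β * Real.log ρ)) := by
        rw [e, jumpError]; ring
    _ ≤ _ := by gcongr

section Exit

variable {R : ℝ} {y : ℤ × ℤ}

lemma hitDist_mem_Icc (p : PMF (ℤ × ℤ)) (A : Set (ℤ × ℤ)) (x y : ℤ × ℤ) :
    hitDist p A x y ∈ Set.Icc (0 : ℝ) 1 := by
  rw [hitDist_eq_reachProb]
  exact reachProb_mem_Icc _ _ _ _

lemma hitDist_self (p : PMF (ℤ × ℤ)) {A : Set (ℤ × ℤ)} (hy : y ∈ A) : hitDist p A y y = 1 := by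
  rw [hitDist_eq_reachProb]
  exact reachProb_of_mem p ⟨rfl, hy⟩

lemma hitDist_of_ne (p : PMF (ℤ × ℤ)) {A : Set (ℤ × ℤ)} {x : ℤ × ℤ} (hx : x ∈ A) (hxy : x ≠ y) :
    hitDist p A x y = 0 := by
  rw [hitDist_eq_reachProb]
  exact reachProb_of_notMem p hx fun h => hxy h.1

lemma transOp_hitDist (p : PMF (ℤ × ℤ)) {A : Set (ℤ × ℤ)} {x : ℤ × ℤ} (hx : x ∉ A)
    (y : ℤ × ℤ) : transOp p (fun z => hitDist p A z y) x = hitDist p A x y := by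
  simp only [hitDist_eq_reachProb]
  exact reachProb_eq_transOp p hx fun h => hx h.2

lemma mem_compl_disc_zero {z : ℤ × ℤ} : z ∈ (disc 0 R)ᶜ ↔ R ≤ euclid z := by
  rw [Set.mem_compl_iff, mem_disc_zero, not_lt]

/-- A boundary point that cannot be entered from the disc carries no exit probability. -/
lemma hitDist_eq_zero_of_sum_eq_zero (hp : RegularWalk p)
    (h : ∑ w ∈ discF 0 R, step p (w - y) = 0) {x : ℤ × ℤ} (hx : euclid x < R) :
    hitDist p (disc 0 R)ᶜ x y = 0 := by
  obtain ⟨s, hs0, hs⟩ := exists_step_pos hp.cov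
  have hf : Bdd fun z => hitDist p (disc 0 R)ᶜ z y := .of_mem_Icc fun z => hitDist_mem_Icc p _ z y
  have hxR : x ∈ disc 0 R := mem_disc_zero.mpr hx
  have hzero : ∀ w ∈ discF 0 R, step p (w - y) = 0 :=
    (Finset.sum_eq_zero_iff_of_nonneg fun w _ => step_nonneg p _).mp h
  -- Outside the disc the exit distribution is supported at `y`, which no step from inside can
  -- reach. Cutting it off outside therefore preserves harmonicity, and the maximum principle
  -- applies with zero boundary values.
  have key := nonpos_of_subharmonic (p := p) (disc_finite 0 R) hs0 hs (hf.indicator (disc 0 R))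
    (fun w hw => ?_) (fun w hw => ?_) x
  · rw [Set.indicator_of_mem hxR] at key
    exact le_antisymm key (hitDist_mem_Icc p _ x y).1
  · rw [Set.indicator_of_mem hw, ← transOp_hitDist p (Set.notMem_compl_iff.mpr hw) y]
    refine le_of_eq (tsum_congr fun z => ?_)
    beta_reduce
    by_cases hz : w + z ∈ disc 0 R
    · rw [Set.indicator_of_mem hz]
    · rw [Set.indicator_of_notMem hz, mul_zero]
      rcases eq_or_ne (w + z) y with hzy | hzy
      · have e : step p z = step p (w - y) := by
          rw [← hzy, show w - (w + z) = -z by abel, step_neg hp.symm]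
        rw [e, hzero w (by simpa [mem_discF] using mem_disc_zero.mp hw), zero_mul]
      · rw [hitDist_of_ne p hz hzy, mul_zero]
  · rw [Set.indicator_of_notMem hw]

/-- The scale `R / 256` is chosen so that `discAvg` averages over exactly `D(0, R)`. The factor `17`
is generously replaced by `65536 = 256²`. -/
lemma le_discAvg_hitDist (hp : RegularWalk p) (hR : baseRadius p ≤ R) (hy : R ≤ euclid y) :
    Real.exp (-8) / (2 * (thirdMoment p + 1)) / R * ∑ w ∈ discF 0 R, step p (w - y)
      ≤ discAvg (fun z => hitDist p (disc 0 R)ᶜ z y) (R / 256) := by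
  have hR1 : 1 ≤ R := (one_le_baseRadius p).trans hR
  have hf := fun z => hitDist_mem_Icc p (disc 0 R)ᶜ z y
  refine (sum_step_le_sum_discF hp hR (fun z => (hf z).1) (.of_mem_Icc hf)
    (fun z hz => transOp_hitDist p (by rw [mem_compl_disc_zero]; linarith) y) hy
    (hitDist_self p (mem_compl_disc_zero.mpr hy))).trans ?_
  rw [discAvg, mul_div_cancel₀ _ (by norm_num : (256 : ℝ) ≠ 0)]
  have h1 : ∑ w ∈ discF 0 (R / 2), hitDist p (disc 0 R)ᶜ w y
      ≤ ∑ w ∈ discF 0 R, hitDist p (disc 0 R)ᶜ w y := by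
    refine Finset.sum_le_sum_of_subset_of_nonneg (fun w hw => ?_) fun w _ _ => (hf w).1
    rw [mem_discF] at hw ⊢
    linarith
  have h0 : 0 ≤ ∑ w ∈ discF 0 R, hitDist p (disc 0 R)ᶜ w y :=
    Finset.sum_nonneg fun w _ => (hf w).1
  calc _ ≤ 17 / R ^ 2 * ∑ w ∈ discF 0 R, hitDist p (disc 0 R)ᶜ w y := by gcongr
    _ ≤ 65536 / R ^ 2 * ∑ w ∈ discF 0 R, hitDist p (disc 0 R)ᶜ w y := by
        gcongr
        norm_num
    _ = _ := by rw [div_pow]; field_simp; ring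

lemma euclid_bounds_of_mem_band {s : ℝ} (h : y ∈ band (disc 0 R) s) :
    R ≤ euclid y ∧ euclid y ≤ R + s := by
  refine ⟨by simpa [mem_disc_zero] using h.1, le_of_forall_pos_lt_add fun ε hε => ?_⟩
  have h2 : (⨅ x ∈ disc 0 R, ((euclid (y - x) : ℝ) : EReal)) < ((s + ε : ℝ) : EReal) :=
    h.2.trans_lt (EReal.coe_lt_coe_iff.mpr (by linarith))
  simp only [iInf_lt_iff, EReal.coe_lt_coe_iff] at h2
  obtain ⟨x, hx, hxs⟩ := h2
  rw [mem_disc_zero] at hx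
  have := euclid_le_add_sub y x
  linarith

end Exit

/-! ### Condition A -/

/-- Condition A at the scale `s = n ^ 4`. -/
lemma ConditionA.exists_le_sum_step {β : ℝ} (hβ : 0 < β) (hA : ConditionA p β) :
    ∃ c : ℝ, 0 < c ∧ ∀ᶠ n : ℕ in atTop, ∀ R : ℝ, (n : ℝ) ^ 4 ≤ R → ∀ y : ℤ × ℤ, R ≤ euclid y →
      euclid y ≤ R + (n : ℝ) ^ 4 → ∑ w ∈ discF 0 R, step p (w - y) = 0 ∨
        c * Real.exp (-(β * n)) ≤ ∑ w ∈ discF 0 R, step p (w - y) := by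
  rcases hA with hfin | ⟨c, hc, s₀, h⟩
  -- For finite range there is a smallest positive step probability. A point from which the disc can
  -- be entered at all has at least this probability of entering it.
  · obtain ⟨s, hs, hmin⟩ := hfin.exists_minimalFor (step p) p.support p.support_nonempty
    have hs0 : 0 < step p s := step_pos_iff.mpr hs
    refine ⟨step p s, hs0, .of_forall fun n R _ y _ _ => ?_⟩
    by_cases hzero : ∀ w ∈ discF 0 R, step p (w - y) = 0
    · exact .inl (Finset.sum_eq_zero hzero)
    · push Not at hzero
      obtain ⟨w, hw, hne⟩ := hzero
      right
      have hpos : 0 < step p (w - y) := (step_nonneg p _).lt_of_ne' hne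
      have h1 : step p s ≤ step p (w - y) := by
        rcases le_total (step p s) (step p (w - y)) with h | h
        · exact h
        · exact hmin (step_pos_iff.mp hpos) h
      have h2 : step p (w - y) ≤ ∑ w ∈ discF 0 R, step p (w - y) :=
        Finset.single_le_sum (f := fun w => step p (w - y)) (fun w _ => step_nonneg p _) hw
      have h3 : Real.exp (-(β * n)) ≤ 1 := by
        rw [Real.exp_le_one_iff, neg_nonpos]; positivity
      calc step p s * Real.exp (-(β * n)) ≤ step p s * 1 := by gcongr
        _ ≤ _ := by linarith
  · refine ⟨c, hc, ?_⟩
    have hev : ∀ᶠ n : ℕ in atTop, s₀ ≤ (n : ℝ) ^ 4 :=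
      ((tendsto_pow_atTop (by norm_num)).comp tendsto_natCast_atTop_atTop).eventually_ge_atTop s₀
    filter_upwards [hev] with n hn R hR y hy hy'
    right
    have h1 := h _ R hn hR y hy hy'
    have e1 : ((n : ℝ) ^ 4) ^ (1 / 4 : ℝ) = n := by
      rw [← Real.rpow_natCast, ← Real.rpow_mul (by positivity)]
      norm_num
    rw [e1] at h1
    refine h1.trans (le_of_eq ?_)
    rw [tsum_subtype (disc 0 R) (fun z => trans p y z), tsum_eq_sum (s := discF 0 R)]
    · refine Finset.sum_congr rfl fun w hw => ?_
      rw [mem_discF] at hw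
      rw [Set.indicator_of_mem (show w ∈ disc 0 R from hw), trans]
    · intro w hw
      rw [mem_discF] at hw
      exact Set.indicator_of_notMem (show w ∉ disc 0 R from hw) _

/-! ### The Harnack inequality for the exit distribution -/

lemma eventually_mul_pow_le_exp (K : ℝ) (k : ℕ) {b : ℝ} (hb : 0 < b) :
    ∀ᶠ x : ℝ in atTop, K * x ^ k ≤ Real.exp (b * x) := by
  have h := (isLittleO_pow_exp_pos_mul_atTop k hb).bound (c := 1 / (|K| + 1)) (by positivity)
  filter_upwards [h, eventually_ge_atTop 0] with x hx hx0
  rw [Real.norm_eq_abs, Real.norm_eq_abs, Real.abs_exp, abs_of_nonneg (by positivity),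
    one_div_mul_eq_div, le_div_iff₀ (by positivity)] at hx
  have := le_abs_self K
  have h2 : 0 ≤ x ^ k := by positivity
  nlinarith

lemma eventually_natCast_mul_pow_le_exp (K : ℝ) (k : ℕ) :
    ∀ᶠ n : ℕ in atTop, K * (n : ℝ) ^ k ≤ Real.exp n := by
  simpa using tendsto_natCast_atTop_atTop.eventually (eventually_mul_pow_le_exp K k one_pos)

/-- Write `x = log R ≥ n`. Of the decay `e ^ (-2βx)`, one factor `e ^ (-βx)` absorbs the polynomial
`(1 + x) n³` and the other is at most `e ^ (-βn)`. This is where the exponent `3 + 2β` meets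
Condition A with the same `β`. -/
lemma HasMoment.eventually_jumpError_le {β : ℝ} (hβ : 0 < β) (h : HasMoment p (3 + 2 * β)) {κ : ℝ}
    (hκ : 0 < κ) :
    ∀ᶠ n : ℕ in atTop, ∀ R : ℝ, Real.exp n ≤ R →
      jumpError p (R / 256) ≤ 1 / (n : ℝ) ^ 3 * (κ * Real.exp (-(β * n)) / R) := by
  obtain ⟨m, hm⟩ : ∃ m, m = ∑' x : ℤ × ℤ, euclid x ^ (3 + 2 * β) * step p x := ⟨_, rfl⟩
  have hm0 : 0 ≤ m := hm ▸ tsum_nonneg fun x =>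
    mul_nonneg (Real.rpow_nonneg (euclid_nonneg x) _) (step_nonneg p x)
  obtain ⟨x₀, hx₀⟩ := eventually_atTop.mp
    (eventually_mul_pow_le_exp (256 * m * 2 * Real.exp (2 * β * Real.log 256) / κ) 4 hβ)
  filter_upwards [tendsto_natCast_atTop_atTop.eventually_ge_atTop x₀, eventually_ge_atTop 1,
    eventually_natCast_mul_pow_le_exp 256 0] with n hn hn1 h256 R hR
  have hR256 : 256 ≤ R := by simpa using h256.trans hR
  have hR0 : 0 < R := by linarith
  have hn0 : (1 : ℝ) ≤ n := by exact_mod_cast hn1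
  have hnx : (n : ℝ) ≤ Real.log R := (Real.le_log_iff_exp_le hR0).mpr hR
  have h1 := h.mul_jumpError_le hβ (ρ := R / 256) ((one_le_div (by norm_num)).mpr hR256)
  rw [← hm, Real.log_div hR0.ne' (by norm_num)] at h1
  have h2 := hx₀ _ (hn.trans hnx)
  generalize Real.log R = x at *
  have hl256 : 0 ≤ Real.log 256 := Real.log_nonneg (by norm_num)
  have e1 : Real.exp (-(2 * β * (x - Real.log 256)))
      = Real.exp (2 * β * Real.log 256) * (Real.exp (-(β * x)) * Real.exp (-(β * x))) := by
    rw [← Real.exp_add, ← Real.exp_add]; ring_nf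
  rw [e1] at h1
  generalize Real.log 256 = L at *
  have hE := Real.exp_pos (2 * β * L)
  generalize Real.exp (2 * β * L) = E at *
  rw [div_mul_eq_mul_div, div_le_iff₀ hκ] at h2
  have e3 : Real.exp (β * x) * Real.exp (-(β * x)) = 1 := by rw [← Real.exp_add]; simp
  have hex := Real.exp_pos (-(β * x))
  have h4 : Real.exp (-(β * x)) ≤ Real.exp (-(β * n)) := by
    rw [Real.exp_le_exp]; nlinarith
  rw [← mul_div_assoc, le_div_iff₀ hR0, one_div_mul_eq_div, le_div_iff₀ (by positivity)]
  calc jumpError p (R / 256) * R * n ^ 3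
      = 256 * (R / 256 * jumpError p (R / 256)) * n ^ 3 := by ring
    _ ≤ 256 * (m * (1 + (x - L)) * (E * (Real.exp (-(β * x)) * Real.exp (-(β * x))))) * n ^ 3 := by
        gcongr
    _ = 256 * (m * E) * ((1 + (x - L)) * n ^ 3) * (Real.exp (-(β * x)) * Real.exp (-(β * x))) := by
        ring
    _ ≤ 256 * (m * E) * ((2 * x) * x ^ 3) * (Real.exp (-(β * x)) * Real.exp (-(β * x))) := by
        gcongr <;> linarith
    _ = (256 * m * 2 * E * x ^ 4) * Real.exp (-(β * x)) * Real.exp (-(β * x)) := by ring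
    _ ≤ (Real.exp (β * x) * κ) * Real.exp (-(β * x)) * Real.exp (-(β * x)) := by gcongr
    _ = κ * Real.exp (-(β * x)) := by
        rw [show Real.exp (β * x) * κ * Real.exp (-(β * x)) * Real.exp (-(β * x))
          = Real.exp (β * x) * Real.exp (-(β * x)) * (κ * Real.exp (-(β * x))) by ring, e3, one_mul]
    _ ≤ κ * Real.exp (-(β * n)) := by gcongr

/-- Harnack is used with `l ^ 32 = R / 256` and `η = n⁻³`. Each error is of order `n⁻³`: the
relative distance by the choice of points, `1 / l` because `R ≥ e ^ n ≥ 256 n ^ 96`, and the long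
jumps by Condition A. The radius `2 R / n³` is wide enough for the band around `D(0, r)` as well. -/
theorem exists_hitDist_harnack (hp : RegularWalk p) {β : ℝ} (hβ : 0 < β)
    (hmom : HasMoment p (3 + 2 * β)) (hA : ConditionA p β) :
    ∃ C : ℝ, 0 ≤ C ∧ ∀ᶠ n : ℕ in atTop, ∀ R : ℝ, Real.exp n ≤ R → ∀ y : ℤ × ℤ, R ≤ euclid y →
      euclid y ≤ R + (n : ℝ) ^ 4 → ∀ x x' : ℤ × ℤ, euclid x ≤ 2 * (R / (n : ℝ) ^ 3) →
      euclid x' ≤ 2 * (R / (n : ℝ) ^ 3) →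
      |hitDist p (disc 0 R)ᶜ x y - hitDist p (disc 0 R)ᶜ x' y|
        ≤ C / (n : ℝ) ^ 3 * hitDist p (disc 0 R)ᶜ x' y := by
  obtain ⟨C, l₀, hC, hl₀, H⟩ := exists_harnack hp
  obtain ⟨c, hc, hcA⟩ := hA.exists_le_sum_step hβ
  obtain ⟨κ, hκ⟩ : ∃ κ, κ = Real.exp (-8) / (2 * (thirdMoment p + 1)) := ⟨_, rfl⟩
  have hκ0 : 0 < κ := by
    have := thirdMoment_nonneg p
    rw [hκ]; positivity
  refine ⟨C * 1026, by positivity, ?_⟩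
  filter_upwards [hcA, hmom.eventually_jumpError_le hβ (mul_pos hκ0 hc),
    eventually_natCast_mul_pow_le_exp 1 4, eventually_natCast_mul_pow_le_exp 256 96,
    eventually_natCast_mul_pow_le_exp (baseRadius p) 0, eventually_ge_atTop 2048,
    tendsto_natCast_atTop_atTop.eventually_ge_atTop l₀,
    tendsto_natCast_atTop_atTop.eventually_ge_atTop C]
    with n hcA hjump h4 h96 hbase h2048 hnl hnC R hR y hy hy' x x' hx hx'
  have hn : (2048 : ℝ) ≤ n := by exact_mod_cast h2048
  rw [one_mul] at h4
  rw [pow_zero, mul_one] at hbase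
  have hR0 : 0 < R := (Real.exp_pos _).trans_le hR
  have hn3 : (n : ℝ) ≤ (n : ℝ) ^ 3 := le_self_pow₀ (by linarith) (by norm_num)
  have hn30 : 0 < (n : ℝ) ^ 3 := by linarith
  have h2R : 2 * (R / (n : ℝ) ^ 3) ≤ R / 256 / 4 := by
    rw [← mul_div_assoc, div_le_iff₀ hn30]
    have : R * 2048 ≤ R * (n : ℝ) ^ 3 := by gcongr; linarith
    linarith
  rcases hcA R (h4.trans hR) y hy hy' with hzero | hpos
  · rw [hitDist_eq_zero_of_sum_eq_zero hp hzero (by linarith),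
      hitDist_eq_zero_of_sum_eq_zero hp hzero (by linarith)]
    simp
  obtain ⟨l, hl⟩ : ∃ l, l = (R / 256) ^ (1 / 32 : ℝ) := ⟨_, rfl⟩
  have hl0 : 0 ≤ l := hl ▸ Real.rpow_nonneg (by positivity) _
  have hlR : l ^ 32 = R / 256 := by
    rw [hl, ← Real.rpow_natCast, ← Real.rpow_mul (by positivity)]
    norm_num
  have hln : (n : ℝ) ^ 3 ≤ l := by
    refine le_of_pow_le_pow_left₀ (n := 32) (by norm_num) hl0 ?_
    rw [hlR, ← pow_mul, le_div_iff₀ (by norm_num)]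
    norm_num at h96 ⊢
    linarith
  have hHl := H l (by linarith) (fun z => hitDist p (disc 0 R)ᶜ z y) (1 / (n : ℝ) ^ 3)
    (fun z => hitDist_mem_Icc p _ z y) (fun z hz => transOp_hitDist p (by
      rw [mem_compl_disc_zero, not_le]
      rw [hlR] at hz
      linarith) y) (by rw [mul_one_div, div_le_one hn30]; linarith) (by
      rw [hlR]
      refine (hjump R hR).trans (mul_le_mul_of_nonneg_left ?_ (by positivity))
      refine le_trans ?_ (le_discAvg_hitDist hp (hbase.trans hR) hy)
      rw [← hκ]
      calc κ * c * Real.exp (-(β * n)) / R = κ / R * (c * Real.exp (-(β * n))) := by ring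
        _ ≤ _ := by gcongr) x x' (by rw [hlR]; linarith) (by rw [hlR]; linarith)
  refine hHl.trans (mul_le_mul_of_nonneg_right ?_ (hitDist_mem_Icc p _ x' y).1)
  rw [hlR, mul_div_assoc]
  gcongr
  have h1 : euclid (x - x') / (R / 256) ≤ 1024 / (n : ℝ) ^ 3 := by
    have h2 := euclid_add_le x (-x')
    rw [euclid_neg, ← sub_eq_add_neg] at h2
    calc euclid (x - x') / (R / 256) ≤ 4 * (R / (n : ℝ) ^ 3) / (R / 256) := by
          gcongr
          linarith
      _ = 1024 / (n : ℝ) ^ 3 := by field_simp; norm_num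
  have h2 : 1 / l ≤ 1 / (n : ℝ) ^ 3 := one_div_le_one_div_of_le hn30 hln
  calc _ ≤ 1024 / (n : ℝ) ^ 3 + 1 / (n : ℝ) ^ 3 + 1 / (n : ℝ) ^ 3 := by gcongr
    _ = 1026 / (n : ℝ) ^ 3 := by ring

end PlanarWalk

namespace PlanarWalk

variable {p : PMF (ℤ × ℤ)}

open Filter

/-! ### Escaping from a small disc -/

lemma radialC3_log_one_add : RadialC3 (fun x => Real.log (1 + x)) (fun x => (1 + x)⁻¹)
    (fun x => -((1 + x) ^ 2)⁻¹) (fun x => 2 * ((1 + x) ^ 3)⁻¹) 2 where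
  deriv0 x hx := by
    have h1 : HasDerivAt (fun x : ℝ => 1 + x) 1 x := (hasDerivAt_id x).const_add 1
    simpa using h1.log (by positivity)
  deriv1 x hx := by
    have h1 : HasDerivAt (fun x : ℝ => 1 + x) 1 x := (hasDerivAt_id x).const_add 1
    refine (h1.inv (by positivity)).congr_deriv ?_
    rw [neg_div, one_div]
  deriv2 x hx := by
    have h1 : HasDerivAt (fun x : ℝ => 1 + x) 1 x := (hasDerivAt_id x).const_add 1
    have : 1 + x ≠ 0 := by positivity
    refine (((h1.pow 2).inv (pow_ne_zero 2 this)).neg).congr_deriv ?_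
    simp only [Pi.pow_apply]
    field_simp
    push_cast
    ring
  bound2 y hy := by
    rw [abs_neg, abs_of_nonneg (by positivity), inv_mul_le_iff₀ (by positivity)]
    nlinarith [sq_nonneg (y - 1), sq_nonneg (y ^ 2)]
  bound3 y hy := by
    rw [abs_of_nonneg (by positivity), mul_assoc, mul_comm]
    refine mul_le_of_le_one_left (by norm_num) ?_
    rw [inv_mul_le_one₀ (by positivity)]
    gcongr
    nlinarith [sq_nonneg (y - 1)]

/-- Up to scaling this is the Laplacian of `log (1 + |w|²)`. It is strictly positive, unlike that of
the pure logarithm, which leaves room for discretisation errors. -/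
lemma one_add_inv_sub (x : ℝ) (hx : 0 ≤ x) :
    (1 + x)⁻¹ + x * -((1 + x) ^ 2)⁻¹ = ((1 + x) ^ 2)⁻¹ := by
  have : 1 + x ≠ 0 := by positivity
  field_simp
  ring

/-- A bounded potential growing logarithmically between the scales `s` and `s * t`. -/
noncomputable def logPotential (s t : ℝ) (w : ℤ × ℤ) : ℝ :=
  Real.log (1 + euclid w ^ 2 / s ^ 2) - Real.log (1 + euclid w ^ 2 / (s * t) ^ 2)

section Potential

variable {s t : ℝ}

lemma logPotential_le (hs : 0 < s) (ht : 1 ≤ t) (w : ℤ × ℤ) :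
    logPotential s t w ≤ 2 * Real.log t := by
  have ht0 : 0 < t := by linarith
  have h : 1 + euclid w ^ 2 / s ^ 2 ≤ t ^ 2 * (1 + euclid w ^ 2 / (s * t) ^ 2) := by
    have e : t ^ 2 * (1 + euclid w ^ 2 / (s * t) ^ 2) = t ^ 2 + euclid w ^ 2 / s ^ 2 := by
      field_simp
    rw [e]
    linarith [one_le_pow₀ ht (n := 2)]
  have h1 := Real.log_le_log (by positivity) h
  rw [Real.log_mul (by positivity) (by positivity), Real.log_pow] at h1
  rw [logPotential]
  push_cast at h1
  linarith

lemma logPotential_nonneg (hs : 0 < s) (ht : 1 ≤ t) (w : ℤ × ℤ) : 0 ≤ logPotential s t w := by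
  rw [logPotential, sub_nonneg]
  refine Real.log_le_log (by positivity) ?_
  gcongr
  exact le_mul_of_one_le_right hs.le ht

lemma bdd_logPotential (hs : 0 < s) (ht : 1 ≤ t) : Bdd (logPotential s t) :=
  .of_mem_Icc fun w => ⟨logPotential_nonneg hs ht w, logPotential_le hs ht w⟩

lemma logPotential_le_log_two (hs : 0 < s) {w : ℤ × ℤ} (hw : euclid w < s) :
    logPotential s t w ≤ Real.log 2 := by
  have h1 : euclid w ^ 2 / s ^ 2 ≤ 1 := by
    rw [div_le_one (by positivity)]
    exact pow_le_pow_left₀ (euclid_nonneg w) hw.le 2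
  have h2 : Real.log (1 + euclid w ^ 2 / s ^ 2) ≤ Real.log 2 :=
    Real.log_le_log (by positivity) (by linarith)
  have h3 : 0 ≤ Real.log (1 + euclid w ^ 2 / (s * t) ^ 2) :=
    Real.log_nonneg (by linarith [show 0 ≤ euclid w ^ 2 / (s * t) ^ 2 by positivity])
  rw [logPotential]
  linarith

lemma le_logPotential (hs : 0 < s) (ht : 0 < t) {a : ℝ} (ha : 0 < a) {w : ℤ × ℤ}
    (h1 : s * a ≤ euclid w) (h2 : euclid w ≤ s * t) :
    2 * Real.log a - Real.log 2 ≤ logPotential s t w := by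
  have e1 : a ^ 2 ≤ 1 + euclid w ^ 2 / s ^ 2 := by
    have : a ^ 2 ≤ euclid w ^ 2 / s ^ 2 := by
      rw [le_div_iff₀ (by positivity), ← mul_pow, mul_comm]
      exact pow_le_pow_left₀ (by positivity) h1 2
    linarith
  have e2 : euclid w ^ 2 / (s * t) ^ 2 ≤ 1 := by
    rw [div_le_one (by positivity)]
    exact pow_le_pow_left₀ (euclid_nonneg w) h2 2
  have e3 : Real.log (1 + euclid w ^ 2 / (s * t) ^ 2) ≤ Real.log 2 :=
    Real.log_le_log (by positivity) (by linarith)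
  have e4 := Real.log_le_log (by positivity) e1
  rw [Real.log_pow] at e4
  rw [logPotential]
  push_cast at e4
  linarith

/-- The potential is subharmonic well inside the larger scale. -/
lemma logPotential_le_transOp (hp : RegularWalk p) (hs : 0 < s) {b : ℝ} (hb : 1 ≤ b)
    (ht : 8 * b ^ 4 ≤ t ^ 2) (ht0 : 1 ≤ t) (hsb : 320 * thirdMoment p * b ^ 4 ≤ s) {w : ℤ × ℤ}
    (hw : euclid w ≤ s * b) :
    logPotential s t w ≤ transOp p (logPotential s t) w := by
  have hst : 0 < s * t := by positivity
  obtain ⟨s1, h1⟩ := radialC3_log_one_add.abs_transOp_sub_le hp.symm hp.cov hp.third hs 0 w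
  obtain ⟨s2, h2⟩ := radialC3_log_one_add.abs_transOp_sub_le hp.symm hp.cov hp.third hst 0 w
  have hT : transOp p (logPotential s t) w = transOp p (radial (fun x => Real.log (1 + x)) s 0) w
      - transOp p (radial (fun x => Real.log (1 + x)) (s * t) 0) w := by
    simp only [transOp]
    rw [← s1.tsum_sub s2]
    refine tsum_congr fun z => ?_
    simp only [logPotential, radial, sub_zero]
    ring
  rw [one_add_inv_sub _ (by positivity), sub_zero] at h1 h2
  have hM := thirdMoment_nonneg p
  have hr : logPotential s t w = radial (fun x => Real.log (1 + x)) s 0 w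
      - radial (fun x => Real.log (1 + x)) (s * t) 0 w := by
    simp only [logPotential, radial, sub_zero]
  -- Error budget: half of this positive drift pays for the subtracted logarithm at scale `s t`, the
  -- other half for the two Taylor remainders.
  have b1 : 1 / (2 * b ^ 4 * s ^ 2) ≤ 2 / s ^ 2 * ((1 + euclid w ^ 2 / s ^ 2) ^ 2)⁻¹ := by
    have h3 : 1 + euclid w ^ 2 / s ^ 2 ≤ 2 * b ^ 2 := by
      have : euclid w ^ 2 / s ^ 2 ≤ b ^ 2 := by
        rw [div_le_iff₀ (by positivity), ← mul_pow, mul_comm]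
        exact pow_le_pow_left₀ (euclid_nonneg w) hw 2
      linarith [one_le_pow₀ hb (n := 2)]
    calc 1 / (2 * b ^ 4 * s ^ 2) = 2 / s ^ 2 * ((2 * b ^ 2) ^ 2)⁻¹ := by field_simp
      _ ≤ _ := by gcongr
  have b2 : 2 / (s * t) ^ 2 * ((1 + euclid w ^ 2 / (s * t) ^ 2) ^ 2)⁻¹ ≤ 1 / (4 * b ^ 4 * s ^ 2) := by
    have h3 : 1 ≤ (1 + euclid w ^ 2 / (s * t) ^ 2) ^ 2 :=
      one_le_pow₀ (by linarith [show 0 ≤ euclid w ^ 2 / (s * t) ^ 2 by positivity])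
    calc _ ≤ 2 / (s * t) ^ 2 * 1 := by
          gcongr
          exact inv_le_one_of_one_le₀ h3
      _ = 2 / (t ^ 2 * s ^ 2) := by rw [mul_one, mul_pow, mul_comm (s ^ 2)]
      _ ≤ 2 / (8 * b ^ 4 * s ^ 2) := by gcongr
      _ = _ := by field_simp; norm_num
  have b3 : 20 * 2 * thirdMoment p / (s * t) ^ 3 ≤ 20 * 2 * thirdMoment p / s ^ 3 := by
    gcongr
    exact le_mul_of_one_le_right hs.le ht0
  have b4 : 2 * (20 * 2 * thirdMoment p / s ^ 3) ≤ 1 / (4 * b ^ 4 * s ^ 2) := by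
    rw [← mul_div_assoc, div_le_div_iff₀ (by positivity) (by positivity)]
    have := mul_le_mul_of_nonneg_left hsb (sq_nonneg s)
    linarith
  have b5 : 1 / (2 * b ^ 4 * s ^ 2) = 1 / (4 * b ^ 4 * s ^ 2) + 1 / (4 * b ^ 4 * s ^ 2) := by
    field_simp; norm_num
  rw [hT, hr]
  linarith [(abs_le.mp h1).1, (abs_le.mp h2).2]

end Potential

/-! ### Comparison principles for escape and exit probabilities -/

section Annulus

variable {A B : Set (ℤ × ℤ)}

/-- A lower bound on the probability to reach `A` before `B` by a subharmonic function. -/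
lemma le_reachProb_mul (hp : RegularWalk p) (hfin : Aᶜ.Finite) {Φ : ℤ × ℤ → ℝ} (hΦ : Bdd Φ)
    {a L : ℝ} (hsub : ∀ z, z ∉ A → z ∉ B → Φ z ≤ transOp p Φ z)
    (hA : ∀ z ∈ A, z ∉ B → Φ z ≤ a + L) (hB : ∀ z ∈ B, Φ z ≤ a) (x : ℤ × ℤ) :
    Φ x - a ≤ L * reachProb p (A \ B) (A ∪ B) x := by
  obtain ⟨s, hs0, hs⟩ := exists_step_pos hp.cov
  have hq : Bdd (reachProb p (A \ B) (A ∪ B)) := .of_mem_Icc (reachProb_mem_Icc p _ _)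
  have hqL : Bdd fun z => L * reachProb p (A \ B) (A ∪ B) z := (Bdd.const L).mul hq
  have hu := (hΦ.sub (Bdd.const a)).sub hqL
  have key := nonpos_of_subharmonic (p := p) (D := Aᶜ \ B) (hfin.subset Set.sdiff_subset) hs0 hs hu
    (fun z hz => ?_) (fun z hz => ?_) x
  · linarith
  · rw [transOp_sub (hΦ.sub (Bdd.const a)) hqL, transOp_sub hΦ (Bdd.const a), transOp_const,
      transOp_const_mul, reachProb_eq_transOp p (fun h => h.elim hz.1 hz.2) (fun h => hz.1 h.1)]
    have := hsub z hz.1 hz.2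
    linarith
  · by_cases hzB : z ∈ B
    · rw [reachProb_of_notMem p (.inr hzB) (fun h => h.2 hzB)]
      have := hB z hzB
      linarith
    · have hzA : z ∈ A := by
        by_contra h
        exact hz ⟨h, hzB⟩
      rw [reachProb_of_mem p (show z ∈ A \ B from ⟨hzA, hzB⟩)]
      have := hA z hzA hzB
      linarith

/-- Reaching `y ∈ A` after a visit to `B`, compared with the extreme values on `B` of the hitting
distribution. -/
lemma reachProb_sub_le (hp : RegularWalk p) (hfin : Aᶜ.Finite) (y : ℤ × ℤ)
    {σ M : ℝ} (hM : ∀ z ∈ B, σ * reachProb p ({y} ∩ A) A z ≤ M) (x : ℤ × ℤ) :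
    σ * (reachProb p ({y} ∩ A) A x - reachProb p (({y} ∩ A) \ B) (A ∪ B) x)
      ≤ (1 - reachProb p (A \ B) (A ∪ B) x) * M := by
  obtain ⟨s, hs0, hs⟩ := exists_step_pos hp.cov
  have hb : ∀ Y S, Bdd (reachProb p Y S) := fun Y S => .of_mem_Icc (reachProb_mem_Icc p Y S)
  have h1 : Bdd fun z => reachProb p ({y} ∩ A) A z - reachProb p (({y} ∩ A) \ B) (A ∪ B) z :=
    (hb _ _).sub (hb _ _)
  have h2 : Bdd fun z => 1 - reachProb p (A \ B) (A ∪ B) z := (Bdd.const 1).sub (hb _ _)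
  have h3 : Bdd fun z => σ * (reachProb p ({y} ∩ A) A z - reachProb p (({y} ∩ A) \ B) (A ∪ B) z) :=
    (Bdd.const σ).mul h1
  have h4 : Bdd fun z => M * (1 - reachProb p (A \ B) (A ∪ B) z) := (Bdd.const M).mul h2
  have key := nonpos_of_subharmonic (p := p) (D := Aᶜ \ B) (hfin.subset Set.sdiff_subset) hs0 hs
    (h3.sub h4) (fun z hz => ?_) (fun z hz => ?_) x
  · linarith
  · have hzAB : z ∉ A ∪ B := fun h => h.elim hz.1 hz.2
    rw [transOp_sub h3 h4, transOp_const_mul, transOp_const_mul, transOp_sub (hb _ _) (hb _ _),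
      transOp_sub (Bdd.const 1) (hb _ _), transOp_const,
      reachProb_eq_transOp p hz.1 (fun h => hz.1 h.2),
      reachProb_eq_transOp p hzAB (fun h => hz.1 h.1.2),
      reachProb_eq_transOp p hzAB (fun h => hz.1 h.1)]
  · by_cases hzB : z ∈ B
    · rw [reachProb_of_notMem p (S := A ∪ B) (.inr hzB) (fun h => h.2 hzB),
        reachProb_of_notMem p (S := A ∪ B) (.inr hzB) (fun h => h.2 hzB)]
      have := hM z hzB
      linarith
    · have hzA : z ∈ A := by
        by_contra h
        exact hz ⟨h, hzB⟩
      rw [reachProb_of_mem p (show z ∈ A \ B from ⟨hzA, hzB⟩)]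
      have e : reachProb p ({y} ∩ A) A z = reachProb p (({y} ∩ A) \ B) (A ∪ B) z := by
        by_cases hzy : z ∈ ({y} : Set (ℤ × ℤ))
        · rw [reachProb_of_mem p (show z ∈ {y} ∩ A from ⟨hzy, hzA⟩),
            reachProb_of_mem p (show z ∈ ({y} ∩ A) \ B from ⟨⟨hzy, hzA⟩, hzB⟩)]
        · rw [reachProb_of_notMem p hzA (fun h => hzy h.1),
            reachProb_of_notMem p (.inl hzA) (fun h => hzy h.1.1)]
      rw [e]
      simp

/-- Conditioning on escape from `B` barely changes a hitting distribution that is nearly constant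
on `B`. -/
lemma abs_reachProb_sub_le (hp : RegularWalk p) (hfin : Aᶜ.Finite)
    (y : ℤ × ℤ) {ε δ : ℝ} (hδ : 0 < δ) (hε : 0 ≤ ε) {x : ℤ × ℤ}
    (hB : ∀ z ∈ B, |reachProb p ({y} ∩ A) A z - reachProb p ({y} ∩ A) A x|
      ≤ ε * reachProb p ({y} ∩ A) A x) (hq : δ ≤ reachProb p (A \ B) (A ∪ B) x) :
    |reachProb p (({y} ∩ A) \ B) (A ∪ B) x
        - reachProb p (A \ B) (A ∪ B) x * reachProb p ({y} ∩ A) A x|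
      ≤ ε / δ * (reachProb p (A \ B) (A ∪ B) x * reachProb p ({y} ∩ A) A x) := by
  have hH := (reachProb_mem_Icc p ({y} ∩ A) A x).1
  have hq1 := reachProb_mem_Icc p (A \ B) (A ∪ B) x
  have h1 := reachProb_sub_le hp hfin y (σ := 1)
    (M := (1 + ε) * reachProb p ({y} ∩ A) A x) (fun z hz => by
      linarith [(abs_le.mp (hB z hz)).2]) x
  -- The sign `σ = -1` converts the upper comparison into a lower one; the two together bracket the
  -- probability of exiting at `y` after visiting `B`.
  have h2 := reachProb_sub_le hp hfin y (σ := -1)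
    (M := -((1 - ε) * reachProb p ({y} ∩ A) A x)) (fun z hz => by
      linarith [(abs_le.mp (hB z hz)).1]) x
  generalize reachProb p ({y} ∩ A) A x = H at *
  generalize reachProb p (A \ B) (A ∪ B) x = q at *
  generalize reachProb p (({y} ∩ A) \ B) (A ∪ B) x = J at *
  have h3 : |J - q * H| ≤ ε * H := by
    have h4 : 0 ≤ q * (ε * H) := mul_nonneg hq1.1 (mul_nonneg hε hH)
    rw [abs_le]
    constructor <;> linarith
  refine h3.trans ?_
  rw [div_mul_eq_mul_div, le_div_iff₀ hδ]
  calc ε * H * δ ≤ ε * H * q := by gcongr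
    _ = _ := by ring

end Annulus

/-- From distance `r` the walk leaves `D(0, r n³)` before hitting `D(0, r / n³)` with probability
bounded below. -/
lemma eventually_le_reachProb (hp : RegularWalk p) :
    ∀ᶠ n : ℕ in atTop, ∀ r : ℝ, Real.exp n ≤ r → ∀ x : ℤ × ℤ, r ≤ euclid x →
      1 / 8 ≤ reachProb p ((disc 0 (r * (n : ℝ) ^ 3))ᶜ \ disc 0 (r / (n : ℝ) ^ 3))
        ((disc 0 (r * (n : ℝ) ^ 3))ᶜ ∪ disc 0 (r / (n : ℝ) ^ 3)) x := by
  filter_upwards [eventually_natCast_mul_pow_le_exp (320 * thirdMoment p) 27,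
    eventually_ge_atTop 2] with n hexp hn2 r hr x hx
  have hn : (2 : ℝ) ≤ n := by exact_mod_cast hn2
  have hn0 : (0 : ℝ) < n := by linarith
  obtain ⟨s, hs⟩ : ∃ s, s = r / (n : ℝ) ^ 3 := ⟨_, rfl⟩
  have hr0 : 0 < r := (Real.exp_pos _).trans_le hr
  have hs0 : 0 < s := hs ▸ by positivity
  have hsr : r = s * (n : ℝ) ^ 3 := by rw [hs]; field_simp
  have hsR : r * (n : ℝ) ^ 3 = s * (n : ℝ) ^ 6 := by rw [hsr]; ring
  rw [hsR, ← hs]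
  have hb : (1 : ℝ) ≤ (n : ℝ) ^ 6 := one_le_pow₀ (by linarith)
  by_cases hxD : euclid x < s * (n : ℝ) ^ 6
  swap
  · rw [reachProb_of_mem]
    · norm_num
    · refine ⟨mem_compl_disc_zero.mpr (not_lt.mp hxD), ?_⟩
      rw [mem_disc_zero, not_lt]
      refine le_trans ?_ hx
      rw [hsr]
      exact le_mul_of_one_le_right hs0.le (one_le_pow₀ (by linarith))
  -- With `b = n ^ 6` the potential is subharmonic up to the outer radius as soon as `t² ≥ 8 n ^
  -- 24`, hence this `t`. It exceeds the outer radius ratio, but the potential is bounded by `2 log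
  -- t` everywhere, so overshoots of any size are controlled.
  obtain ⟨t, ht⟩ : ∃ t : ℝ, t = 3 * (n : ℝ) ^ 12 := ⟨_, rfl⟩
  have h12 : (n : ℝ) ^ 6 ≤ (n : ℝ) ^ 12 := pow_le_pow_right₀ (by linarith) (by norm_num)
  have ht1 : 1 ≤ t := by linarith
  have hsb : 320 * thirdMoment p * ((n : ℝ) ^ 6) ^ 4 ≤ s := by
    rw [hs, le_div_iff₀ (by positivity)]
    refine le_trans (le_of_eq ?_) (hexp.trans hr)
    ring
  have key := le_reachProb_mul hp (A := (disc 0 (s * (n : ℝ) ^ 6))ᶜ) (B := disc 0 s)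
    (by rw [compl_compl]; exact disc_finite _ _) (bdd_logPotential hs0 ht1) (a := Real.log 2)
    (L := 2 * Real.log t - Real.log 2)
    (fun z hz _ => logPotential_le_transOp hp hs0 hb (by rw [ht]; nlinarith [sq_nonneg ((n : ℝ) ^ 12)])
      ht1 hsb (by
        rw [mem_compl_disc_zero, not_le] at hz
        exact hz.le))
    (fun z _ _ => by linarith [logPotential_le hs0 ht1 z])
    (fun z hz => logPotential_le_log_two hs0 (mem_disc_zero.mp hz)) x
  have hlow := le_logPotential hs0 (by linarith : 0 < t) (a := (n : ℝ) ^ 3) (by positivity)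
    (by rw [← hsr]; exact hx) (hxD.le.trans (by gcongr; linarith))
  have hlogn : Real.log 2 ≤ Real.log n := Real.log_le_log (by norm_num) hn
  have hlog3 : Real.log 3 ≤ 2 * Real.log 2 := by
    have := Real.log_le_log (by norm_num) (show (3 : ℝ) ≤ 2 ^ 2 by norm_num)
    rw [Real.log_pow] at this
    push_cast at this
    exact this
  have hlog2 : 0 < Real.log 2 := Real.log_pos (by norm_num)
  rw [ht, Real.log_mul (by norm_num) (by positivity), Real.log_pow] at key
  rw [Real.log_pow] at hlow
  rw [ht] at hlow
  push_cast at key hlow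
  generalize reachProb p _ _ x = q at *
  -- The start contributes at least `6 log n - 2 log 2`, against a total height of about `24 log n`.
  -- The ratio tends to `1/4`, and `1/8` leaves enough room for the constants already from `n = 2`.
  by_contra! hq
  have hpos : 0 < 2 * (Real.log 3 + 12 * Real.log n) - Real.log 2 := by
    have : 0 ≤ Real.log 3 := Real.log_nonneg (by norm_num)
    linarith
  have := mul_lt_mul_of_pos_left hq hpos
  linarith

/-- Points of `D(0, r)`, of its band and of `D(0, r / n³)` all lie within `2 r`, since `n ^ 4 ≤ e ^
n ≤ r`. One Harnack estimate thus serves both parts, and dividing by the escape probability `1/8`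
accounts for the constant `8 C`. -/
theorem exists_exit_disc_estimates (hp : RegularWalk p) {β : ℝ} (hβ : 0 < β)
    (hmom : HasMoment p (3 + 2 * β)) (hA : ConditionA p β) :
    ∃ C : ℝ, ∀ᶠ n : ℕ in atTop, ∀ r R : ℝ, Real.exp n ≤ r → r = R / (n : ℝ) ^ 3 →
      (∀ x ∈ disc 0 r, ∀ x' ∈ disc 0 r, ∀ y ∈ band (disc 0 R) ((n : ℝ) ^ 4),
        |hitDist p (disc 0 R)ᶜ x y - hitDist p (disc 0 R)ᶜ x' y|
          ≤ C / (n : ℝ) ^ 3 * hitDist p (disc 0 R)ᶜ x' y) ∧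
      (∀ x ∈ band (disc 0 r) ((n : ℝ) ^ 4), ∀ y ∈ band (disc 0 R) ((n : ℝ) ^ 4),
        |(stepsLaw p).real (hitsAt x (disc 0 R)ᶜ y ∩
              hitsBefore x (disc 0 R)ᶜ (disc 0 (r / (n : ℝ) ^ 3)))
            - (stepsLaw p).real (hitsBefore x (disc 0 R)ᶜ (disc 0 (r / (n : ℝ) ^ 3)))
              * hitDist p (disc 0 R)ᶜ x y|
          ≤ C / (n : ℝ) ^ 3 *
            ((stepsLaw p).real (hitsBefore x (disc 0 R)ᶜ (disc 0 (r / (n : ℝ) ^ 3)))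
              * hitDist p (disc 0 R)ᶜ x y)) := by
  obtain ⟨C, hC, H⟩ := exists_hitDist_harnack hp hβ hmom hA
  refine ⟨8 * C, ?_⟩
  filter_upwards [H, eventually_le_reachProb hp, eventually_natCast_mul_pow_le_exp 1 4,
    eventually_ge_atTop 1] with n H hq h4 hn1 r R hr hrR
  have hn : (1 : ℝ) ≤ n := by exact_mod_cast hn1
  have hn3 : 1 ≤ (n : ℝ) ^ 3 := one_le_pow₀ hn
  have hr0 : 0 < r := (Real.exp_pos _).trans_le hr
  have hR : R = r * (n : ℝ) ^ 3 := by rw [hrR]; field_simp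
  have hrleR : r ≤ R := hR ▸ le_mul_of_one_le_right hr0.le hn3
  have h8 : C / (n : ℝ) ^ 3 ≤ 8 * C / (n : ℝ) ^ 3 := by gcongr; linarith
  rw [one_mul] at h4
  refine ⟨fun x hx x' hx' y hy => ?_, fun x hx y hy => ?_⟩
  · rw [mem_disc_zero] at hx hx'
    obtain ⟨hy1, hy2⟩ := euclid_bounds_of_mem_band hy
    exact (H R (hr.trans hrleR) y hy1 hy2 x x' (by rw [← hrR]; linarith)
      (by rw [← hrR]; linarith)).trans
      (mul_le_mul_of_nonneg_right h8 (hitDist_mem_Icc p _ _ _).1)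
  · obtain ⟨hx1, hx2⟩ := euclid_bounds_of_mem_band hx
    obtain ⟨hy1, hy2⟩ := euclid_bounds_of_mem_band hy
    have hs : r / (n : ℝ) ^ 3 ≤ r := div_le_self hr0.le hn3
    have hx2r : euclid x ≤ 2 * r := by linarith
    have hqx := hq r hr x hx1
    rw [← hR] at hqx
    rw [hitsAt_inter_hitsBefore_eq_reach, hitsBefore_eq_reach, hitDist_eq_reachProb]
    have key := abs_reachProb_sub_le hp (A := (disc 0 R)ᶜ) (B := disc 0 (r / (n : ℝ) ^ 3))
      (by rw [compl_compl]; exact disc_finite _ _)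
      y (ε := C / (n : ℝ) ^ 3) (δ := 1 / 8) (by norm_num) (by positivity) (x := x)
      (fun z hz => by
        rw [mem_disc_zero] at hz
        have := H R (hr.trans hrleR) y hy1 hy2 z x (by rw [← hrR]; linarith)
          (by rw [← hrR]; linarith)
        simpa only [hitDist_eq_reachProb] using this) hqx
    rw [show 8 * C / (n : ℝ) ^ 3 = C / (n : ℝ) ^ 3 / (1 / 8) by ring]
    exact key

end PlanarWalk

theorem lemma3p1 (p : PMF (ℤ × ℤ)) (β : ℝ) (hβ : 0 < β)
    (hsymm : PlanarWalk.IsSymmetric p)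
    (haper : PlanarWalk.IsStronglyAperiodic p)
    (hcov : PlanarWalk.HasIdentityCovariance p)
    (hmom : PlanarWalk.HasMoment p (3 + 2 * β))
    (hA : PlanarWalk.ConditionA p β) :
    ∃ (C : ℝ) (N : ℕ), ∀ n : ℕ, N ≤ n → ∀ r R : ℝ, Real.exp n ≤ r → r = R / (n : ℝ) ^ 3 →
      (∀ x ∈ PlanarWalk.disc 0 r, ∀ x' ∈ PlanarWalk.disc 0 r,
        ∀ y ∈ PlanarWalk.band (PlanarWalk.disc 0 R) ((n : ℝ) ^ 4),
          |PlanarWalk.hitDist p (PlanarWalk.disc 0 R)ᶜ x y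
              - PlanarWalk.hitDist p (PlanarWalk.disc 0 R)ᶜ x' y|
            ≤ C / (n : ℝ) ^ 3 * PlanarWalk.hitDist p (PlanarWalk.disc 0 R)ᶜ x' y) ∧
      (∀ x ∈ PlanarWalk.band (PlanarWalk.disc 0 r) ((n : ℝ) ^ 4),
        ∀ y ∈ PlanarWalk.band (PlanarWalk.disc 0 R) ((n : ℝ) ^ 4),
          |(PlanarWalk.stepsLaw p).real
                (PlanarWalk.hitsAt x (PlanarWalk.disc 0 R)ᶜ y ∩
                  PlanarWalk.hitsBefore x (PlanarWalk.disc 0 R)ᶜ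
                    (PlanarWalk.disc 0 (r / (n : ℝ) ^ 3)))
              - (PlanarWalk.stepsLaw p).real
                  (PlanarWalk.hitsBefore x (PlanarWalk.disc 0 R)ᶜ
                    (PlanarWalk.disc 0 (r / (n : ℝ) ^ 3)))
                * PlanarWalk.hitDist p (PlanarWalk.disc 0 R)ᶜ x y|
            ≤ C / (n : ℝ) ^ 3 *
                ((PlanarWalk.stepsLaw p).real
                  (PlanarWalk.hitsBefore x (PlanarWalk.disc 0 R)ᶜ
                    (PlanarWalk.disc 0 (r / (n : ℝ) ^ 3)))
                * PlanarWalk.hitDist p (PlanarWalk.disc 0 R)ᶜ x y)) := by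
  have hp : PlanarWalk.RegularWalk p :=
    ⟨hsymm, haper, hcov, PlanarWalk.summable_third (by linarith) hmom⟩
  obtain ⟨C, hC⟩ := PlanarWalk.exists_exit_disc_estimates hp hβ hmom hA
  obtain ⟨N, hN⟩ := Filter.eventually_atTop.mp hC
  exact ⟨C, N, hN⟩
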